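/- Let $H$ be a finite-dimensional Hopf algebra over a field $k$, with comultiplication $\Delta(h)=\sum h_{(1)}\otimes h_{(2)}$ and counit $\epsilon$, and let $B$ be a right $H$-module algebra, i.e. a $k$-algebra with a right $H$-module structure such that $1\cdot h=\epsilon(h)1$ and $(bc)\cdot h=\sum (b\cdot h_{(1)})(c\cdot h_{(2)})$. Let $A=H\# B$ be the smash product: the vector space $H\otimes B$ with multiplication $(h\otimes b)(l\otimes c)=\sum hl_{(1)}\otimes (b\cdot l_{(2)})c$; it contains $H=H\otimes 1$ and is a left $H$-comodule algebra by $\Delta_A(h\otimes b)=\Delta(h)\otimes b$. For a left $H$-module $V$ and a left $A$-module $M$ the tensor product $V\otimes M$ over $k$ is an $A$-module via $\Delta_A$; likewise, $V\otimes W$ is an $H$-module via $\Delta$ for $H$-modules $V,W$. All modules are left modules. Let $\mathcal C$ be a class of $A$-modules closed under finite direct sums, subquotients and $M\mapsto H\otimes M$ (for instance all $A$-modules, or all finite-dimensional ones). Let $A_H\text{-}\underline{\mathrm{mod}}$ be the category of modules in $\mathcal C$ modulo the morphisms that factor through $H\otimes N$ for some $N\in\mathcal C$. Let $H\text{-}\underline{\mathrm{mod}}$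 be the stable category of $H$-modules, i.e. $H$-modules modulo the morphisms that factor through an injective module. A morphism of $A_H\text{-}\underline{\mathrm{mod}}$ is a quasi-isomorphism if it restricts to an isomorphism in $H\text{-}\underline{\mathrm{mod}}$, and $D(B,H)$ is the localization of $A_H\text{-}\underline{\mathrm{mod}}$ at the quasi-isomorphisms. A left integral is an element $\Lambda\neq 0$ of $H$ with $h\Lambda=\epsilon(h)\Lambda$ for all $h\in H$. Given one, put $T(M)=(H/k\Lambda)\otimes M$. For a morphism $u:X\to Y$ of modules let $C_u$ be the pushout of $u$ and $X\to H\otimes X$, $x\mapsto\Lambda\otimes x$, and let $w:C_u\to TX$ be the morphism that is zero on $Y$ and is the projection $H\otimes X\to TX$ on $H\otimes X$; the sequence $X\xrightarrow{u}Y\to C_u\xrightarrow{w}TX$ is the standard triangle of $u$. The Grothendieck group $K(\mathcal T)$ of a triangulated category $\mathcal T$ is generated by symbols $[X]$ for the objects $X$ of $\mathcal T$, with relations $[Y]=[X]+[Z]$ for all distinguished triangles $X\to Y\to Z\to X[1]$. Then a left integral exists, and for every left integral $\Lambda$ and every class $\mathcal C$ as above: 1. $D(B,H)$ is a triangulated category,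 with shift functor induced by $T$ and with distinguished triangles those isomorphic to images of standard triangles of modules in $\mathcal C$. 2. For every $H$-module $V$ such that $V\otimes M\in\mathcal C$ for all $M\in\mathcal C$ (every $V$, if $\mathcal C$ consists of all modules; every finite-dimensional $V$, for any $\mathcal C$), the functor $M\mapsto V\otimes M$ induces an exact functor $D(B,H)\to D(B,H)$, i.e. an additive functor that commutes with the shift and preserves distinguished triangles. 3. The stable category $H\text{-}\underline{\mathrm{mod}}$ of finite-dimensional $H$-modules is triangulated in the same way, with shift functor induced by $V\mapsto (H/k\Lambda)\otimes V$ and with distinguished triangles those isomorphic to images of standard triangles of finite-dimensional $H$-modules; its Grothendieck group $K(H\text{-}\underline{\mathrm{mod}})$ is a ring with $[V][W]=[V\otimes W]$ and $1=[k]$, where $H$ acts on $k$ by $\epsilon$; and $K(D(B,H))$ is a left module over this ring with $[V]\cdot[M]=[V\otimes M]$ for $V$ finite-dimensional and $M\in\mathcal C$. -/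

import Mathlib

open CategoryTheory CategoryTheory.Limits CategoryTheory.Pretriangulated TensorProduct
open scoped ModuleCat

universe u

set_option linter.unusedSectionVars false

noncomputable section

namespace Hopfological

/-! ### Comodule algebras, module algebras and the smash product -/

/-- A left `H`-comodule algebra: a `k`-algebra `A` with a coassociative and counital coaction
`A → H ⊗ A` that is a homomorphism of algebras. -/
class LeftComoduleAlgebra (k H A : Type u) [Field k] [Ring H] [Bialgebra k H]
    [Ring A] [Algebra k A] where
  coact : A →ₐ[k] H ⊗[k] A
  counit_coact : ∀ a : A,
    TensorProduct.lid k A ((Coalgebra.counit (R := k) (A := H)).rTensor A (coact a)) = a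
  coassoc_coact : ∀ a : A,
    TensorProduct.assoc k H H A ((Coalgebra.comul (R := k) (A := H)).rTensor A (coact a)) =
      coact.toLinearMap.lTensor H (coact a)

/-- `H` is a comodule algebra over itself through its comultiplication. -/
instance LeftComoduleAlgebra.self (k H : Type u) [Field k] [Ring H] [Bialgebra k H] :
    LeftComoduleAlgebra k H H where
  coact := Bialgebra.comulAlgHom k H
  counit_coact a := by simp
  coassoc_coact a := by
    simp

/-- A right `H`-module algebra: a `k`-algebra `B` with a right action `act b h = b · h` of `H`
for which the unit and the multiplication of `B` are maps of `H`-modules: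
`1 · h = ε(h) 1` and `(b c) · h = ∑ (b · h₍₁₎) (c · h₍₂₎)`. -/
class RightModuleAlgebra (k H B : Type u) [Field k] [Ring H] [Bialgebra k H]
    [Ring B] [Algebra k B] where
  act (k) : B →ₗ[k] H →ₗ[k] B
  act_one : ∀ b : B, act b 1 = b
  act_mul : ∀ (b : B) (h l : H), act b (h * l) = act (act b h) l
  one_act : ∀ h : H, act 1 h = algebraMap k B (Coalgebra.counit (R := k) h)
  mul_act : ∀ (b c : B) (h : H),
    act (b * c) h =
      LinearMap.mul' k B (TensorProduct.map (act b) (act c) (Coalgebra.comul (R := k) h))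

section Smash

variable (k H B : Type u) [Field k] [Ring H] [Bialgebra k H] [Ring B] [Algebra k B]
  [RightModuleAlgebra k H B]

open RightModuleAlgebra

/-- The underlying `k`-vector space `H ⊗ B` of the smash product `H # B`. -/
@[nolint unusedArguments]
def SmashProduct : Type u := H ⊗[k] B

namespace SmashProduct

instance : AddCommGroup (SmashProduct k H B) := inferInstanceAs (AddCommGroup (H ⊗[k] B))

instance : Module k (SmashProduct k H B) := inferInstanceAs (Module k (H ⊗[k] B))

/-- The element `h ⊗ b`. -/
def mk : H →ₗ[k] B →ₗ[k] SmashProduct k H B := TensorProduct.mk k H B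

variable {k H B} in
theorem induction_mk {p : SmashProduct k H B → Prop} (x : SmashProduct k H B) (h0 : p 0)
    (hm : ∀ h b, p (mk k H B h b)) (ha : ∀ x y, p x → p y → p (x + y)) : p x :=
  TensorProduct.induction_on (motive := p) x h0 hm ha

/-- For fixed `h`, `b`, `c`, the map `H ⊗ H → H ⊗ B`, `l ⊗ l' ↦ h l ⊗ (b · l') c`. -/
def twist (h : H) (b c : B) : H ⊗[k] H →ₗ[k] SmashProduct k H B :=
  TensorProduct.map (LinearMap.mulLeft k h) ((LinearMap.mulRight k c) ∘ₗ act k b)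

variable {k H B} in
theorem twist_tmul (h : H) (b c : B) (l l' : H) :
    twist k H B h b c (l ⊗ₜ l') = mk k H B (h * l) (act k b l' * c) := rfl

/-- The multiplication of the smash product on elementary tensors,
`(h ⊗ b) (l ⊗ c) = ∑ h l₍₁₎ ⊗ (b · l₍₂₎) c`. -/
def mulAux (h : H) (b : B) : SmashProduct k H B →ₗ[k] SmashProduct k H B :=
  TensorProduct.lift (LinearMap.mk₂ k
    (fun (l : H) (c : B) => twist k H B h b c (Coalgebra.comul (R := k) l))
    (fun l l' c => by simp) (fun r l c => by simp)
    (fun l c c' => by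
      generalize Coalgebra.comul (R := k) l = t
      induction t with
      | zero => simp
      | tmul x y => simp [twist_tmul, mul_add]
      | add x y hx hy => simp only [map_add, hx, hy]; abel)
    (fun r l c => by
      generalize Coalgebra.comul (R := k) l = t
      induction t with
      | zero => simp
      | tmul x y => simp [twist_tmul]
      | add x y hx hy => simp only [map_add, hx, hy, smul_add]))

variable {k H B} in
theorem mulAux_mk (h : H) (b : B) (l : H) (c : B) :
    mulAux k H B h b (mk k H B l c) = twist k H B h b c (Coalgebra.comul (R := k) l) :=
  rfl

/-- The multiplication of the smash product as a bilinear map. -/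
def mulHom : SmashProduct k H B →ₗ[k] SmashProduct k H B →ₗ[k] SmashProduct k H B :=
  TensorProduct.lift (LinearMap.mk₂ k (fun (h : H) (b : B) => mulAux k H B h b)
    (fun h h' b => by
      ext x
      induction x using induction_mk with
      | h0 => simp
      | hm l c =>
        simp only [mulAux_mk, LinearMap.add_apply]
        generalize Coalgebra.comul (R := k) l = t
        induction t with
        | zero => simp
        | tmul x y => simp [twist_tmul, add_mul]
        | add x y hx hy => simp only [map_add, hx, hy]; abel
      | ha x y hx hy => simp only [map_add, hx, hy])
    (fun r h b => by
      ext x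
      induction x using induction_mk with
      | h0 => simp
      | hm l c =>
        simp only [mulAux_mk, LinearMap.smul_apply]
        generalize Coalgebra.comul (R := k) l = t
        induction t with
        | zero => simp
        | tmul x y => simp [twist_tmul]
        | add x y hx hy => simp only [map_add, hx, hy, smul_add]
      | ha x y hx hy => simp only [map_add, hx, hy])
    (fun h b b' => by
      ext x
      induction x using induction_mk with
      | h0 => simp
      | hm l c =>
        simp only [mulAux_mk, LinearMap.add_apply]
        generalize Coalgebra.comul (R := k) l = t
        induction t with
        | zero => simp
        | tmul x y => simp [twist_tmul, add_mul]
        | add x y hx hy => simp only [map_add, hx, hy]; abel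
      | ha x y hx hy => simp only [map_add, hx, hy])
    (fun r h b => by
      ext x
      induction x using induction_mk with
      | h0 => simp
      | hm l c =>
        simp only [mulAux_mk, LinearMap.smul_apply]
        generalize Coalgebra.comul (R := k) l = t
        induction t with
        | zero => simp
        | tmul x y => simp [twist_tmul]
        | add x y hx hy => simp only [map_add, hx, hy, smul_add]
      | ha x y hx hy => simp only [map_add, hx, hy]))

instance : Mul (SmashProduct k H B) := ⟨fun x y => mulHom k H B x y⟩

instance : One (SmashProduct k H B) := ⟨mk k H B 1 1⟩

variable {k H B}

theorem mul_def (x y : SmashProduct k H B) : x * y = mulHom k H B x y := rfl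

theorem one_def : (1 : SmashProduct k H B) = mk k H B 1 1 := rfl

theorem mk_mul_mk (h l : H) (b c : B) :
    mk k H B h b * mk k H B l c = twist k H B h b c (Coalgebra.comul (R := k) l) := rfl

protected theorem add_mul (x y z : SmashProduct k H B) : (x + y) * z = x * z + y * z := by
  simp [mul_def]

protected theorem mul_add (x y z : SmashProduct k H B) : x * (y + z) = x * y + x * z := by
  simp [mul_def]

protected theorem zero_mul (x : SmashProduct k H B) : 0 * x = 0 := by simp [mul_def]

protected theorem mul_zero (x : SmashProduct k H B) : x * 0 = 0 := by simp [mul_def]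

protected theorem one_mul (x : SmashProduct k H B) : 1 * x = x := by
  induction x using induction_mk with
  | h0 => exact SmashProduct.mul_zero _
  | hm l c =>
    rw [one_def, mk_mul_mk]
    have : ∀ t : H ⊗[k] H, twist k H B 1 1 c t =
        mk k H B (TensorProduct.rid k H ((Coalgebra.counit (R := k) (A := H)).lTensor H t)) c := by
      intro t
      induction t with
      | zero => simp
      | tmul x y => simp [twist_tmul, one_act, Algebra.algebraMap_eq_smul_one]
      | add x y hx hy => simp only [map_add, hx, hy, LinearMap.add_apply]
    rw [this]
    simp
  | ha x y hx hy => rw [SmashProduct.mul_add, hx, hy]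

protected theorem mul_one (x : SmashProduct k H B) : x * 1 = x := by
  induction x using induction_mk with
  | h0 => exact SmashProduct.zero_mul _
  | hm l c =>
    rw [one_def, mk_mul_mk, Bialgebra.comul_one, Algebra.TensorProduct.one_def, twist_tmul,
      act_one, mul_one, mul_one]
  | ha x y hx hy => rw [SmashProduct.add_mul, hx, hy]

/-- Auxiliary: the map `x ⊗ (y ⊗ z) ↦ h l x ⊗ (b · (l' y)) (c · z) d`. -/
def assocAux (h l l' : H) (b c d : B) : H ⊗[k] (H ⊗[k] H) →ₗ[k] SmashProduct k H B :=
  TensorProduct.map (LinearMap.mulLeft k (h * l))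
    (LinearMap.mulRight k d ∘ₗ LinearMap.mul' k B ∘ₗ
      TensorProduct.map (act k (act k b l')) (act k c))

theorem assocAux_tmul (h l l' : H) (b c d : B) (x y z : H) :
    assocAux h l l' b c d (x ⊗ₜ (y ⊗ₜ z)) =
      mk k H B (h * l * x) (act k (act k b l') y * act k c z * d) := rfl

theorem mul_assoc_left (h l l' m : H) (b c d : B) :
    mk k H B (h * l) (act k b l' * c) * mk k H B m d =
      assocAux h l l' b c d
        ((Coalgebra.comul (R := k) (A := H)).lTensor H (Coalgebra.comul (R := k) m)) := by
  rw [mk_mul_mk]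
  generalize Coalgebra.comul (R := k) m = t
  induction t with
  | zero => simp
  | tmul x y =>
    rw [twist_tmul, mul_act, LinearMap.lTensor_tmul]
    rfl
  | add x y hx hy => simp only [map_add, hx, hy]

theorem twist_mul (h l l' : H) (b c d : B) (y : H) (s : H ⊗[k] H) :
    twist k H B h b (act k c y * d) ((l ⊗ₜ[k] l') * s) =
      assocAux h l l' b c d (TensorProduct.assoc k H H H (s ⊗ₜ y)) := by
  induction s with
  | zero => simp
  | tmul u v =>
    simp only [Algebra.TensorProduct.tmul_mul_tmul, twist_tmul, TensorProduct.assoc_tmul,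
      assocAux_tmul, act_mul, mul_assoc]
  | add u v hu hv => simp only [mul_add, map_add, hu, hv, TensorProduct.add_tmul]

protected theorem mul_assoc (x y z : SmashProduct k H B) : x * y * z = x * (y * z) := by
  induction x using induction_mk with
  | h0 => simp only [SmashProduct.zero_mul]
  | ha x x' hx hx' => simp only [SmashProduct.add_mul, hx, hx']
  | hm h b =>
  induction y using induction_mk with
  | h0 => simp only [SmashProduct.zero_mul, SmashProduct.mul_zero]
  | ha y y' hy hy' => simp only [SmashProduct.add_mul, SmashProduct.mul_add, hy, hy']
  | hm l c =>
  induction z using induction_mk with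
  | h0 => simp only [SmashProduct.mul_zero]
  | ha z z' hz hz' => simp only [SmashProduct.mul_add, hz, hz']
  | hm m d =>
  rw [mk_mul_mk h l, mk_mul_mk l m]
  have hR : ∀ t : H ⊗[k] H, mk k H B h b * twist k H B l c d t =
      ∑ i ∈ (Coalgebra.Repr.arbitrary k l).index,
        assocAux h ((Coalgebra.Repr.arbitrary k l).left i)
          ((Coalgebra.Repr.arbitrary k l).right i) b c d
          (TensorProduct.assoc k H H H ((Coalgebra.comul (R := k) (A := H)).rTensor H t)) := by
    intro t
    induction t with
    | zero => simp [SmashProduct.mul_zero]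
    | tmul u v =>
      rw [twist_tmul, mk_mul_mk, Bialgebra.comul_mul]
      nth_rewrite 1 [← (Coalgebra.Repr.arbitrary k l).eq]
      simp only [Finset.sum_mul, map_sum, twist_mul, LinearMap.rTensor_tmul]
    | add u v hu hv => simp only [map_add, SmashProduct.mul_add, hu, hv, Finset.sum_add_distrib]
  rw [hR, Coalgebra.coassoc_apply]
  nth_rewrite 1 [← (Coalgebra.Repr.arbitrary k l).eq]
  rw [map_sum, mul_def, map_sum, LinearMap.sum_apply]
  refine Finset.sum_congr rfl fun i _ => ?_
  rw [← mul_def, twist_tmul, mul_assoc_left]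

instance : Ring (SmashProduct k H B) where
  mul_assoc := SmashProduct.mul_assoc
  one_mul := SmashProduct.one_mul
  mul_one := SmashProduct.mul_one
  left_distrib := SmashProduct.mul_add
  right_distrib := SmashProduct.add_mul
  zero_mul := SmashProduct.zero_mul
  mul_zero := SmashProduct.mul_zero
  neg_add_cancel := neg_add_cancel
  zsmul := fun n x => n • x
  zsmul_zero' := SubNegMonoid.zsmul_zero'
  zsmul_succ' := SubNegMonoid.zsmul_succ'
  zsmul_neg' := SubNegMonoid.zsmul_neg'

instance : Algebra k (SmashProduct k H B) :=
  Algebra.ofModule (fun r x y => by simp [mul_def]) (fun r x y => by simp [mul_def])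

theorem algebraMap_def (r : k) :
    algebraMap k (SmashProduct k H B) r = mk k H B (algebraMap k H r) 1 := by
  rw [Algebra.algebraMap_eq_smul_one, one_def, Algebra.algebraMap_eq_smul_one, map_smul,
    LinearMap.smul_apply]

variable (k H B)

/-- The inclusion `H → H # B`, `h ↦ h ⊗ 1`, of algebras. -/
def incl : H →ₐ[k] SmashProduct k H B where
  toFun h := mk k H B h 1
  map_one' := rfl
  map_mul' h l := by
    rw [mk_mul_mk]
    have : ∀ t : H ⊗[k] H, twist k H B h 1 1 t =
        mk k H B (h * TensorProduct.rid k H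
          ((Coalgebra.counit (R := k) (A := H)).lTensor H t)) 1 := by
      intro t
      induction t with
      | zero => simp
      | tmul x y => simp [twist_tmul, one_act, Algebra.algebraMap_eq_smul_one]
      | add x y hx hy => simp only [map_add, hx, hy, LinearMap.add_apply, mul_add]
    rw [this]
    simp
  map_zero' := by simp
  map_add' h l := by simp
  commutes' r := (algebraMap_def r).symm

/-- The linear map `H # B → H ⊗ (H # B)`, `h ⊗ b ↦ ∑ h₍₁₎ ⊗ (h₍₂₎ ⊗ b)`. -/
def coactLin : SmashProduct k H B →ₗ[k] H ⊗[k] SmashProduct k H B :=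
  TensorProduct.lift
    (LinearMap.lcomp k (H ⊗[k] SmashProduct k H B) (Coalgebra.comul (R := k) (A := H)) ∘ₗ
      LinearMap.lTensorHom H ∘ₗ (mk k H B).flip).flip

variable {k H B}

theorem coactLin_mk (h : H) (b : B) :
    coactLin k H B (mk k H B h b) =
      ((mk k H B).flip b).lTensor H (Coalgebra.comul (R := k) h) := rfl

/-- Auxiliary: the map `x ⊗ (y ⊗ z) ↦ h x ⊗ (h' y ⊗ (b · z) c)`. -/
def coactAux (h h' : H) (b c : B) : H ⊗[k] (H ⊗[k] H) →ₗ[k] H ⊗[k] SmashProduct k H B :=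
  TensorProduct.map (LinearMap.mulLeft k h) (twist k H B h' b c)

theorem coactLin_twist (h : H) (b c : B) (t : H ⊗[k] H) :
    coactLin k H B (twist k H B h b c t) =
      ∑ i ∈ (Coalgebra.Repr.arbitrary k h).index,
        coactAux ((Coalgebra.Repr.arbitrary k h).left i)
          ((Coalgebra.Repr.arbitrary k h).right i) b c
          (TensorProduct.assoc k H H H ((Coalgebra.comul (R := k) (A := H)).rTensor H t)) := by
  induction t with
  | zero => simp
  | tmul x y =>
    rw [twist_tmul, coactLin_mk, Bialgebra.comul_mul, LinearMap.rTensor_tmul]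
    nth_rewrite 1 [← (Coalgebra.Repr.arbitrary k h).eq]
    rw [Finset.sum_mul, map_sum]
    refine Finset.sum_congr rfl fun i _ => ?_
    generalize Coalgebra.comul (R := k) x = s
    induction s with
    | zero => simp
    | tmul u v => rw [Algebra.TensorProduct.tmul_mul_tmul]; rfl
    | add u v hu hv => simp only [mul_add, map_add, hu, hv, TensorProduct.add_tmul]
  | add x y hx hy => simp only [map_add, hx, hy, Finset.sum_add_distrib]

theorem coactLin_mul_mk (h l : H) (b c : B) :
    coactLin k H B (mk k H B h b * mk k H B l c) =
      coactLin k H B (mk k H B h b) * coactLin k H B (mk k H B l c) := by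
  rw [mk_mul_mk, coactLin_twist, Coalgebra.coassoc_apply, coactLin_mk, coactLin_mk]
  nth_rewrite 1 [← (Coalgebra.Repr.arbitrary k h).eq]
  rw [map_sum, Finset.sum_mul]
  refine Finset.sum_congr rfl fun i _ => ?_
  generalize Coalgebra.comul (R := k) l = t
  induction t with
  | zero => simp
  | tmul u v =>
    rw [LinearMap.lTensor_tmul, LinearMap.lTensor_tmul, LinearMap.lTensor_tmul,
      Algebra.TensorProduct.tmul_mul_tmul]
    rfl
  | add u v hu hv => simp only [mul_add, map_add, hu, hv]

variable (k H B)

/-- The algebra homomorphism `Δ : H # B → H ⊗ (H # B)`, `Δ(h ⊗ b) = Δ(h) ⊗ b`. -/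
def coactHom : SmashProduct k H B →ₐ[k] H ⊗[k] SmashProduct k H B :=
  AlgHom.ofLinearMap (coactLin k H B)
    (by rw [one_def, coactLin_mk, Bialgebra.comul_one]; rfl)
    (by
      intro x y
      induction x using induction_mk with
      | h0 => simp
      | ha x x' hx hx' => simp only [add_mul, map_add, hx, hx']
      | hm h b =>
      induction y using induction_mk with
      | h0 => simp
      | ha y y' hy hy' => simp only [mul_add, map_add, hy, hy']
      | hm l c => exact coactLin_mul_mk h l b c)

/-- The smash product `H # B` is a left `H`-comodule algebra. -/
instance : LeftComoduleAlgebra k H (SmashProduct k H B) where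
  coact := coactHom k H B
  counit_coact a := by
    change TensorProduct.lid k _ ((Coalgebra.counit (R := k) (A := H)).rTensor _
      (coactLin k H B a)) = a
    induction a using induction_mk with
    | h0 => simp
    | ha x y hx hy => simp only [map_add, hx, hy]
    | hm h b =>
      have : ∀ t : H ⊗[k] H, TensorProduct.lid k (SmashProduct k H B)
          ((Coalgebra.counit (R := k) (A := H)).rTensor _ (((mk k H B).flip b).lTensor H t)) =
          mk k H B (TensorProduct.lid k H
            ((Coalgebra.counit (R := k) (A := H)).rTensor H t)) b := by
        intro t
        induction t with
        | zero => simp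
        | tmul x y => simp
        | add x y hx hy => simp only [map_add, hx, hy, LinearMap.add_apply]
      rw [coactLin_mk, this]
      simp
  coassoc_coact a := by
    change TensorProduct.assoc k H H _ ((Coalgebra.comul (R := k) (A := H)).rTensor _
      (coactLin k H B a)) = (coactLin k H B).lTensor H (coactLin k H B a)
    induction a using induction_mk with
    | h0 => simp
    | ha x y hx hy => simp only [map_add, hx, hy]
    | hm h b =>
      have h1 : ∀ t : H ⊗[k] H, TensorProduct.assoc k H H (SmashProduct k H B)
          ((Coalgebra.comul (R := k) (A := H)).rTensor _ (((mk k H B).flip b).lTensor H t)) =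
          (((mk k H B).flip b).lTensor H).lTensor H (TensorProduct.assoc k H H H
            ((Coalgebra.comul (R := k) (A := H)).rTensor H t)) := by
        intro t
        induction t with
        | zero => simp
        | tmul x y =>
          simp only [LinearMap.lTensor_tmul, LinearMap.rTensor_tmul]
          generalize Coalgebra.comul (R := k) x = s
          induction s with
          | zero => simp
          | tmul u v => rfl
          | add u v hu hv => simp only [map_add, hu, hv, TensorProduct.add_tmul]
        | add x y hx hy => simp only [map_add, hx, hy]
      have h2 : ∀ t : H ⊗[k] H, (coactLin k H B).lTensor H (((mk k H B).flip b).lTensor H t) =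
          (((mk k H B).flip b).lTensor H).lTensor H
            ((Coalgebra.comul (R := k) (A := H)).lTensor H t) := by
        intro t
        induction t with
        | zero => simp
        | tmul x y => rfl
        | add x y hx hy => simp only [map_add, hx, hy]
      rw [coactLin_mk, h1, h2, Coalgebra.coassoc_apply]

end SmashProduct

end Smash

/-! ### Tensor products of `H`-modules with `A`-modules -/

section Tensor

variable (k : Type u) {H A : Type u} [Field k] [Ring H] [HopfAlgebra k H] [Ring A] [Algebra k A]
  [LeftComoduleAlgebra k H A]

/-- The underlying `k`-vector space of the tensor product `V ⊗ M` over `k`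
of an `H`-module `V` and an `A`-module `M`. -/
def HTensor (V : ModuleCat.{u} H) (M : ModuleCat.{u} A) : Type u := V ⊗[k] M

namespace HTensor

variable (V : ModuleCat.{u} H) (M : ModuleCat.{u} A)

instance : AddCommGroup (HTensor k V M) := inferInstanceAs (AddCommGroup (V ⊗[k] M))

/-- The representation `A → H ⊗ A → End V ⊗ End M → End (V ⊗ M)`. -/
def rep : A →ₐ[k] Module.End k (V ⊗[k] M) :=
  (Module.endTensorEndAlgHom (R := k) (S := k) (A := k) (M := V) (N := M)).comp
    ((Algebra.TensorProduct.map (Algebra.lsmul k k V) (Algebra.lsmul k k M)).comp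
      (LeftComoduleAlgebra.coact (k := k) (H := H) (A := A)))

/-- `A` acts on `V ⊗ M` through its coaction: `a (v ⊗ m) = ∑ a₍₋₁₎ v ⊗ a₍₀₎ m`. -/
instance : Module A (HTensor k V M) :=
  Module.compHom (V ⊗[k] M) (rep k V M).toRingHom

theorem smul_def (a : A) (x : V ⊗[k] M) :
    (show V ⊗[k] M from a • (show HTensor k V M from x)) = rep k V M a x := rfl

end HTensor

/-- The tensor product `V ⊗ M` of an `H`-module and an `A`-module, as an `A`-module. -/
def tensorObj (V : ModuleCat.{u} H) (M : ModuleCat.{u} A) : ModuleCat.{u} A :=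
  ModuleCat.of A (HTensor k V M)

/-- The underlying `k`-linear map of a morphism of modules over a `k`-algebra. -/
abbrev klin {R : Type u} [Ring R] [Algebra k R] {M N : ModuleCat.{u} R} (f : M ⟶ N) :
    M →ₗ[k] N :=
  f.hom.restrictScalars k

theorem map_rep {V W : ModuleCat.{u} H} {M N : ModuleCat.{u} A} (f : V ⟶ W) (g : M ⟶ N)
    (a : A) (x : V ⊗[k] M) :
    TensorProduct.map (klin k f) (klin k g) (HTensor.rep k V M a x) =
      HTensor.rep k W N a (TensorProduct.map (klin k f) (klin k g) x) := by
  simp only [HTensor.rep, AlgHom.comp_apply]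
  generalize LeftComoduleAlgebra.coact (k := k) (H := H) a = t
  induction t with
  | zero => simp
  | add s t hs ht => simp only [map_add, LinearMap.add_apply, hs, ht]
  | tmul h b =>
    induction x with
    | zero => simp
    | add x y hx hy => simp only [map_add, hx, hy]
    | tmul v m =>
      simp only [Algebra.TensorProduct.map_tmul, Module.endTensorEndAlgHom_apply]
      simp

/-- The morphism `f ⊗ g : V ⊗ M → W ⊗ N`. -/
def tensorMap {V W : ModuleCat.{u} H} {M N : ModuleCat.{u} A} (f : V ⟶ W) (g : M ⟶ N) :
    tensorObj k V M ⟶ tensorObj k W N :=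
  ModuleCat.ofHom (X := HTensor k V M) (Y := HTensor k W N)
    { toFun := fun x => TensorProduct.map (klin k f) (klin k g) x
      map_add' := fun x y => map_add (TensorProduct.map (klin k f) (klin k g)) x y
      map_smul' := fun a x => map_rep k f g a x }

/-- Tensoring with an `H`-module `V`, as an endofunctor of the category of `A`-modules. -/
def tensorLeft (V : ModuleCat.{u} H) : ModuleCat.{u} A ⥤ ModuleCat.{u} A where
  obj M := tensorObj k V M
  map g := tensorMap k (𝟙 V) g
  map_id M := by
    ext x
    exact LinearMap.congr_fun (TensorProduct.map_id (R := k) (M := V) (N := M)) x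
  map_comp {M N P} f g := by
    ext x
    exact LinearMap.congr_fun
      (TensorProduct.map_comp (klin k (𝟙 V)) (klin k g) (klin k (𝟙 V)) (klin k f)) x

/-- `Λ` is a left integral of `H`: it is nonzero and `h Λ = ε(h) Λ` for all `h`. -/
def IsLeftIntegral (Λ : H) : Prop :=
  Λ ≠ 0 ∧ ∀ h : H, h * Λ = Coalgebra.counit (R := k) h • Λ

variable (H) in
/-- The regular left `H`-module. -/
def regular : ModuleCat.{u} H := ModuleCat.of H H

/-- The `H`-module `H / kΛ` (for a left integral, `kΛ = HΛ` is the submodule generated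
by `Λ`). -/
def regularQuot (Λ : H) : ModuleCat.{u} H := ModuleCat.of H (H ⧸ Submodule.span H {Λ})

/-- The projection `H → H / kΛ`. -/
def regularProj (Λ : H) : regular H ⟶ regularQuot Λ :=
  ModuleCat.ofHom (Submodule.mkQ (Submodule.span H {Λ}))

theorem regularProj_epi (Λ : H) : Epi (regularProj Λ) :=
  (ModuleCat.epi_iff_surjective
    (ModuleCat.ofHom (Submodule.mkQ (Submodule.span H {Λ})))).2 (Submodule.mkQ_surjective _)

/-- An element of `H`, seen in the regular module. -/
def toRegular (h : H) : regular H := (show H from h)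

variable (H) in
/-- The trivial one-dimensional `H`-module `k`, on which `H` acts through the counit. -/
def trivialModule : ModuleCat.{u} H :=
  (ModuleCat.restrictScalars (Bialgebra.counitAlgHom k H).toRingHom).obj (ModuleCat.of k k)

theorem rep_integral {Λ : H} (hΛ : IsLeftIntegral k Λ) (M : ModuleCat.{u} A) (a : A) (m : M) :
    HTensor.rep k (regular H) M a ((toRegular Λ) ⊗ₜ[k] m) = (toRegular Λ) ⊗ₜ[k] (a • m) := by
  have key : ∀ t : H ⊗[k] A,
      Module.endTensorEndAlgHom (R := k) (S := k) (A := k) (M := regular H) (N := M)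
        (Algebra.TensorProduct.map (Algebra.lsmul k k (regular H)) (Algebra.lsmul k k M) t)
        ((toRegular Λ) ⊗ₜ[k] m) =
      (toRegular Λ) ⊗ₜ[k]
        ((TensorProduct.lid k A ((Coalgebra.counit (R := k) (A := H)).rTensor A t)) • m) := by
    intro t
    induction t with
    | zero => simp
    | add s t hs ht =>
      simp only [map_add, LinearMap.add_apply, hs, ht, add_smul, TensorProduct.tmul_add]
    | tmul h b =>
      have h1 : h • toRegular Λ = Coalgebra.counit (R := k) h • toRegular Λ :=
        (hΛ.2 h).trans (Algebra.smul_def _ _)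
      simp only [Algebra.TensorProduct.map_tmul, Module.endTensorEndAlgHom_apply]
      simp [h1, TensorProduct.smul_tmul]
  have := key (LeftComoduleAlgebra.coact (k := k) (H := H) a)
  rw [LeftComoduleAlgebra.counit_coact] at this
  exact this

/-- The embedding `Λ ⊗ Id : M → H ⊗ M`, `m ↦ Λ ⊗ m`. -/
def integralEmb {Λ : H} (hΛ : IsLeftIntegral k Λ) (M : ModuleCat.{u} A) :
    M ⟶ tensorObj k (regular H) M :=
  ModuleCat.ofHom (Y := HTensor k (regular H) M)
    { toFun := fun m => (toRegular Λ) ⊗ₜ[k] m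
      map_add' := fun m n => TensorProduct.tmul_add _ m n
      map_smul' := fun a m => (rep_integral k hΛ M a m).symm }

end Tensor

/-! ### Classes of modules -/

section Classes

variable (k H : Type u) {A : Type u} [Field k] [Ring H] [HopfAlgebra k H] [Ring A] [Algebra k A]
  [LeftComoduleAlgebra k H A]

/-- A class of `A`-modules closed under subquotients, finite direct sums and tensoring
with `H`. -/
class IsAdmissible (C : ObjectProperty (ModuleCat.{u} A)) : Prop extends
    C.IsClosedUnderSubobjects, C.IsClosedUnderQuotients, C.IsClosedUnderFiniteProducts where
  tensor_regular : ∀ M : ModuleCat.{u} A, C M → C (tensorObj k (regular H) M)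

/-- The class of all `A`-modules is admissible. -/
instance : IsAdmissible k H (⊤ : ObjectProperty (ModuleCat.{u} A)) where
  prop_of_mono _ _ _ := trivial
  prop_of_epi _ _ _ := trivial
  isClosedUnderLimitsOfShape _ _ := ⟨fun _ _ => trivial⟩
  tensor_regular _ _ := trivial

variable {H}

/-- Tensoring with the `H`-module `V` preserves the class `C`. -/
def PreservesClass (V : ModuleCat.{u} H) (C : ObjectProperty (ModuleCat.{u} A)) : Prop :=
  ∀ M : ModuleCat.{u} A, C M → C (tensorObj k V M)

/-- The class of modules that are finite-dimensional over `k`. -/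
def finDim (R : Type u) [Ring R] [Algebra k R] : ObjectProperty (ModuleCat.{u} R) :=
  fun M => FiniteDimensional k M

/-- The identity `V ⊗ M → V ⊗ M` is `k`-linear for the two `k`-vector space structures on the
tensor product: the one of `⊗` and the one that comes from the `A`-module structure. -/
def toTensorObj (V : ModuleCat.{u} H) (M : ModuleCat.{u} A) :
    V ⊗[k] M →ₗ[k] (tensorObj k V M : ModuleCat.{u} A) where
  toFun x := x
  map_add' _ _ := rfl
  map_smul' c x := by
    change c • x = HTensor.rep k V M (algebraMap k A c) x
    rw [AlgHom.commutes]
    rfl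

theorem finDim_tensorObj {V : ModuleCat.{u} H} {M : ModuleCat.{u} A}
    (hV : finDim k H V) (hM : finDim k A M) : finDim k A (tensorObj k V M) := by
  have h1 : FiniteDimensional k V := hV
  have h2 : FiniteDimensional k M := hM
  exact Module.Finite.of_surjective (toTensorObj k V M) (fun x => ⟨x, rfl⟩)

variable (H) in
theorem finDim_regular [FiniteDimensional k H] : finDim k H (regular H) :=
  Module.Finite.of_surjective
    ({ toFun := fun h => toRegular h
       map_add' := fun _ _ => rfl
       map_smul' := fun c h => Algebra.smul_def c h } : H →ₗ[k] regular H) (fun h => ⟨h, rfl⟩)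

instance finDim_isAdmissible [FiniteDimensional k H] : IsAdmissible k H (finDim k A) where
  prop_of_mono {M N} f _ hN := by
    have : FiniteDimensional k N := hN
    exact Module.Finite.of_injective (klin k f) ((ModuleCat.mono_iff_injective f).1 inferInstance)
  prop_of_epi {M N} f _ hM := by
    have : FiniteDimensional k M := hM
    exact Module.Finite.of_surjective (klin k f) ((ModuleCat.epi_iff_surjective f).1 inferInstance)
  isClosedUnderLimitsOfShape J _ := ⟨by
    rintro X ⟨p⟩
    have h : ∀ j, FiniteDimensional k (p.diag.obj j) := p.prop_diag_obj
    have := Fintype.ofFinite J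
    refine Module.Finite.of_injective (M := X) (N := ∀ j, p.diag.obj j)
      (LinearMap.pi fun j => klin k (p.π.app j)) fun x y hxy => ?_
    exact Concrete.isLimit_ext p.diag p.isLimit x y fun j => congrFun hxy j⟩
  tensor_regular M hM := finDim_tensorObj k (finDim_regular k H) hM

/-- An admissible class is preserved by tensoring with finite-dimensional `H`-modules. -/
theorem preservesClass_of_finDim (C : ObjectProperty (ModuleCat.{u} A)) [IsAdmissible k H C]
    {V : ModuleCat.{u} H} (hV : finDim k H V) : PreservesClass k V C := by
  intro M hM
  have hV' : FiniteDimensional k V := hV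
  obtain ⟨n, s, hs⟩ := Module.Finite.exists_fin (R := k) (M := V)
  let q : ∀ _ : Fin n, tensorObj k (regular H) M ⟶ tensorObj k V M := fun i =>
    tensorMap k (ModuleCat.ofHom (X := H) (Y := V) (LinearMap.toSpanSingleton H V (s i))) (𝟙 M)
  have hq : ∀ i (m : M), q i (toTensorObj k (regular H) M (toRegular (1 : H) ⊗ₜ m)) =
      toTensorObj k V M (s i ⊗ₜ m) := fun i m =>
    congrArg (fun v : V => toTensorObj k V M (v ⊗ₜ[k] m)) (one_smul H (s i))
  have hC : C (⨁ fun _ : Fin n => tensorObj k (regular H) M) :=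
    C.prop_of_iso (biproduct.isoProduct _).symm
      (C.prop_product fun _ => IsAdmissible.tensor_regular M hM)
  have : Epi (biproduct.desc q) := ⟨fun {Z} g g' h => by
    have h1 : ∀ i, q i ≫ g = q i ≫ g' := fun i => by
      have := congrArg (fun z => biproduct.ι _ i ≫ z) h
      simpa using this
    have h2 : klin k g ∘ₗ toTensorObj k V M = klin k g' ∘ₗ toTensorObj k V M := by
      refine TensorProduct.ext ?_
      refine LinearMap.ext_on_range hs fun i => LinearMap.ext fun m => ?_
      have := congrArg (fun z => z (toTensorObj k (regular H) M (toRegular (1 : H) ⊗ₜ m))) (h1 i)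
      simp only [ModuleCat.comp_apply, hq] at this
      exact this
    ext x
    exact LinearMap.congr_fun h2 x⟩
  exact C.prop_of_epi (biproduct.desc q) hC

/-- Tensoring with `V` as an endofunctor of the full subcategory of modules in `C`. -/
def tensorOn (C : ObjectProperty (ModuleCat.{u} A)) {V : ModuleCat.{u} H}
    (hV : PreservesClass k V C) : C.FullSubcategory ⥤ C.FullSubcategory :=
  C.lift (C.ι ⋙ tensorLeft k V) (fun M => hV M.obj M.property)

theorem finDim_regularQuot [FiniteDimensional k H] (Λ : H) : finDim k H (regularQuot Λ) := by
  have : FiniteDimensional k (regular H) := finDim_regular k H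
  exact Module.Finite.of_surjective (klin k (regularProj Λ))
    ((ModuleCat.epi_iff_surjective (regularProj Λ)).1 (regularProj_epi Λ))

variable (H) in
theorem finDim_trivialModule : finDim k H (trivialModule k H) :=
  Module.Finite.of_surjective
    ({ toFun := fun c => (show k from c)
       map_add' := fun _ _ => rfl
       map_smul' := fun c x => by
        change c * x = Coalgebra.counit (R := k) (algebraMap k H c) * x
        rw [Bialgebra.counit_algebraMap] } : k →ₗ[k] trivialModule k H) (fun c => ⟨c, rfl⟩)

/-- The shift functor `T M = (H / kΛ) ⊗ M`. -/
abbrev shiftT [FiniteDimensional k H] (C : ObjectProperty (ModuleCat.{u} A)) [IsAdmissible k H C]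
    (Λ : H) : C.FullSubcategory ⥤ C.FullSubcategory :=
  tensorOn k C (preservesClass_of_finDim k C (finDim_regularQuot k Λ))

/-- `X --u--> Y --v--> Z --w--> T X` is a standard triangle: `Z` is the cone of `u`, i.e. the
pushout of `u` along `Λ ⊗ Id : X → H ⊗ X`, and `w` is the map out of the pushout that vanishes
on `Y` and is the projection `H ⊗ X → (H / kΛ) ⊗ X = T X` on `H ⊗ X`. -/
def IsStandardTriangle [FiniteDimensional k H] (C : ObjectProperty (ModuleCat.{u} A))
    [IsAdmissible k H C] {Λ : H} (hΛ : IsLeftIntegral k Λ) {X Y Z : C.FullSubcategory}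
    (f : X ⟶ Y) (v : Y ⟶ Z) (w : Z ⟶ (shiftT k C Λ).obj X) : Prop :=
  ∃ f' : tensorObj k (regular H) X.obj ⟶ Z.obj,
    IsPushout f.hom (integralEmb k hΛ X.obj) v.hom f' ∧
    v.hom ≫ w.hom = 0 ∧ f' ≫ w.hom = tensorMap k (regularProj Λ) (𝟙 X.obj)

/-- Given a functor `Q` from the modules in `C` to a category `E`, this expresses that a
pretriangulated structure on `E` makes it a triangulated category (octahedral axiom included),
that its shift functor is induced by `T`, and that its distinguished triangles are exactly the
triangles isomorphic to images of standard triangles. -/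
def IsStandardTriangulation [FiniteDimensional k H] (C : ObjectProperty (ModuleCat.{u} A))
    [IsAdmissible k H C] {Λ : H} (hΛ : IsLeftIntegral k Λ)
    {E : Type*} [Category* E] (Q : C.FullSubcategory ⥤ E)
    [Preadditive E] [HasZeroObject E] [HasShift E ℤ]
    [∀ n : ℤ, (shiftFunctor E n).Additive] [Pretriangulated E] : Prop :=
  IsTriangulated E ∧ Q.Additive ∧
    ∃ e : shiftT k C Λ ⋙ Q ≅ Q ⋙ shiftFunctor E (1 : ℤ),
      ∀ t : Triangle E, t ∈ distTriang E ↔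
        ∃ (X Y Z : C.FullSubcategory) (f : X ⟶ Y) (v : Y ⟶ Z) (w : Z ⟶ (shiftT k C Λ).obj X),
          IsStandardTriangle k C hΛ f v w ∧
          Nonempty (t ≅ Triangle.mk (Q.map f) (Q.map v) (Q.map w ≫ e.hom.app X))

end Classes

/-! ### Stable, homotopy and derived categories -/

section Categories

/-- Morphisms of `R`-modules in the class `P` are identified when their difference factors
through an injective module in `P`. -/
def stableRel {R : Type u} [Ring R] (P : ObjectProperty (ModuleCat.{u} R)) :
    HomRel P.FullSubcategory :=
  fun X Y f g => ∃ I : ModuleCat.{u} R, P I ∧ Injective I ∧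
    ∃ (i : X.obj ⟶ I) (p : I ⟶ Y.obj), f.hom - g.hom = i ≫ p

/-- The stable category of the `R`-modules in the class `P`. -/
abbrev StableCat {R : Type u} [Ring R] (P : ObjectProperty (ModuleCat.{u} R)) :=
  CategoryTheory.Quotient (stableRel P)

/-- The quotient functor from modules to the stable category. -/
abbrev toStable {R : Type u} [Ring R] (P : ObjectProperty (ModuleCat.{u} R)) :
    P.FullSubcategory ⥤ StableCat P :=
  CategoryTheory.Quotient.functor (stableRel P)

/-- Morphisms of `A`-modules in the class `C` are homotopic when their difference factors
through `H ⊗ N` for some `N` in `C`. -/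
def homotopyRel (k H : Type u) {A : Type u} [Field k] [Ring H] [HopfAlgebra k H] [Ring A]
    [Algebra k A] [LeftComoduleAlgebra k H A] (C : ObjectProperty (ModuleCat.{u} A)) :
    HomRel C.FullSubcategory :=
  fun X Y f g => ∃ N : ModuleCat.{u} A, C N ∧
    ∃ (i : X.obj ⟶ tensorObj k (regular H) N) (p : tensorObj k (regular H) N ⟶ Y.obj),
      f.hom - g.hom = i ≫ p

/-- The category of `A`-modules in the class `C` modulo null-homotopic morphisms. -/
abbrev HomotopyCat (k H : Type u) {A : Type u} [Field k] [Ring H] [HopfAlgebra k H] [Ring A]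
    [Algebra k A] [LeftComoduleAlgebra k H A] (C : ObjectProperty (ModuleCat.{u} A)) :=
  CategoryTheory.Quotient (homotopyRel k H C)

variable (k H B : Type u) [Field k] [Ring H] [HopfAlgebra k H] [Ring B] [Algebra k B]
  [RightModuleAlgebra k H B]

/-- Restriction of `H # B`-modules to `H`-modules. -/
def restrict (C : ObjectProperty (ModuleCat.{u} (SmashProduct k H B))) :
    C.FullSubcategory ⥤ (⊤ : ObjectProperty (ModuleCat.{u} H)).FullSubcategory :=
  ObjectProperty.lift ⊤ (C.ι ⋙ ModuleCat.restrictScalars (SmashProduct.incl k H B).toRingHom)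
    (fun _ => trivial)

/-- A morphism of the homotopy category of `H # B`-modules is a quasi-isomorphism when it
restricts to an isomorphism in the stable category of `H`-modules. -/
def quasiIso (C : ObjectProperty (ModuleCat.{u} (SmashProduct k H B))) :
    MorphismProperty (HomotopyCat k H C) :=
  fun X Y f => ∃ g : X.as ⟶ Y.as,
    (CategoryTheory.Quotient.functor (homotopyRel k H C)).map g = f ∧
      IsIso ((toStable ⊤).map ((restrict k H B C).map g))

/-- The derived category `D(B, H)` of the modules in the class `C`. -/
abbrev DerivedCat (C : ObjectProperty (ModuleCat.{u} (SmashProduct k H B))) :=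
  (quasiIso k H B C).Localization

/-- The functor from `H # B`-modules in the class `C` to the derived category. -/
abbrev toDerived (C : ObjectProperty (ModuleCat.{u} (SmashProduct k H B))) :
    C.FullSubcategory ⥤ DerivedCat k H B C :=
  CategoryTheory.Quotient.functor (homotopyRel k H C) ⋙ (quasiIso k H B C).Q

end Categories

/-! ### Grothendieck groups -/

section Grothendieck

universe v w

variable (E : Type w) [Category.{v} E] [Preadditive E] [HasZeroObject E] [HasShift E ℤ]
  [∀ n : ℤ, (shiftFunctor E n).Additive] [Pretriangulated E]

/-- The relations `[Y] = [X] + [Z]` for the distinguished triangles `X → Y → Z → X[1]`. -/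
def triangleRelations : AddSubgroup (FreeAbelianGroup E) :=
  AddSubgroup.closure {z | ∃ t : Triangle E, t ∈ distTriang E ∧
    z = FreeAbelianGroup.of t.obj₂ -
      (FreeAbelianGroup.of t.obj₁ + FreeAbelianGroup.of t.obj₃)}

/-- The Grothendieck group of a triangulated category. -/
def GrothendieckGroup : Type w := FreeAbelianGroup E ⧸ triangleRelations E

instance instAddCommGroupGrothendieckGroup : AddCommGroup (GrothendieckGroup E) :=
  inferInstanceAs (AddCommGroup (FreeAbelianGroup E ⧸ triangleRelations E))

variable {E} in
/-- The class of an object in the Grothendieck group. -/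
def cls (X : E) : GrothendieckGroup E :=
  QuotientAddGroup.mk (s := triangleRelations E) (FreeAbelianGroup.of X)

end Grothendieck

end Hopfological
end

open Hopfological

/-! The sequences `M → H ⊗ M → (H/kΛ) ⊗ M` turn a class of modules into a relative Frobenius
category: maps into `H ⊗ N` extend along the embeddings, and maps `H ⊗ N → T M` lift through the
projections. Happel's construction then applies. Stably `T` is an autoequivalence, and the pushout
cones satisfy the axioms of a triangulation, octahedra included. `StableData` records what this
construction needs, so one argument covers the homotopy category of `A`-modules (`homotopyRel_iff`)
and the stable categories of `H`-modules (`stableRel_iff`).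

The relative properties come from `H`-modules: `Λ ⊗ (V ⊗ M)` is `(Λ ⊗ V) ⊗ M`, so a splitting or
extension found for `V` can be tensored with `M`. The inputs are that `H ⊗ V` is free (`freeEquiv`,
with inverse given by the antipode) and that `V ⊗ H` and `H ⊗ V` are injective
(`injective_tensor_regular`, `injective_regular_tensor`). Injectivity holds because `V ⊗ H^*` is
coinduced and `H` is a direct summand of `H ⊗ H^*`. The same isomorphisms produce the integral: the
coinduced module on `H` is free and contains the invariant function `x ↦ ε(x) 1`.

Two formal devices complete the triangulation. An autoequivalence extends to a coherent shift by all
integers (`exists_hasShift_int`), as does commutation of a functor with it (`exists_commShift_int`).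
Moreover, rotation need only be checked in one direction (`PretriangulatedCore`).

Restriction to `H` is exact, so the quasi-isomorphisms are the maps whose cone it kills, and `D(B,
H)` is a Verdier quotient (`eq_trW_of_iff`). Tensoring with `V` is exact on the homotopy category
(`tensorOn_isCompatible`) and commutes with restriction, hence descends. Exactness in the variable
`V` (`tensorWith_isCompatible`) makes the operations on Grothendieck groups biadditive;
associativity and unit isomorphisms give the ring and module axioms on classes of objects, which
generate. -/

noncomputable section

namespace Hopfological

universe v₁ u₁ v₂ u₂

/-! ### Integer shifts generated by an autoequivalence -/

section Spectra

variable {E : Type u₁} [Category.{v₁} E]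

/-- A sequence of objects indexed by `ℤ` with isomorphisms `T (X n) ≅ X (n + 1)`. The category
of such sequences has a strict shift, and it is equivalent to `E` if `T` is an equivalence. -/
structure ShiftSpectrum (T : E ⥤ E) where
  obj : ℤ → E
  -- The equation `n + 1 = m` is an argument so that a shifted sequence can reuse the same
  -- isomorphisms, although `n + a + 1` and `n + 1 + a` are different expressions.
  iso : ∀ n m : ℤ, n + 1 = m → (T.obj (obj n) ≅ obj m)

namespace ShiftSpectrum

variable {T : E ⥤ E}

/-- A morphism of sequences. -/
@[ext]
structure Hom (X Y : ShiftSpectrum T) where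
  app : ∀ n, X.obj n ⟶ Y.obj n
  comm : ∀ n m h, T.map (app n) ≫ (Y.iso n m h).hom = (X.iso n m h).hom ≫ app m

instance : Category (ShiftSpectrum T) where
  Hom := Hom
  id X := { app := fun _ => 𝟙 _, comm := by simp }
  comp f g := { app := fun n => f.app n ≫ g.app n, comm := by
                  intro n m h
                  rw [T.map_comp, Category.assoc, g.comm, reassoc_of% f.comm n m h] }

@[simp]
theorem id_app (X : ShiftSpectrum T) (n : ℤ) : Hom.app (𝟙 X) n = 𝟙 (X.obj n) := rfl

@[simp]
theorem comp_app {X Y Z : ShiftSpectrum T} (f : X ⟶ Y) (g : Y ⟶ Z) (n : ℤ) :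
    (f ≫ g).app n = f.app n ≫ g.app n := rfl

@[ext]
theorem hom_ext {X Y : ShiftSpectrum T} {f g : X ⟶ Y} (h : ∀ n, f.app n = g.app n) : f = g :=
  Hom.ext (funext h)

/-- An isomorphism of sequences from its components. -/
def isoMk {X Y : ShiftSpectrum T} (e : ∀ n, X.obj n ≅ Y.obj n)
    (comm : ∀ n m h, T.map (e n).hom ≫ (Y.iso n m h).hom = (X.iso n m h).hom ≫ (e m).hom) :
    X ≅ Y where
  hom := { app := fun n => (e n).hom, comm := comm }
  inv := { app := fun n => (e n).inv, comm := fun n m h => by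
            rw [← cancel_mono (e m).hom, Category.assoc, Category.assoc, ← comm,
              ← T.map_comp_assoc]
            simp }

@[simp]
theorem isoMk_hom_app {X Y : ShiftSpectrum T} (e : ∀ n, X.obj n ≅ Y.obj n) (comm) (n : ℤ) :
    (isoMk e comm).hom.app n = (e n).hom := rfl

@[simp]
theorem isoMk_inv_app {X Y : ShiftSpectrum T} (e : ∀ n, X.obj n ≅ Y.obj n) (comm) (n : ℤ) :
    (isoMk e comm).inv.app n = (e n).inv := rfl

variable (T) in
/-- The shift of sequences. -/
@[simps]
def shift (a : ℤ) : ShiftSpectrum T ⥤ ShiftSpectrum T where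
  obj X := { obj := fun n => X.obj (n + a), iso := fun n m h => X.iso (n + a) (m + a) (by lia) }
  map f := { app := fun n => f.app (n + a), comm := fun _ _ _ => f.comm _ _ _ }

/-- Indices such as `n + (a + b)` and `n + b + a` are only propositionally equal; this makes
transport along such equalities a morphism of sequences. -/
theorem map_eqToHom_iso (X : ShiftSpectrum T) {n n' m m' : ℤ} (hn : n = n') (hm : m = m')
    (h : n + 1 = m) (h' : n' + 1 = m') :
    T.map (eqToHom (congrArg X.obj hn)) ≫ (X.iso n' m' h').hom =
      (X.iso n m h).hom ≫ eqToHom (congrArg X.obj hm) := by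
  subst hn hm; simp

theorem app_eqToHom {X Y : ShiftSpectrum T} (f : X ⟶ Y) {n n' : ℤ} (hn : n = n') :
    f.app n ≫ eqToHom (congrArg Y.obj hn) = eqToHom (congrArg X.obj hn) ≫ f.app n' := by
  subst hn; simp

theorem eqToHom_app {X Y : ShiftSpectrum T} (h : X = Y) (n : ℤ) :
    (eqToHom h).app n = eqToHom (by rw [h]) := by
  subst h; rfl

variable (T) in
/-- The shift by `0` is the identity. -/
def shiftZero : shift T 0 ≅ 𝟭 _ :=
  NatIso.ofComponents
    (fun X => isoMk (fun n => eqToIso (congrArg X.obj (add_zero n)))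
      (fun n m h => X.map_eqToHom_iso (add_zero n) (add_zero m) _ h))
    (fun f => by ext n; exact app_eqToHom f (add_zero n))

@[simp]
theorem shiftZero_inv_app_app (X : ShiftSpectrum T) (n : ℤ) :
    ((shiftZero T).inv.app X).app n = eqToHom (congrArg X.obj (add_zero n).symm) := rfl

variable (T) in
/-- The shift by `a + b` is the composition of the shifts by `a` and `b`. -/
def shiftAdd (a b : ℤ) : shift T (a + b) ≅ shift T a ⋙ shift T b :=
  NatIso.ofComponents
    (fun X => isoMk (fun n => eqToIso (congrArg X.obj (show n + (a + b) = n + b + a by lia)))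
      (fun n m h => X.map_eqToHom_iso (by lia) (by lia) _ _))
    (fun f => by ext n; exact app_eqToHom f (show n + (a + b) = n + b + a by lia))

@[simp]
theorem shiftAdd_hom_app_app (a b : ℤ) (X : ShiftSpectrum T) (n : ℤ) :
    ((shiftAdd T a b).hom.app X).app n =
      eqToHom (congrArg X.obj (show n + (a + b) = n + b + a by lia)) := rfl

/-- Sequences have a shift by `ℤ`. -/
instance : HasShift (ShiftSpectrum T) ℤ :=
  hasShiftMk _ _
    { F := shift T
      zero := shiftZero T
      add := shiftAdd T
      assoc_hom_app := fun a b c X => by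
        ext n
        simp only [comp_app, eqToHom_app, shiftAdd_hom_app_app, shift_map_app]
        erw [eqToHom_trans, eqToHom_trans, eqToHom_trans]
      zero_add_hom_app := fun a X => by
        ext n
        simp only [comp_app, eqToHom_app, shiftAdd_hom_app_app, shift_map_app,
          shiftZero_inv_app_app]
        exact (eqToHom_trans _ _).symm
      add_zero_hom_app := fun a X => by
        ext n
        simp only [comp_app, eqToHom_app, shiftAdd_hom_app_app, shiftZero_inv_app_app]
        exact (eqToHom_trans _ _).symm }

variable (T) in
theorem shiftFunctor_eq (a : ℤ) : shiftFunctor (ShiftSpectrum T) a = shift T a := rfl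

variable (T) in
/-- Evaluation of sequences. -/
@[simps]
def eval (n : ℤ) : ShiftSpectrum T ⥤ E where
  obj X := X.obj n
  map f := f.app n

/-- The component at `0` determines the others: upwards through the structure isomorphisms,
downwards because `T` is faithful. -/
instance [T.Faithful] : (eval T 0).Faithful where
  map_injective {X Y f g} h := by
    ext n
    induction n using Int.induction_on with
    | zero => exact h
    | succ n ih =>
      rw [← cancel_epi (X.iso n (n + 1) rfl).hom, ← f.comm, ← g.comm, ih]
    | pred n ih =>
      apply T.map_injective
      rw [← cancel_mono (Y.iso (-n - 1) (-n) (by lia)).hom, f.comm, g.comm, ih]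

/-- The components of the extension of a morphism between terms of index zero. -/
def extendApp [T.Full] (X Y : ShiftSpectrum T) (f : X.obj 0 ⟶ Y.obj 0) :
    ∀ n : ℤ, X.obj n ⟶ Y.obj n
  | .ofNat n => Nat.rec (motive := fun n => X.obj (.ofNat n) ⟶ Y.obj (.ofNat n)) f
      (fun n g => (X.iso (.ofNat n) (.ofNat (n + 1)) rfl).inv ≫ T.map g ≫
        (Y.iso (.ofNat n) (.ofNat (n + 1)) rfl).hom) n
  | .negSucc n => Nat.rec (motive := fun n => X.obj (.negSucc n) ⟶ Y.obj (.negSucc n))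
      (T.preimage ((X.iso (.negSucc 0) 0 rfl).hom ≫ f ≫ (Y.iso (.negSucc 0) 0 rfl).inv))
      (fun n g => T.preimage ((X.iso (.negSucc (n + 1)) (.negSucc n) rfl).hom ≫ g ≫
        (Y.iso (.negSucc (n + 1)) (.negSucc n) rfl).inv)) n

theorem extendApp_comm [T.Full] (X Y : ShiftSpectrum T) (f : X.obj 0 ⟶ Y.obj 0) (n m : ℤ)
    (h : n + 1 = m) :
    T.map (extendApp X Y f n) ≫ (Y.iso n m h).hom = (X.iso n m h).hom ≫ extendApp X Y f m := by
  have down : ∀ {n m : ℤ} (h : n + 1 = m) (g : X.obj m ⟶ Y.obj m),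
      T.map (T.preimage ((X.iso n m h).hom ≫ g ≫ (Y.iso n m h).inv)) ≫ (Y.iso n m h).hom =
        (X.iso n m h).hom ≫ g := fun h g => by simp
  have up : ∀ {n m : ℤ} (h : n + 1 = m) (g : X.obj n ⟶ Y.obj n),
      T.map g ≫ (Y.iso n m h).hom =
        (X.iso n m h).hom ≫ (X.iso n m h).inv ≫ T.map g ≫ (Y.iso n m h).hom :=
    fun h g => by simp
  subst h
  rcases n with n | n
  · exact up (m := .ofNat (n + 1)) rfl _
  · rcases n with _ | n
    · exact down (n := .negSucc 0) (m := 0) rfl f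
    · exact down (n := .negSucc (n + 1)) (m := .negSucc n) rfl _

instance [T.Full] : (eval T 0).Full where
  map_surjective {X Y} f := ⟨{ app := extendApp X Y f, comm := extendApp_comm X Y f }, rfl⟩

/-- The sequence of iterates of an object under `T` and a quasi-inverse. -/
def iterates (T S : E ⥤ E) (X : E) : ℤ → E
  | .ofNat n => Nat.rec (motive := fun _ => E) X (fun _ Y => T.obj Y) n
  | .negSucc n => Nat.rec (motive := fun _ => E) (S.obj X) (fun _ Y => S.obj Y) n

instance [T.IsEquivalence] : (eval T 0).EssSurj where
  mem_essImage X := by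
    refine ⟨{ obj := iterates T T.inv X, iso := ?_ }, ⟨Iso.refl _⟩⟩
    rintro n m rfl
    rcases n with n | n
    · exact Iso.refl _
    · rcases n with _ | n
      · exact T.asEquivalence.counitIso.app X
      · exact T.asEquivalence.counitIso.app (iterates T T.inv X (.negSucc n))

instance [T.IsEquivalence] : (eval T 0).IsEquivalence where

end ShiftSpectrum

open ShiftSpectrum in
/-- An autoequivalence is the shift by `1` for some shift by `ℤ`. -/
theorem exists_hasShift_int (T : E ⥤ E) [T.IsEquivalence] :
    ∃ _ : HasShift E ℤ, Nonempty (T ≅ shiftFunctor E (1 : ℤ)) := by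
  -- An equivalence is a localization at the isomorphisms, so precomposition with it is fully
  -- faithful; transporting the shift along `eval T 0` relies on this.
  have h0 : (eval T 0).IsLocalization (MorphismProperty.isomorphisms _) :=
    Functor.IsLocalization.of_isEquivalence _ _ (fun _ _ _ h => h)
  have h1 := Localization.full_whiskeringLeft (eval T 0) (MorphismProperty.isomorphisms _) E
  have h2 := Localization.faithful_whiskeringLeft (eval T 0) (MorphismProperty.isomorphisms _) E
  let s (a : ℤ) : E ⥤ E := 
    (eval T 0).inv ⋙ shiftFunctor (ShiftSpectrum T) a ⋙ eval T 0
  let i (a : ℤ) : eval T 0 ⋙ s a ≅ shiftFunctor (ShiftSpectrum T) a ⋙ eval T 0 :=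
    Functor.isoWhiskerRight (eval T 0).asEquivalence.unitIso.symm
      (shiftFunctor (ShiftSpectrum T) a ⋙ eval T 0)
  -- Shifting and evaluating at `0` yields the term of index `1`, which is `T` of the term of index
  -- `0`.
  let j : shift T (1 : ℤ) ⋙ eval T 0 ≅ eval T 0 ⋙ T :=
    NatIso.ofComponents (fun X => (X.iso 0 (0 + 1) rfl).symm) (fun {X Y} f => by
      change f.app (0 + 1) ≫ (Y.iso 0 (0 + 1) rfl).inv =
        (X.iso 0 (0 + 1) rfl).inv ≫ T.map (f.app 0)
      rw [Iso.comp_inv_eq, Category.assoc, f.comm, Iso.inv_hom_id_assoc])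
  exact ⟨HasShift.induced (eval T 0) ℤ s i,
    ⟨(Functor.isoWhiskerLeft (eval T 0).inv
        (Functor.isoWhiskerRight (eqToIso (shiftFunctor_eq T 1)) (eval T 0) ≪≫ j) ≪≫
      Functor.isoWhiskerRight (eval T 0).asEquivalence.counitIso T).symm⟩⟩

end Spectra

/-! ### Functors that commute with integer shifts -/

section CommShift

variable {C : Type u₁} [Category.{v₁} C] {D : Type u₂} [Category.{v₂} D]
  [HasShift C ℤ] [HasShift D ℤ] {F : C ⥤ D}

open Functor.CommShift

/-- Commutation with the shift by `n + 1` and by `1` gives commutation with the shift by `n`. -/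
theorem exists_isoAdd'_one_eq {n m : ℤ} (h : n + 1 = m)
    (e : shiftFunctor C (1 : ℤ) ⋙ F ≅ F ⋙ shiftFunctor D (1 : ℤ))
    (em : shiftFunctor C m ⋙ F ≅ F ⋙ shiftFunctor D m) :
    ∃ en : shiftFunctor C n ⋙ F ≅ F ⋙ shiftFunctor D n, isoAdd' h en e = em := by
  -- This is what the shift by `1` of the unknown `en` has to be; full faithfulness of that shift
  -- recovers `en`.
  let a : shiftFunctor C n ⋙ F ⋙ shiftFunctor D (1 : ℤ) ≅
      F ⋙ shiftFunctor D n ⋙ shiftFunctor D (1 : ℤ) :=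
    Functor.isoWhiskerLeft _ e.symm ≪≫
      Functor.isoWhiskerRight (shiftFunctorAdd' C n 1 m h).symm F ≪≫ em ≪≫
        Functor.isoWhiskerLeft F (shiftFunctorAdd' D n 1 m h)
  refine ⟨NatIso.ofComponents (fun X => (shiftFunctor D (1 : ℤ)).preimageIso (a.app X))
    (fun {X Y} f => (shiftFunctor D (1 : ℤ)).map_injective ?_), ?_⟩
  · simpa using a.hom.naturality f
  · ext X
    have h1 : a.hom.app X = e.inv.app _ ≫ F.map ((shiftFunctorAdd' C n 1 m h).inv.app X) ≫
        em.hom.app X ≫ (shiftFunctorAdd' D n 1 m h).hom.app (F.obj X) := rfl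
    rw [isoAdd'_hom_app]
    simp only [NatIso.ofComponents_hom_app, Functor.preimageIso_hom, Functor.map_preimage,
      Iso.app_hom, h1, Category.assoc, Iso.hom_inv_id_app, Functor.comp_obj]
    rw [Iso.hom_inv_id_app_assoc, ← F.map_comp_assoc, Iso.hom_inv_id_app, F.map_id]
    exact (Category.id_comp _).trans (Category.comp_id _)

theorem isoAdd'_one_injective {n m : ℤ} (h : n + 1 = m)
    (e : shiftFunctor C (1 : ℤ) ⋙ F ≅ F ⋙ shiftFunctor D (1 : ℤ))
    {e₁ e₂ : shiftFunctor C n ⋙ F ≅ F ⋙ shiftFunctor D n}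
    (he : isoAdd' h e₁ e = isoAdd' h e₂ e) : e₁ = e₂ := by
  ext X
  apply (shiftFunctor D (1 : ℤ)).map_injective
  have := congrArg (fun z => z.hom.app X) he
  simp only [isoAdd'_hom_app] at this
  rw [cancel_epi, cancel_epi, cancel_mono] at this
  exact this

variable (F) in
/-- A functor that commutes with the shift by `1` commutes with all shifts by integers. -/
theorem exists_commShift_int (e : shiftFunctor C (1 : ℤ) ⋙ F ≅ F ⋙ shiftFunctor D (1 : ℤ)) :
    ∃ h : F.CommShift ℤ, h.commShiftIso 1 = e := by
  -- `p` descends by one step. Iterating it downwards, and `isoAdd'` upwards, defines all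
  -- isomorphisms from the one at `0`.
  choose p hp using fun (n m : ℤ) (h : n + 1 = m) => exists_isoAdd'_one_eq (F := F) h e
  let c : ∀ n : ℤ, shiftFunctor C n ⋙ F ≅ F ⋙ shiftFunctor D n
    | .ofNat n => Nat.rec
        (motive := fun n => shiftFunctor C (.ofNat n : ℤ) ⋙ F ≅ F ⋙ shiftFunctor D (.ofNat n : ℤ))
        (isoZero F ℤ) (fun n g => isoAdd' (show Int.ofNat n + 1 = Int.ofNat (n + 1) from rfl) g e) n
    | .negSucc n => Nat.rec (motive := fun n =>
          shiftFunctor C (.negSucc n : ℤ) ⋙ F ≅ F ⋙ shiftFunctor D (.negSucc n : ℤ))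
        (p (.negSucc 0) 0 rfl (isoZero F ℤ))
        (fun n g => p (.negSucc (n + 1)) (.negSucc n) rfl g) n
  have c0 : c 0 = isoZero F ℤ := rfl
  have cs : ∀ (n m : ℤ) (h : n + 1 = m), c m = isoAdd' h (c n) e := by
    rintro n m rfl
    rcases n with n | n
    · rfl
    · rcases n with _ | n
      · exact (hp (.negSucc 0) 0 rfl _).symm
      · exact (hp (.negSucc (n + 1)) (.negSucc n) rfl _).symm
  have ca : ∀ (a b ab : ℤ) (h : a + b = ab), c ab = isoAdd' h (c a) (c b) := by
    intro a b
    induction b using Int.induction_on with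
    | zero =>
      rintro ab h
      obtain rfl : a = ab := by lia
      rw [c0, isoAdd'_isoZero]
    | succ b ih =>
      intro ab h
      rw [cs (a + b) ab (by lia), ih (a + b) rfl, cs b (b + 1) rfl,
        isoAdd'_assoc (c a) (c b) e rfl rfl (by lia)]
    | pred b ih =>
      intro ab h
      -- Adding the isomorphism at `1` is injective, so the identity at `-b - 1` follows from the
      -- one at `-b`.
      refine isoAdd'_one_injective (m := a + -b) (by lia) e ?_
      rw [← cs, ih (a + -b) rfl, isoAdd'_assoc (c a) _ e h (show -(b : ℤ) - 1 + 1 = -b by lia)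
        (by lia), ← cs]
  refine ⟨{ commShiftIso := c, commShiftIso_zero := c0,
            commShiftIso_add := fun a b => ca a b _ rfl }, ?_⟩
  change c 1 = e
  rw [cs 0 1 rfl, c0, isoZero_isoAdd'_]

end CommShift

/-! ### Pretriangulated structures from one-sided rotation -/

section OneSided

variable (E : Type u₁) [Category.{v₁} E] [Preadditive E] [HasZeroObject E] [HasShift E ℤ]
  [∀ n : ℤ, (shiftFunctor E n).Additive]

open ZeroObject

variable {E} in
/-- An isomorphism of triangles from its components. -/
def triangleIso {X Y Z X' Y' Z' : E} {f : X ⟶ Y} {g : Y ⟶ Z} {h : Z ⟶ X⟦(1 : ℤ)⟧}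
    {f' : X' ⟶ Y'} {g' : Y' ⟶ Z'} {h' : Z' ⟶ X'⟦(1 : ℤ)⟧} (e₁ : X ≅ X') (e₂ : Y ≅ Y')
    (e₃ : Z ≅ Z') (comm₁ : f ≫ e₂.hom = e₁.hom ≫ f') (comm₂ : g ≫ e₃.hom = e₂.hom ≫ g')
    (comm₃ : h ≫ e₁.hom⟦(1 : ℤ)⟧' = e₃.hom ≫ h') :
    Triangle.mk f g h ≅ Triangle.mk f' g' h' :=
  Triangle.isoMk _ _ e₁ e₂ e₃ comm₁ comm₂ comm₃

variable {E} in
theorem exists_isos_of_triangleIso {X Y Z X' Y' Z' : E} {f : X ⟶ Y} {g : Y ⟶ Z} {h : Z ⟶ X⟦(1 : ℤ)⟧}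
    {f' : X' ⟶ Y'} {g' : Y' ⟶ Z'} {h' : Z' ⟶ X'⟦(1 : ℤ)⟧}
    (j : Triangle.mk f g h ≅ Triangle.mk f' g' h') :
    ∃ (e₁ : X ≅ X') (e₂ : Y ≅ Y') (e₃ : Z ≅ Z'), f ≫ e₂.hom = e₁.hom ≫ f' ∧
      g ≫ e₃.hom = e₂.hom ≫ g' ∧ h ≫ e₁.hom⟦(1 : ℤ)⟧' = e₃.hom ≫ h' :=
  ⟨Triangle.π₁.mapIso j, Triangle.π₂.mapIso j, Triangle.π₃.mapIso j, j.hom.comm₁, j.hom.comm₂,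
    j.hom.comm₃⟩

/-- The axioms of a pretriangulated category, where triangles are only required to stay
distinguished after rotation in one direction. -/
structure PretriangulatedCore where
  dist : Set (Triangle E)
  iso_mem : ∀ T₁ ∈ dist, ∀ T₂, (T₂ ≅ T₁) → T₂ ∈ dist
  contractible_mem : ∀ X : E, contractibleTriangle X ∈ dist
  exists_mem : ∀ {X Y : E} (f : X ⟶ Y),
    ∃ (Z : E) (g : Y ⟶ Z) (h : Z ⟶ X⟦(1 : ℤ)⟧), Triangle.mk f g h ∈ dist
  rotate_mem : ∀ {X Y Z : E} {f : X ⟶ Y} {g : Y ⟶ Z} {h : Z ⟶ X⟦(1 : ℤ)⟧},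
    Triangle.mk f g h ∈ dist → Triangle.mk g h (-f⟦(1 : ℤ)⟧') ∈ dist
  complete : ∀ {X Y Z X' Y' Z' : E} {f : X ⟶ Y} {g : Y ⟶ Z} {h : Z ⟶ X⟦(1 : ℤ)⟧}
      {f' : X' ⟶ Y'} {g' : Y' ⟶ Z'} {h' : Z' ⟶ X'⟦(1 : ℤ)⟧},
      Triangle.mk f g h ∈ dist → Triangle.mk f' g' h' ∈ dist →
      ∀ (a : X ⟶ X') (b : Y ⟶ Y'), f ≫ b = a ≫ f' →
      ∃ c : Z ⟶ Z', g ≫ c = b ≫ g' ∧ h ≫ a⟦(1 : ℤ)⟧' = c ≫ h'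

namespace PretriangulatedCore

variable {E} (D : PretriangulatedCore E)
include D

/-- Comparing the rotated contractible triangle on `A` with the rotation of the given one yields a
map `A⟦1⟧ ⟶ X⟦1⟧`, and the shift is full and faithful. Inverse rotation, still to be proved, is
avoided. -/
theorem exists_lift {X Y Z : E} {f : X ⟶ Y} {g : Y ⟶ Z} {h : Z ⟶ X⟦(1 : ℤ)⟧}
    (hT : Triangle.mk f g h ∈ D.dist) {A : E} (a : A ⟶ Y) (ha : a ≫ g = 0) :
    ∃ l : A ⟶ X, l ≫ f = a := by
  obtain ⟨c, -, hc⟩ := D.complete (D.rotate_mem (D.contractible_mem A))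
    (D.rotate_mem hT) a 0 (by rw [ha, zero_comp])
  obtain ⟨l, rfl⟩ := (shiftFunctor E (1 : ℤ)).map_surjective c
  refine ⟨l, (shiftFunctor E (1 : ℤ)).map_injective ?_⟩
  simpa using hc.symm

/-- Replaces the five lemma. A map `ψ` goes back, and both composites are unipotent: if `x` is
compatible with `g` and `h`, then `x - 𝟙` has the form `l ≫ g`, while `g ≫ (x - 𝟙) = 0`, so its
square vanishes. -/
theorem isIso_of_comm {X Y Z Z' : E} {f : X ⟶ Y} {g : Y ⟶ Z} {h : Z ⟶ X⟦(1 : ℤ)⟧}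
    {g' : Y ⟶ Z'} {h' : Z' ⟶ X⟦(1 : ℤ)⟧} (hT : Triangle.mk f g h ∈ D.dist)
    (hT' : Triangle.mk f g' h' ∈ D.dist) (φ : Z ⟶ Z') (h1 : g ≫ φ = g') (h2 : φ ≫ h' = h) :
    IsIso φ := by
  obtain ⟨ψ, k1, k2⟩ := D.complete hT' hT (𝟙 X) (𝟙 Y) (by simp)
  rw [Category.id_comp] at k1
  rw [CategoryTheory.Functor.map_id, Category.comp_id] at k2
  have key : ∀ {Z : E} {g : Y ⟶ Z} {h : Z ⟶ X⟦(1 : ℤ)⟧} (_ : Triangle.mk f g h ∈ D.dist)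
      (x : Z ⟶ Z) (_ : g ≫ x = g) (_ : x ≫ h = h), IsIso x := by
    intro Z g h hT x hx1 hx2
    obtain ⟨l, hl⟩ := D.exists_lift (D.rotate_mem hT) (x - 𝟙 Z) (by
      rw [Preadditive.sub_comp, hx2, Category.id_comp, sub_self])
    have h0 : (x - 𝟙 Z) ≫ (x - 𝟙 Z) = 0 := by
      nth_rewrite 1 [← hl]
      rw [Category.assoc, Preadditive.comp_sub, hx1, Category.comp_id, sub_self, comp_zero]
    obtain ⟨y, hy⟩ : ∃ y, x = 𝟙 Z + y := ⟨x - 𝟙 Z, by abel⟩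
    subst hy
    rw [add_sub_cancel_left] at h0
    exact ⟨𝟙 Z - y, by simp [h0], by simp [h0]⟩
  have i1 := key hT (φ ≫ ψ) (by rw [reassoc_of% h1, k1]) (by rw [Category.assoc, ← k2, h2])
  have i2 := key hT' (ψ ≫ φ) (by rw [reassoc_of% k1, h1]) (by rw [Category.assoc, h2, k2])
  have : IsSplitMono φ := ⟨⟨ψ ≫ inv (φ ≫ ψ), by rw [← Category.assoc, IsIso.hom_inv_id]⟩⟩
  have : Epi φ := epi_of_epi ψ φ
  exact isIso_of_epi_of_isSplitMono φ

/-- Complete `f` to a distinguished triangle and compare third rotations, both of which begin with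
`-f⟦1⟧`. The isomorphism obtained between shifted third objects comes from an unshifted one. -/
theorem mem_of_rotate_mem {X Y Z : E} {f : X ⟶ Y} {g : Y ⟶ Z} {w : Z ⟶ X⟦(1 : ℤ)⟧}
    (h : Triangle.mk g w (-f⟦(1 : ℤ)⟧') ∈ D.dist) : Triangle.mk f g w ∈ D.dist := by
  obtain ⟨Z', g', w', hT'⟩ := D.exists_mem f
  have h3 := D.rotate_mem (D.rotate_mem h)
  have h3' := D.rotate_mem (D.rotate_mem (D.rotate_mem hT'))
  obtain ⟨φ, k1, k2⟩ := D.complete h3 h3' (𝟙 _) (𝟙 _) (by simp)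
  rw [Category.id_comp] at k1
  rw [CategoryTheory.Functor.map_id, Category.comp_id] at k2
  have : IsIso φ := D.isIso_of_comm h3 h3' φ k1 k2.symm
  obtain ⟨ψ, rfl⟩ := (shiftFunctor E (1 : ℤ)).map_surjective φ
  have : IsIso ψ := isIso_of_reflects_iso ψ (shiftFunctor E (1 : ℤ))
  have l1 : g ≫ ψ = g' := (shiftFunctor E (1 : ℤ)).map_injective (by simpa using k1)
  have l2 : ψ ≫ w' = w := (shiftFunctor E (1 : ℤ)).map_injective (by simpa using k2.symm)
  exact D.iso_mem _ hT' _ (triangleIso (Iso.refl X) (Iso.refl Y) (asIso ψ) (by simp)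
    (by simp [l1]) (by simp [l2]))

/-- The pretriangulated structure defined by a `PretriangulatedCore`. -/
@[reducible]
def pretriangulated : Pretriangulated E where
  distinguishedTriangles := D.dist
  isomorphic_distinguished T₁ h T₂ e := D.iso_mem T₁ h T₂ e
  contractible_distinguished := D.contractible_mem
  distinguished_cocone_triangle := D.exists_mem
  rotate_distinguished_triangle _ := ⟨D.rotate_mem, D.mem_of_rotate_mem⟩
  complete_distinguished_triangle_morphism _ _ h₁ h₂ a b h := D.complete h₁ h₂ a b h

end PretriangulatedCore

end OneSided

/-! ### Stable categories attached to functorial embeddings -/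

/-- A functorial embedding `i : X ⟶ I X` with cokernel `p : I X ⟶ T X` for which the objects
`I N` are injective relative to the embeddings and projective relative to the projections. -/
structure StableData (𝒜 : Type u₁) [Category.{v₁} 𝒜] [Preadditive 𝒜] where
  I : 𝒜 ⥤ 𝒜
  T : 𝒜 ⥤ 𝒜
  additive_T : T.Additive
  i : ∀ X, X ⟶ I.obj X
  p : ∀ X, I.obj X ⟶ T.obj X
  i_naturality : ∀ {X Y : 𝒜} (f : X ⟶ Y), f ≫ i Y = i X ≫ I.map f
  p_naturality : ∀ {X Y : 𝒜} (f : X ⟶ Y), I.map f ≫ p Y = p X ≫ T.map f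
  i_p : ∀ X, i X ≫ p X = 0
  mono_i : ∀ X, Mono (i X)
  epi_p : ∀ X, Epi (p X)
  lift : ∀ {X Z : 𝒜} (g : Z ⟶ I.obj X), g ≫ p X = 0 → ∃ h, h ≫ i X = g
  desc : ∀ {X Z : 𝒜} (g : I.obj X ⟶ Z), i X ≫ g = 0 → ∃ h, p X ≫ h = g
  extend : ∀ {X N : 𝒜} (g : X ⟶ I.obj N), ∃ g', i X ≫ g' = g
  cover : ∀ {X N : 𝒜} (g : I.obj N ⟶ T.obj X), ∃ g', g' ≫ p X = g
  -- Input for essential surjectivity of `T`: a sequence `X ⟶ I N ⟶ M` such that `i X` extends over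
  -- `I N`, which makes `M` stably isomorphic to `T X`.
  exists_loop : ∀ M : 𝒜, ∃ (X N : 𝒜) (a : X ⟶ I.obj N) (b : I.obj N ⟶ M)
    (e : I.obj N ⟶ I.obj X), a ≫ e = i X ∧ a ≫ b = 0 ∧ Epi b ∧
      ∀ {Z : 𝒜} (g : I.obj N ⟶ Z), a ≫ g = 0 → ∃ h, b ≫ h = g
  exists_pushout : ∀ {X Y : 𝒜} (f : X ⟶ Y),
    ∃ (Z : 𝒜) (v : Y ⟶ Z) (f' : I.obj X ⟶ Z), IsPushout f (i X) v f'

namespace StableData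

variable {𝒜 : Type u₁} [Category.{v₁} 𝒜] [Preadditive 𝒜] (D : StableData 𝒜)

attribute [instance] additive_T mono_i epi_p

theorem i_naturality_assoc {X Y Z : 𝒜} (f : X ⟶ Y) (h : D.I.obj Y ⟶ Z) :
    f ≫ D.i Y ≫ h = D.i X ≫ D.I.map f ≫ h := by
  rw [← Category.assoc, D.i_naturality, Category.assoc]

theorem i_p_assoc {X Z : 𝒜} (h : D.T.obj X ⟶ Z) : D.i X ≫ D.p X ≫ h = 0 := by
  rw [← Category.assoc, D.i_p, zero_comp]

/-- A morphism is null if it factors through an object of the form `I N`. -/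
def Null {X Y : 𝒜} (f : X ⟶ Y) : Prop :=
  ∃ (N : 𝒜) (a : X ⟶ D.I.obj N) (b : D.I.obj N ⟶ Y), f = a ≫ b

variable {D}

/-- By relative injectivity, a map through some `I N` already factors through the embedding of its
source; hence null maps are closed under sums. -/
theorem null_iff {X Y : 𝒜} {f : X ⟶ Y} : D.Null f ↔ ∃ g, D.i X ≫ g = f := by
  constructor
  · rintro ⟨N, a, b, rfl⟩
    obtain ⟨a', rfl⟩ := D.extend a
    exact ⟨a' ≫ b, by simp⟩
  · rintro ⟨g, rfl⟩
    exact ⟨X, D.i X, g, rfl⟩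

theorem Null.add {X Y : 𝒜} {f g : X ⟶ Y} (hf : D.Null f) (hg : D.Null g) : D.Null (f + g) := by
  rw [null_iff] at *
  obtain ⟨a, rfl⟩ := hf
  obtain ⟨b, rfl⟩ := hg
  exact ⟨a + b, by simp⟩

theorem Null.neg {X Y : 𝒜} {f : X ⟶ Y} (hf : D.Null f) : D.Null (-f) := by
  obtain ⟨N, a, b, rfl⟩ := hf
  exact ⟨N, a, -b, by simp⟩

variable (D) in
theorem null_zero (X Y : 𝒜) : D.Null (0 : X ⟶ Y) := null_iff.2 ⟨0, by simp⟩

theorem Null.comp_left {X Y Z : 𝒜} {f : X ⟶ Y} (hf : D.Null f) (g : Z ⟶ X) : D.Null (g ≫ f) := by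
  obtain ⟨N, a, b, rfl⟩ := hf
  exact ⟨N, g ≫ a, b, by simp⟩

theorem Null.comp_right {X Y Z : 𝒜} {f : X ⟶ Y} (hf : D.Null f) (g : Y ⟶ Z) : D.Null (f ≫ g) := by
  obtain ⟨N, a, b, rfl⟩ := hf
  exact ⟨N, a, b ≫ g, by simp⟩

/-- `T (I N)` need not have the form `I N'`, but `i (I N)` splits by relative injectivity, so `T (I
N)` is a retract of `I (I N)`. -/
theorem Null.map_T {X Y : 𝒜} {f : X ⟶ Y} (hf : D.Null f) : D.Null (D.T.map f) := by
  obtain ⟨N, a, b, rfl⟩ := hf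
  obtain ⟨ρ, hρ⟩ := D.extend (𝟙 (D.I.obj N))
  obtain ⟨s, hs⟩ := D.desc (𝟙 _ - ρ ≫ D.i _) (by simp [reassoc_of% hρ])
  have h1 : s ≫ D.p _ = 𝟙 (D.T.obj (D.I.obj N)) := by
    rw [← cancel_epi (D.p _), reassoc_of% hs]
    simp [i_p]
  rw [D.T.map_comp]
  exact ⟨_, D.T.map a ≫ s, D.p _ ≫ D.T.map b, by simp [reassoc_of% h1]⟩

/-! ### The stable category and its autoequivalence -/

section Quotient

variable {r : HomRel 𝒜} (hr : ∀ {X Y : 𝒜} (f g : X ⟶ Y), r f g ↔ D.Null (f - g))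
include hr

theorem congruence : Congruence r where
  equivalence := fun {X Y} =>
    { refl := fun f => (hr f f).2 (by rw [sub_self]; exact D.null_zero X Y)
      symm := fun h => (hr _ _).2 (by rw [← neg_sub]; exact ((hr _ _).1 h).neg)
      trans := fun h h' => (hr _ _).2 (by
        rw [← sub_add_sub_cancel]; exact ((hr _ _).1 h).add ((hr _ _).1 h')) }
  comp_left := fun f _ _ h => (hr _ _).2 (by
    rw [← Preadditive.comp_sub]; exact ((hr _ _).1 h).comp_left f)
  comp_right := fun g h => (hr _ _).2 (by
    rw [← Preadditive.sub_comp]; exact ((hr _ _).1 h).comp_right g)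

theorem map_eq_iff {X Y : 𝒜} (f g : X ⟶ Y) :
    (Quotient.functor r).map f = (Quotient.functor r).map g ↔ D.Null (f - g) := by
  have := congruence hr
  rw [Quotient.functor_map_eq_iff, hr]

theorem rel_add ⦃X Y : 𝒜⦄ (f₁ f₂ g₁ g₂ : X ⟶ Y) (hf : r f₁ f₂) (hg : r g₁ g₂) :
    r (f₁ + g₁) (f₂ + g₂) := by
  rw [hr] at *
  rw [add_sub_add_comm]
  exact hf.add hg

/-- The preadditive structure of the stable category. -/
@[reducible]
def preadditive : Preadditive (Quotient r) :=
  have := congruence hr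
  Quotient.preadditive r (rel_add hr)

theorem functor_additive : letI := preadditive hr; (Quotient.functor r).Additive :=
  have := congruence hr
  Quotient.functor_additive r (rel_add hr)

/-- An isomorphism in the stable category from mutually inverse morphisms modulo null ones. -/
def stableIso {X Y : 𝒜} (f : X ⟶ Y) (g : Y ⟶ X) (hfg : D.Null (f ≫ g - 𝟙 X))
    (hgf : D.Null (g ≫ f - 𝟙 Y)) : (Quotient.functor r).obj X ≅ (Quotient.functor r).obj Y where
  hom := (Quotient.functor r).map f
  inv := (Quotient.functor r).map g
  hom_inv_id := by
    rw [← Functor.map_comp, ← CategoryTheory.Functor.map_id]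
    exact (map_eq_iff hr _ _).2 hfg
  inv_hom_id := by
    rw [← Functor.map_comp, ← CategoryTheory.Functor.map_id]
    exact (map_eq_iff hr _ _).2 hgf

/-- The endofunctor of the stable category induced by `T`. -/
def stableT : CategoryTheory.Quotient r ⥤ CategoryTheory.Quotient r :=
  CategoryTheory.Quotient.lift r (D.T ⋙ Quotient.functor r) (fun X Y f g h => by
    rw [Functor.comp_map, Functor.comp_map, map_eq_iff hr, ← D.T.map_sub]
    exact ((hr f g).1 h).map_T)

/-- If `T f = a ≫ b`, lift `b` through `p Y` to `b'`. Then `I f - p X ≫ a ≫ b'` is killed by `p Y`,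
and its lift to a map `I X ⟶ Y` extends `f` along `i X`. -/
theorem null_of_null_map_T {X Y : 𝒜} {f : X ⟶ Y} (hf : D.Null (D.T.map f)) : D.Null f := by
  obtain ⟨N, a, b, h⟩ := hf
  obtain ⟨b', rfl⟩ := D.cover b
  obtain ⟨l, hl⟩ := D.lift (D.I.map f - D.p X ≫ a ≫ b') (by
    rw [Preadditive.sub_comp, p_naturality, h]
    simp)
  refine null_iff.2 ⟨l, ?_⟩
  rw [← cancel_mono (D.i Y), Category.assoc, hl, i_naturality]
  simp [i_p_assoc]

/-- Fullness: relative projectivity lifts a map `T X ⟶ T Y` to `I X ⟶ I Y`, which restricts to the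
kernels. Essential surjectivity: as in Schanuel's lemma, comparing the loop sequence of `M` with `X
⟶ I X ⟶ T X` gives maps that are mutually inverse up to null maps. -/
theorem stableT_isEquivalence : (stableT hr).IsEquivalence where
  faithful := ⟨by
    rintro ⟨X⟩ ⟨Y⟩ f g h
    obtain ⟨f, rfl⟩ := (Quotient.functor r).map_surjective (X := X) (Y := Y) f
    obtain ⟨g, rfl⟩ := (Quotient.functor r).map_surjective (X := X) (Y := Y) g
    change (Quotient.functor r).map (D.T.map f) = (Quotient.functor r).map (D.T.map g) at h
    rw [map_eq_iff hr, ← D.T.map_sub] at h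
    rw [map_eq_iff hr]
    exact null_of_null_map_T hr h⟩
  full := ⟨by
    rintro ⟨X⟩ ⟨Y⟩ g
    obtain ⟨g, rfl⟩ := (Quotient.functor r).map_surjective (X := D.T.obj X) (Y := D.T.obj Y) g
    obtain ⟨q, hq⟩ := D.cover (D.p X ≫ g)
    obtain ⟨f, hf⟩ := D.lift (D.i X ≫ q) (by rw [Category.assoc, hq, i_p_assoc])
    -- `I f` and `q` both extend `f`, so their difference descends to `T X`, and `T f - g` factors
    -- through `I Y`.
    obtain ⟨l, hl⟩ := D.desc (D.I.map f - q) (by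
      rw [Preadditive.comp_sub, ← i_naturality, hf, sub_self])
    refine ⟨(Quotient.functor r).map f, ?_⟩
    change (Quotient.functor r).map (D.T.map f) = (Quotient.functor r).map g
    rw [map_eq_iff hr]
    refine ⟨_, l, D.p Y, ?_⟩
    rw [← cancel_epi (D.p X), reassoc_of% hl, Preadditive.comp_sub, ← p_naturality,
      Preadditive.sub_comp, hq]⟩
  essSurj := ⟨by
    rintro ⟨M⟩
    obtain ⟨X, N, a, b, e, hae, hab, hb, hd⟩ := D.exists_loop M
    obtain ⟨c, hc⟩ := D.extend a
    obtain ⟨φ, hφ⟩ := hd (e ≫ D.p X) (by rw [reassoc_of% hae, i_p])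
    obtain ⟨ψ, hψ⟩ := D.desc (c ≫ b) (by rw [reassoc_of% hc, hab])
    obtain ⟨l, hl⟩ := hd (e ≫ c - 𝟙 _) (by simp [reassoc_of% hae, hc])
    obtain ⟨m, hm⟩ := D.desc (c ≫ e - 𝟙 _) (by simp [reassoc_of% hc, hae])
    refine ⟨(Quotient.functor r).obj X, ⟨stableIso hr ψ φ ⟨_, m, D.p X, ?_⟩ ⟨_, l, b, ?_⟩⟩⟩
    · rw [← cancel_epi (D.p X), reassoc_of% hm]
      simp only [Preadditive.comp_sub, reassoc_of% hψ, hφ, Preadditive.sub_comp, Category.assoc,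
        Category.id_comp]
      exact congrArg _ (Category.comp_id _)
    · rw [← cancel_epi b, reassoc_of% hl]
      simp [reassoc_of% hφ, hψ]⟩

end Quotient
/-- `Z` is the cone of `f`: the pushout of `f` along `i X`, with its maps from `Y` and to `T X`. -/
def IsCone (D : StableData 𝒜) {X Y Z : 𝒜} (f : X ⟶ Y) (v : Y ⟶ Z) (w : Z ⟶ D.T.obj X) : Prop :=
  ∃ f' : D.I.obj X ⟶ Z, IsPushout f (D.i X) v f' ∧ v ≫ w = 0 ∧ f' ≫ w = D.p X

variable (D) in
theorem exists_isCone {X Y : 𝒜} (f : X ⟶ Y) :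
    ∃ (Z : 𝒜) (v : Y ⟶ Z) (w : Z ⟶ D.T.obj X), D.IsCone f v w := by
  obtain ⟨Z, v, f', h⟩ := D.exists_pushout f
  exact ⟨Z, v, h.desc 0 (D.p X) (by simp [i_p]), f', h, by simp, by simp⟩

/-- `z` is a cokernel of `x`. -/
structure IsCoker {X Y Z : 𝒜} (x : X ⟶ Y) (z : Y ⟶ Z) : Prop where
  zero : x ≫ z = 0
  epi : Epi z
  desc : ∀ {A : 𝒜} (g : Y ⟶ A), x ≫ g = 0 → ∃ h, z ≫ h = g

/-! ### The triangulation by cones -/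

section Triangulated

variable {r : HomRel 𝒜} (hr : ∀ {X Y : 𝒜} (f g : X ⟶ Y), r f g ↔ D.Null (f - g))
  [Preadditive (CategoryTheory.Quotient r)] [hadd : (Quotient.functor r).Additive]
  [HasShift (CategoryTheory.Quotient r) ℤ]
  (e : D.T ⋙ Quotient.functor r ≅
    Quotient.functor r ⋙ shiftFunctor (CategoryTheory.Quotient r) (1 : ℤ))

local notation "Q" => Quotient.functor r

theorem e_naturality {X Y : 𝒜} (f : X ⟶ Y) :
    (Q).map (D.T.map f) ≫ e.hom.app Y = e.hom.app X ≫ ((Q).map f)⟦(1 : ℤ)⟧' :=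
  e.hom.naturality f

/-- The triangles isomorphic to images of cones. -/
def distSet : Set (Triangle (CategoryTheory.Quotient r)) :=
  {t | ∃ (X Y Z : 𝒜) (f : X ⟶ Y) (v : Y ⟶ Z) (w : Z ⟶ D.T.obj X), D.IsCone f v w ∧
    Nonempty (t ≅ Triangle.mk ((Q).map f) ((Q).map v) ((Q).map w ≫ e.hom.app X))}

theorem mem_distSet_of_iso {t t' : Triangle (CategoryTheory.Quotient r)} (ht : t ∈ distSet e)
    (i : t' ≅ t) : t' ∈ distSet e := by
  obtain ⟨X, Y, Z, f, v, w, h, ⟨j⟩⟩ := ht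
  exact ⟨X, Y, Z, f, v, w, h, ⟨i ≪≫ j⟩⟩

theorem IsCone.mem_distSet {X Y Z : 𝒜} {f : X ⟶ Y} {v : Y ⟶ Z} {w : Z ⟶ D.T.obj X}
    (h : D.IsCone f v w) :
    Triangle.mk ((Q).map f) ((Q).map v) ((Q).map w ≫ e.hom.app X) ∈ distSet e :=
  ⟨X, Y, Z, f, v, w, h, ⟨Iso.refl _⟩⟩

include hr

/-- Since `i X` extends to `a` along `x`, the cone of `x` splits into `Z` and `I X`, hence is stably
the cokernel `Z`. The section `s` is induced by `v - a ≫ f'`; as the connecting map vanishes on `v`,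
it gives the sign. Rotation and the octahedral axiom both reduce to this. -/
theorem mem_distSet_of_isCoker {X Y Z : 𝒜} {x : X ⟶ Y} {z : Y ⟶ Z} (hz : IsCoker x z)
    {a : Y ⟶ D.I.obj X} (ha : x ≫ a = D.i X) {w : Z ⟶ D.T.obj X} (hw : z ≫ w = a ≫ D.p X) :
    Triangle.mk ((Q).map x) ((Q).map z) (-(Q).map w ≫ e.hom.app X) ∈ distSet e := by
  have := hz.epi
  obtain ⟨C, v, c, f', hf, hvc, hfc⟩ := D.exists_isCone x
  let q : C ⟶ Z := hf.desc z 0 (by rw [hz.zero, comp_zero])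
  have hq1 : v ≫ q = z := hf.inl_desc _ _ _
  have hq2 : f' ≫ q = 0 := hf.inr_desc _ _ _
  obtain ⟨s, hs⟩ := hz.desc (v - a ≫ f') (by
    rw [Preadditive.comp_sub, reassoc_of% ha, hf.w, sub_self])
  let ρ : C ⟶ D.I.obj X := hf.desc a (𝟙 _) (by rw [ha, Category.comp_id])
  have hρ1 : v ≫ ρ = a := hf.inl_desc _ _ _
  have hρ2 : f' ≫ ρ = 𝟙 _ := hf.inr_desc _ _ _
  have hsq : s ≫ q = 𝟙 Z := by
    rw [← cancel_epi z, reassoc_of% hs]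
    simp [hq1, hq2]
  have hqs : q ≫ s - 𝟙 C = ρ ≫ (-f') := by
    apply hf.hom_ext
    · simp [reassoc_of% hq1, hs, reassoc_of% hρ1]
    · simp [reassoc_of% hq2, reassoc_of% hρ2]
  have hsw : s ≫ c = -w := by
    rw [← cancel_epi z, reassoc_of% hs]
    simp [hvc, hfc, hw]
  refine ⟨X, Y, C, x, v, c, ⟨f', hf, hvc, hfc⟩, ⟨triangleIso (Iso.refl _) (Iso.refl _)
    (stableIso hr s q (by rw [hsq, sub_self]; exact D.null_zero _ _) ⟨_, _, _, hqs⟩) ?_ ?_ ?_⟩⟩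
  · simp
  · change (Q).map z ≫ (Q).map s = 𝟙 _ ≫ (Q).map v
    rw [← (Q).map_comp, hs, Category.id_comp, map_eq_iff hr]
    exact ⟨X, a, -f', by simp⟩
  · change _ ≫ (𝟙 ((Q).obj X))⟦(1 : ℤ)⟧' = (Q).map s ≫ (Q).map c ≫ _
    rw [← (Q).map_comp_assoc, hsw, CategoryTheory.Functor.map_id, Category.comp_id, (Q).map_neg,
      Preadditive.neg_comp]

/-- In a cone, `w` is a cokernel of `v`, and `i Y` together with `I f` extends `i Y` over `Z`. The
induced map `T X ⟶ T Y` is `T f`. -/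
theorem rotate_mem_distSet {X Y Z : 𝒜} {f : X ⟶ Y} {v : Y ⟶ Z} {w : Z ⟶ D.T.obj X}
    (h : D.IsCone f v w) :
    Triangle.mk ((Q).map v) ((Q).map w ≫ e.hom.app X) (-((Q).map f)⟦(1 : ℤ)⟧') ∈ distSet e := by
  obtain ⟨f', hf, hvw, hfw⟩ := h
  have hc : IsCoker v w :=
    { zero := hvw
      epi := by have := D.epi_p X; rw [← hfw] at this; exact epi_of_epi f' w
      desc := fun g hg => by
        obtain ⟨h, hh⟩ := D.desc (f' ≫ g) (by rw [← hf.w_assoc, hg, comp_zero])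
        refine ⟨h, hf.hom_ext ?_ ?_⟩
        · rw [reassoc_of% hvw, zero_comp, hg]
        · rw [reassoc_of% hfw, hh] }
  let a : Z ⟶ D.I.obj Y := hf.desc (D.i Y) (D.I.map f) (D.i_naturality f)
  have ha1 : v ≫ a = D.i Y := hf.inl_desc _ _ _
  have ha2 : f' ≫ a = D.I.map f := hf.inr_desc _ _ _
  have hw : w ≫ D.T.map f = a ≫ D.p Y := by
    apply hf.hom_ext
    · rw [reassoc_of% hvw, reassoc_of% ha1, i_p, zero_comp]
    · rw [reassoc_of% hfw, reassoc_of% ha2, p_naturality]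
  refine mem_distSet_of_iso e (mem_distSet_of_isCoker hr e hc ha1 hw)
    (triangleIso (Iso.refl _) (Iso.refl _) (e.app X).symm ?_ ?_ ?_)
  · simp
  · change ((Q).map w ≫ e.hom.app X) ≫ e.inv.app X = 𝟙 _ ≫ (Q).map w
    rw [Category.assoc, Iso.hom_inv_id_app, Category.id_comp]
    exact Category.comp_id _
  · change (-((Q).map f)⟦(1 : ℤ)⟧') ≫ (𝟙 ((Q).obj Y))⟦(1 : ℤ)⟧' =
      e.inv.app X ≫ (-(Q).map (D.T.map f) ≫ e.hom.app Y)
    rw [CategoryTheory.Functor.map_id, Category.comp_id, e_naturality,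
      Preadditive.comp_neg, Iso.inv_hom_id_app_assoc]

/-- The square commutes up to a null map `i X ≫ l`; adding `l ≫ v'` to the map on `I X` absorbs it.
Since `v' ≫ w' = 0`, the last square is not affected. -/
theorem complete_cone {X Y Z X' Y' Z' : 𝒜} {f : X ⟶ Y} {v : Y ⟶ Z} {w : Z ⟶ D.T.obj X}
    {f' : X' ⟶ Y'} {v' : Y' ⟶ Z'} {w' : Z' ⟶ D.T.obj X'} (h : D.IsCone f v w)
    (h' : D.IsCone f' v' w') (a : X ⟶ X') (b : Y ⟶ Y')
    (comm : (Q).map f ≫ (Q).map b = (Q).map a ≫ (Q).map f') :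
    ∃ c : Z ⟶ Z', v ≫ c = b ≫ v' ∧ w ≫ D.T.map a = c ≫ w' := by
  obtain ⟨g, hg, hvw, hgw⟩ := h
  obtain ⟨g', hg', hvw', hgw'⟩ := h'
  rw [← (Q).map_comp, ← (Q).map_comp, map_eq_iff hr, null_iff] at comm
  obtain ⟨l, hl⟩ := comm
  have h1 : f ≫ b ≫ v' = D.i X ≫ (D.I.map a ≫ g' + l ≫ v') := by
    rw [Preadditive.comp_add, reassoc_of% hl, ← i_naturality_assoc, ← hg'.w]
    simp
  refine ⟨hg.desc (b ≫ v') (D.I.map a ≫ g' + l ≫ v') h1, hg.inl_desc _ _ _, hg.hom_ext ?_ ?_⟩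
  · rw [reassoc_of% hvw, hg.inl_desc_assoc, Category.assoc, hvw', zero_comp, comp_zero]
  · rw [reassoc_of% hgw, hg.inr_desc_assoc, Preadditive.add_comp, Category.assoc, Category.assoc,
      hvw', hgw', comp_zero, add_zero, p_naturality]

theorem isZero_obj_I (N : 𝒜) : IsZero ((Q).obj (D.I.obj N)) := by
  rw [IsZero.iff_id_eq_zero, ← CategoryTheory.Functor.map_id, ← (Q).map_zero, map_eq_iff hr]
  exact ⟨N, 𝟙 _, 𝟙 _, by simp⟩

variable [HasZeroObject (CategoryTheory.Quotient r)]
  [∀ n : ℤ, (shiftFunctor (CategoryTheory.Quotient r) n).Additive]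

/-- Images of cones satisfy the axioms of distinguished triangles. -/
def core : PretriangulatedCore (CategoryTheory.Quotient r) where
  dist := distSet e
  iso_mem _ h _ i := mem_distSet_of_iso e h i
  contractible_mem := by
    rintro ⟨X⟩
    -- The cone of an identity is `I X`, which is stably zero.
    have hc : D.IsCone (𝟙 X) (D.i X) (D.p X) :=
      ⟨𝟙 _, IsPushout.of_horiz_isIso ⟨by simp⟩, D.i_p X, by simp⟩
    exact mem_distSet_of_iso e (hc.mem_distSet e) (triangleIso (Iso.refl ((Q).obj X))
      (Iso.refl ((Q).obj X)) ((isZero_zero _).iso (isZero_obj_I hr X))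
      (by simp) ((isZero_obj_I hr X).eq_of_tgt _ _) ((isZero_zero _).eq_of_src _ _))
  exists_mem := by
    rintro ⟨X⟩ ⟨Y⟩ f
    obtain ⟨f, rfl⟩ := (Q).map_surjective (X := X) (Y := Y) f
    obtain ⟨Z, v, w, h⟩ := D.exists_isCone f
    exact ⟨(Q).obj Z, (Q).map v, (Q).map w ≫ e.hom.app X, h.mem_distSet e⟩
  rotate_mem := by
    rintro X Y Z f g h ⟨X', Y', Z', f', v', w', hc, ⟨j⟩⟩
    exact mem_distSet_of_iso e (rotate_mem_distSet hr e hc)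
      ((rotate (CategoryTheory.Quotient r)).mapIso j)
  complete := by
    rintro X₁ Y₁ Z₁ X₂ Y₂ Z₂ f₁ g₁ h₁ f₂ g₂ h₂ ⟨X, Y, Z, f, v, w, hc, ⟨j⟩⟩
      ⟨X', Y', Z', f', v', w', hc', ⟨j'⟩⟩ a b hab
    obtain ⟨e₁, e₂, e₃, k₁, k₂, k₃⟩ := exists_isos_of_triangleIso j
    obtain ⟨e₁', e₂', e₃', l₁, l₂, l₃⟩ := exists_isos_of_triangleIso j'
    obtain ⟨a', ha'⟩ := (Q).map_surjective (e₁.inv ≫ a ≫ e₁'.hom)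
    obtain ⟨b', hb'⟩ := (Q).map_surjective (e₂.inv ≫ b ≫ e₂'.hom)
    obtain ⟨c, hc1, hc2⟩ := complete_cone hr hc hc' a' b' (by
      rw [ha', hb', ← cancel_epi e₁.hom, ← reassoc_of% k₁]
      simp [l₁, reassoc_of% hab])
    refine ⟨e₃.hom ≫ (Q).map c ≫ e₃'.inv, ?_, ?_⟩
    · rw [reassoc_of% k₂, ← (Q).map_comp_assoc, hc1, (Q).map_comp_assoc, hb',
        ← cancel_mono e₃'.hom]
      simp [l₂]
    · rw [← cancel_mono (e₁'.hom⟦(1 : ℤ)⟧')]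
      have h1 : h₁ ≫ (e₁.hom ≫ (Q).map a')⟦(1 : ℤ)⟧' = e₃.hom ≫ (Q).map c ≫ (Q).map w' ≫
          e.hom.app X' := by
        rw [Functor.map_comp, reassoc_of% k₃, ← e_naturality,
          ← (Q).map_comp_assoc, hc2, (Q).map_comp_assoc]
      rw [ha', Iso.hom_inv_id_assoc, Functor.map_comp, ← Category.assoc] at h1
      rw [h1]
      simp [l₃]

/-- The pretriangulated structure of the stable category. -/
@[reducible]
def pretriangulated : Pretriangulated (CategoryTheory.Quotient r) := (core hr e).pretriangulated

/-- Octahedra may be checked up to isomorphism of the two maps. Stably `y` is the map `x` to `W ⊞ I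
Y` with components `y` and `i Y`, along which `i Y` extends. The octahedron becomes a third
isomorphism theorem: the cone of `u` maps to that of `u ≫ x` with the same cokernel as `x`, and
`mem_distSet_of_isCoker` applies to both cokernels. -/
theorem isTriangulated [HasBinaryBiproducts 𝒜] :
    letI := pretriangulated hr e
    IsTriangulated (CategoryTheory.Quotient r) := by
  let := pretriangulated hr e
  refine IsTriangulated.mk' ?_
  rintro ⟨X⟩ ⟨Y⟩ ⟨W⟩ u y
  obtain ⟨u, rfl⟩ := (Q).map_surjective (X := X) (Y := Y) u
  obtain ⟨y, rfl⟩ := (Q).map_surjective (X := Y) (Y := W) y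
  obtain ⟨Z₂, v₂, w₂, f₂, h₂, -, -⟩ := D.exists_isCone y
  let x : Y ⟶ W ⊞ D.I.obj Y := biprod.lift y (D.i Y)
  let z : W ⊞ D.I.obj Y ⟶ Z₂ := biprod.desc v₂ (-f₂)
  have hxs : x ≫ biprod.snd = D.i Y := biprod.lift_snd _ _
  have hz : IsCoker x z :=
    { zero := by simp [x, z, h₂.w]
      epi := ⟨fun g g' hg => h₂.hom_ext
        (by have := congrArg (fun t => biprod.inl ≫ t) hg; simpa [z] using this)
        (by have := congrArg (fun t => biprod.inr ≫ t) hg; simpa [z] using this)⟩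
      desc := fun g hg => by
        have h0 : y ≫ biprod.inl ≫ g + D.i Y ≫ biprod.inr ≫ g = 0 := by
          rw [← hg]; simp [x, biprod.lift_eq]
        refine ⟨h₂.desc (biprod.inl ≫ g) (-(biprod.inr ≫ g)) (by
          rw [Preadditive.comp_neg]; exact eq_neg_of_add_eq_zero_left h0), ?_⟩
        ext <;> simp [z] }
  have := hz.epi
  obtain ⟨w, hw⟩ := hz.desc (biprod.snd ≫ D.p Y) (by rw [reassoc_of% hxs, i_p])
  obtain ⟨Z₁, v₁, w₁, hc₁⟩ := D.exists_isCone u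
  obtain ⟨Z₃, v₃, w₃, hc₃⟩ := D.exists_isCone (u ≫ x)
  have d₁ := hc₁.mem_distSet e
  have d₃ := hc₃.mem_distSet e
  obtain ⟨f₁, h₁, hvw₁, hfw₁⟩ := hc₁
  obtain ⟨f₃, h₃, hvw₃, hfw₃⟩ := hc₃
  let m : Z₁ ⟶ Z₃ := h₁.desc (x ≫ v₃) f₃ (by rw [← h₃.w, Category.assoc])
  have hm1 : v₁ ≫ m = x ≫ v₃ := h₁.inl_desc _ _ _
  have hm2 : f₁ ≫ m = f₃ := h₁.inr_desc _ _ _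
  let n : Z₃ ⟶ Z₂ := h₃.desc z 0 (by rw [Category.assoc, hz.zero, comp_zero, comp_zero])
  have hn1 : v₃ ≫ n = z := h₃.inl_desc _ _ _
  have hn2 : f₃ ≫ n = 0 := h₃.inr_desc _ _ _
  have hmn : IsCoker m n :=
    { zero := h₁.hom_ext (by rw [reassoc_of% hm1, hn1, hz.zero, comp_zero])
        (by rw [reassoc_of% hm2, hn2, comp_zero])
      epi := by rw [← hn1] at this; exact epi_of_epi v₃ n
      desc := fun g hg => by
        obtain ⟨l, hl⟩ := hz.desc (v₃ ≫ g) (by rw [← reassoc_of% hm1, hg, comp_zero])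
        refine ⟨l, h₃.hom_ext ?_ ?_⟩
        · rw [reassoc_of% hn1, hl]
        · rw [reassoc_of% hn2, ← hm2, Category.assoc, hg, comp_zero, zero_comp] }
  -- The extension of `i Z₁` along `m` that puts the third triangle in cokernel form.
  let a : Z₃ ⟶ D.I.obj Z₁ := h₃.desc (biprod.snd ≫ D.I.map v₁) (f₁ ≫ D.i Z₁) (by
    rw [Category.assoc, reassoc_of% hxs, ← i_naturality, ← Category.assoc, h₁.w, Category.assoc])
  have ha1 : v₃ ≫ a = biprod.snd ≫ D.I.map v₁ := h₃.inl_desc _ _ _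
  have ha2 : f₃ ≫ a = f₁ ≫ D.i Z₁ := h₃.inr_desc _ _ _
  have hma : m ≫ a = D.i Z₁ := by
    apply h₁.hom_ext
    · rw [reassoc_of% hm1, ha1, reassoc_of% hxs, i_naturality]
    · rw [reassoc_of% hm2, ha2]
  have hnw : n ≫ w ≫ D.T.map v₁ = a ≫ D.p Z₁ := by
    apply h₃.hom_ext
    · rw [reassoc_of% hn1, reassoc_of% hw, reassoc_of% ha1, p_naturality]
    · rw [reassoc_of% hn2, reassoc_of% ha2, i_p, zero_comp, comp_zero]
  -- The connecting maps agree only up to a map through `I Y`; `ρ` is its first factor.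
  let ρ : Z₃ ⟶ D.I.obj Y := h₃.desc biprod.snd (D.I.map u) (by
    rw [Category.assoc, hxs, i_naturality])
  have hρ : w₃ ≫ D.T.map u - -(n ≫ w) = ρ ≫ D.p Y := by
    rw [sub_neg_eq_add]
    apply h₃.hom_ext
    · rw [Preadditive.comp_add, reassoc_of% hvw₃, reassoc_of% hn1, h₃.inl_desc_assoc, zero_comp,
        zero_add, hw]
    · rw [Preadditive.comp_add, reassoc_of% hfw₃, reassoc_of% hn2, h₃.inr_desc_assoc, zero_comp,
        add_zero, p_naturality]
  have dx := mem_distSet_of_isCoker hr e hz hxs hw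
  have dm := mem_distSet_of_isCoker hr e hmn hma hnw
  refine ⟨(Q).obj X, (Q).obj Y, (Q).obj (W ⊞ D.I.obj Y), (Q).obj Z₁, (Q).obj Z₂, (Q).obj Z₃,
    (Q).map u, (Q).map x, Iso.refl _, Iso.refl _,
    stableIso hr biprod.inl biprod.fst (by simpa using D.null_zero _ _)
      ⟨Y, biprod.snd, -biprod.inr, ?_⟩, ?_, ?_, (Q).map v₁, (Q).map w₁ ≫ e.hom.app X, d₁,
    (Q).map z, -(Q).map w ≫ e.hom.app Y, dx, (Q).map v₃, (Q).map w₃ ≫ e.hom.app X, ?_,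
    ⟨{ m₁ := (Q).map m, m₃ := (Q).map n, comm₁ := ?_, comm₂ := ?_, comm₃ := ?_, comm₄ := ?_,
       mem := ?_ }⟩⟩
  · rw [← biprod.total, sub_add_cancel_left, Preadditive.comp_neg]
  · simp
  · change (Q).map y ≫ (Q).map biprod.inl = 𝟙 _ ≫ (Q).map x
    rw [Category.id_comp, ← (Q).map_comp, map_eq_iff hr]
    exact ⟨Y, D.i Y, -biprod.inr, by simp [x, biprod.lift_eq]⟩
  · rw [← (Q).map_comp]; exact d₃
  · rw [← (Q).map_comp, ← (Q).map_comp, hm1]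
  · rw [← (Q).map_comp_assoc]
    congr 2
    apply h₁.hom_ext
    · rw [reassoc_of% hm1, hvw₃, hvw₁, comp_zero]
    · rw [reassoc_of% hm2, hfw₃, hfw₁]
  · rw [← (Q).map_comp, hn1]
  · rw [Category.assoc, ← e_naturality, ← (Q).map_comp_assoc, Preadditive.comp_neg,
      ← (Q).map_comp_assoc, ← Preadditive.neg_comp, ← (Q).map_neg]
    congr 1
    rw [map_eq_iff hr]
    exact ⟨Y, ρ, D.p Y, hρ⟩
  · rw [Preadditive.neg_comp, Category.assoc, ← e_naturality, ← (Q).map_comp_assoc]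
    exact dm

end Triangulated

section Exists

variable {r : HomRel 𝒜} (hr : ∀ {X Y : 𝒜} (f g : X ⟶ Y), r f g ↔ D.Null (f - g))
include hr

theorem hasBinaryBiproducts [HasBinaryBiproducts 𝒜] [Preadditive (CategoryTheory.Quotient r)]
    [(Quotient.functor r).Additive] : HasBinaryBiproducts (CategoryTheory.Quotient r) where
  has_binary_biproduct := by
    rintro ⟨X⟩ ⟨Y⟩
    have := (Quotient.functor r).preservesFiniteBiproductsOfAdditive
    have := preservesBinaryBiproducts_of_preservesBiproducts (Quotient.functor r)
    exact HasBinaryBiproduct.mk ⟨_, isBinaryBilimitOfPreserves (Quotient.functor r)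
      (BinaryBiproduct.isBilimit X Y)⟩

/-- The stable category is triangulated, with shift induced by `T` and with the triangles
isomorphic to images of cones as distinguished triangles. -/
theorem exists_triangulation [HasBinaryBiproducts 𝒜] [HasZeroObject 𝒜] :
    ∃ (_ : Preadditive (CategoryTheory.Quotient r)) (_ : HasZeroObject (CategoryTheory.Quotient r))
      (_ : HasShift (CategoryTheory.Quotient r) ℤ)
      (_ : ∀ n : ℤ, (shiftFunctor (CategoryTheory.Quotient r) n).Additive)
      (_ : Pretriangulated (CategoryTheory.Quotient r)),
      IsTriangulated (CategoryTheory.Quotient r) ∧ (Quotient.functor r).Additive ∧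
        ∃ e : D.T ⋙ Quotient.functor r ≅
            Quotient.functor r ⋙ shiftFunctor (CategoryTheory.Quotient r) (1 : ℤ),
          distTriang (CategoryTheory.Quotient r) = distSet e := by
  let h1 := preadditive hr
  have h2 := functor_additive hr
  have := stableT_isEquivalence hr
  obtain ⟨h3, ⟨j⟩⟩ := exists_hasShift_int (stableT hr)
  have := hasBinaryBiproducts hr
  -- Shifts are equivalences, so they preserve products and are additive.
  have h4 : ∀ n : ℤ, (shiftFunctor (CategoryTheory.Quotient r) n).Additive := fun n =>
    (shiftFunctor (CategoryTheory.Quotient r) n).additive_of_preserves_binary_products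
  have h5 : HasZeroObject (CategoryTheory.Quotient r) :=
    ⟨_, isZero_obj_I hr (Classical.choose (HasZeroObject.zero (C := 𝒜)))⟩
  let e : D.T ⋙ Quotient.functor r ≅
      Quotient.functor r ⋙ shiftFunctor (CategoryTheory.Quotient r) (1 : ℤ) :=
    Functor.isoWhiskerLeft (Quotient.functor r) j
  exact ⟨h1, h5, h3, h4, pretriangulated hr e, isTriangulated hr e, h2, e, rfl⟩

end Exists

end StableData

/-! ### Exact functors between stable categories -/

namespace StableData

variable {𝒜 : Type u₁} [Category.{v₁} 𝒜] [Preadditive 𝒜] {ℬ : Type u₂} [Category.{v₂} ℬ]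
  [Preadditive ℬ]

/-- A functor compatible with the embeddings `X ⟶ I X` up to null morphisms. -/
structure IsCompatible (D : StableData 𝒜) (D' : StableData ℬ) (F : 𝒜 ⥤ ℬ) : Prop where
  additive : F.Additive
  -- `F` need not commute with `I`: it is enough that `F (I N)` is stably zero and that the
  -- embedding of `F X` extends along `F (i X)`.
  null_I : ∀ N, D'.Null (𝟙 (F.obj (D.I.obj N)))
  exists_extension : ∀ X, ∃ e : F.obj (D.I.obj X) ⟶ D'.I.obj (F.obj X),
    F.map (D.i X) ≫ e = D'.i (F.obj X)
  map_coker : ∀ X, IsCoker (F.map (D.i X)) (F.map (D.p X))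
  map_pushout : ∀ {X Y Z : 𝒜} {f : X ⟶ Y} {v : Y ⟶ Z} {f' : D.I.obj X ⟶ Z},
    IsPushout f (D.i X) v f' → IsPushout (F.map f) (F.map (D.i X)) (F.map v) (F.map f')

namespace IsCompatible

variable {D : StableData 𝒜} {D' : StableData ℬ} {F : 𝒜 ⥤ ℬ} (hF : D.IsCompatible D' F)
include hF

theorem null_through {X Y : ℬ} {N : 𝒜} (a : X ⟶ F.obj (D.I.obj N)) (b : F.obj (D.I.obj N) ⟶ Y) :
    D'.Null (a ≫ b) := by
  have := ((hF.null_I N).comp_left a).comp_right b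
  simpa using this

theorem null_map {X Y : 𝒜} {f : X ⟶ Y} (hf : D.Null f) : D'.Null (F.map f) := by
  obtain ⟨N, a, b, rfl⟩ := hf
  rw [F.map_comp]
  exact hF.null_through _ _

theorem exists_coextension (X : 𝒜) : ∃ e : D'.I.obj (F.obj X) ⟶ F.obj (D.I.obj X),
    D'.i (F.obj X) ≫ e = F.map (D.i X) := by
  rw [← null_iff]
  have := (hF.null_I X).comp_left (F.map (D.i X))
  simpa using this

theorem exists_comparison (X : 𝒜) :
    ∃ (θ : F.obj (D.T.obj X) ⟶ D'.T.obj (F.obj X)) (e : F.obj (D.I.obj X) ⟶ D'.I.obj (F.obj X)),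
      F.map (D.i X) ≫ e = D'.i (F.obj X) ∧ F.map (D.p X) ≫ θ = e ≫ D'.p (F.obj X) := by
  obtain ⟨e, he⟩ := hF.exists_extension X
  obtain ⟨θ, hθ⟩ := (hF.map_coker X).desc (e ≫ D'.p _) (by rw [reassoc_of% he, i_p])
  exact ⟨θ, e, he, hθ⟩

/-- The comparison map `F (T X) ⟶ T' (F X)`. -/
def θ (X : 𝒜) : F.obj (D.T.obj X) ⟶ D'.T.obj (F.obj X) := (hF.exists_comparison X).choose

theorem θ_spec (X : 𝒜) : ∃ e : F.obj (D.I.obj X) ⟶ D'.I.obj (F.obj X),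
      F.map (D.i X) ≫ e = D'.i (F.obj X) ∧ F.map (D.p X) ≫ hF.θ X = e ≫ D'.p (F.obj X) :=
  (hF.exists_comparison X).choose_spec

/-- `θ` depends on a chosen extension, so it is natural only up to null maps: the two maps `F (I X)
⟶ I' (F Y)` agree on `F X`, and their difference descends to `F (T X)`. -/
theorem θ_naturality {X Y : 𝒜} (f : X ⟶ Y) :
    D'.Null (F.map (D.T.map f) ≫ hF.θ Y - hF.θ X ≫ D'.T.map (F.map f)) := by
  obtain ⟨e, he, hθ⟩ := hF.θ_spec X
  obtain ⟨e₁, he₁, hθ₁⟩ := hF.θ_spec Y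
  have := (hF.map_coker X).epi
  obtain ⟨h, hh⟩ := (hF.map_coker X).desc (F.map (D.I.map f) ≫ e₁ - e ≫ D'.I.map (F.map f)) (by
    rw [Preadditive.comp_sub, reassoc_of% he, ← D'.i_naturality, ← F.map_comp_assoc,
      ← D.i_naturality, F.map_comp_assoc, he₁, sub_self])
  refine ⟨F.obj Y, h, D'.p _, ?_⟩
  rw [← cancel_epi (F.map (D.p X)), reassoc_of% hh, Preadditive.comp_sub, ← F.map_comp_assoc,
    ← D.p_naturality, F.map_comp_assoc, hθ₁, reassoc_of% hθ, ← D'.p_naturality]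
  simp

/-- Two embeddings of `F X` with stably zero targets, each extending along the other, have stably
isomorphic cokernels: the composites of the extensions differ from identities by maps that vanish on
`F X`. -/
theorem exists_inverse (X : 𝒜) : ∃ θ' : D'.T.obj (F.obj X) ⟶ F.obj (D.T.obj X),
    D'.Null (hF.θ X ≫ θ' - 𝟙 _) ∧ D'.Null (θ' ≫ hF.θ X - 𝟙 _) := by
  obtain ⟨e, he, hθ⟩ := hF.θ_spec X
  obtain ⟨e', he'⟩ := hF.exists_coextension X
  have := (hF.map_coker X).epi
  obtain ⟨θ', hθ'⟩ := D'.desc (e' ≫ F.map (D.p X)) (by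
    rw [reassoc_of% he', (hF.map_coker X).zero])
  refine ⟨θ', ?_, ?_⟩
  · obtain ⟨h, hh⟩ := (hF.map_coker X).desc (e ≫ e' - 𝟙 _) (by simp [reassoc_of% he, he'])
    have : hF.θ X ≫ θ' - 𝟙 _ = h ≫ F.map (D.p X) := by
      rw [← cancel_epi (F.map (D.p X)), reassoc_of% hh]
      simp [reassoc_of% hθ, hθ']
    rw [this]
    exact hF.null_through _ _
  · obtain ⟨h, hh⟩ := D'.desc (e' ≫ e - 𝟙 _) (by simp [reassoc_of% he', he])
    refine ⟨F.obj X, h, D'.p _, ?_⟩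
    rw [← cancel_epi (D'.p _), reassoc_of% hh]
    simp [reassoc_of% hθ', hθ]

section Quotient

variable {r' : HomRel ℬ} (hr' : ∀ {X Y : ℬ} (f g : X ⟶ Y), r' f g ↔ D'.Null (f - g))
include hr'

/-- The comparison map as an isomorphism in the stable category. -/
def θIso : D.T ⋙ F ⋙ Quotient.functor r' ≅ F ⋙ D'.T ⋙ Quotient.functor r' :=
  NatIso.ofComponents (fun X => stableIso hr' (hF.θ X) (hF.exists_inverse X).choose
    (hF.exists_inverse X).choose_spec.1 (hF.exists_inverse X).choose_spec.2) (fun {X Y} f => by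
      change (Quotient.functor r').map (F.map (D.T.map f)) ≫ (Quotient.functor r').map (hF.θ Y) =
        (Quotient.functor r').map (hF.θ X) ≫ (Quotient.functor r').map (D'.T.map (F.map f))
      rw [← Functor.map_comp, ← Functor.map_comp, map_eq_iff hr']
      exact hF.θ_naturality f)

theorem map_cone_mem_distSet [Preadditive (CategoryTheory.Quotient r')]
    [(Quotient.functor r').Additive] [HasShift (CategoryTheory.Quotient r') ℤ]
    (e' : D'.T ⋙ Quotient.functor r' ≅
      Quotient.functor r' ⋙ shiftFunctor (CategoryTheory.Quotient r') (1 : ℤ))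
    {X Y Z : 𝒜} {f : X ⟶ Y} {v : Y ⟶ Z} {w : Z ⟶ D.T.obj X}
    (h : D.IsCone f v w) :
    Triangle.mk ((Quotient.functor r').map (F.map f)) ((Quotient.functor r').map (F.map v))
      ((Quotient.functor r').map (F.map w) ≫ (Quotient.functor r').map (hF.θ X) ≫
        e'.hom.app (F.obj X)) ∈ distSet e' := by
  have := hF.additive
  obtain ⟨f', hf, hvw, hfw⟩ := h
  have hFf := hF.map_pushout hf
  obtain ⟨C, vC, wC, hC⟩ := D'.exists_isCone (F.map f)
  have hmem := hC.mem_distSet e'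
  obtain ⟨fC, hfC, hvwC, hfwC⟩ := hC
  -- `F Z` and the cone of `F f` are pushouts of `F f` along two embeddings of `F X`; the comparison
  -- maps `e` and `e'` of their targets induce `c` and `c'`.
  have hex : ∃ (c : F.obj Z ⟶ C) (c' : C ⟶ F.obj Z), F.map v ≫ c = vC ∧
      c ≫ wC = F.map w ≫ hF.θ X ∧ D'.Null (c ≫ c' - 𝟙 _) ∧ D'.Null (c' ≫ c - 𝟙 _) := by
    obtain ⟨e, he, hθ⟩ := hF.θ_spec X
    obtain ⟨e', he'⟩ := hF.exists_coextension X
    let c : F.obj Z ⟶ C := hFf.desc vC (e ≫ fC) (by rw [reassoc_of% he, hfC.w])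
    let c' : C ⟶ F.obj Z := hfC.desc (F.map v) (e' ≫ F.map f') (by rw [reassoc_of% he', hFf.w])
    have hc1 : F.map v ≫ c = vC := hFf.inl_desc _ _ _
    have hc2 : F.map f' ≫ c = e ≫ fC := hFf.inr_desc _ _ _
    have hc1' : vC ≫ c' = F.map v := hfC.inl_desc _ _ _
    have hc2' : fC ≫ c' = e' ≫ F.map f' := hfC.inr_desc _ _ _
    refine ⟨c, c', hc1, ?_, ?_, ?_⟩
    · apply hFf.hom_ext
      · rw [reassoc_of% hc1, hvwC, ← F.map_comp_assoc, hvw, F.map_zero, zero_comp]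
      · rw [reassoc_of% hc2, hfwC, ← F.map_comp_assoc, hfw, hθ]
    · obtain ⟨h, hh⟩ := (hF.map_coker X).desc (e ≫ e' - 𝟙 _) (by simp [reassoc_of% he, he'])
      have : c ≫ c' - 𝟙 _ = (F.map w ≫ h) ≫ F.map f' := by
        apply hFf.hom_ext
        · rw [Category.assoc, ← F.map_comp_assoc, hvw, F.map_zero, zero_comp, Preadditive.comp_sub,
            reassoc_of% hc1, hc1', Category.comp_id, sub_self]
        · rw [Category.assoc, ← F.map_comp_assoc, hfw, reassoc_of% hh, Preadditive.comp_sub,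
            reassoc_of% hc2, hc2']
          simp
      rw [this]
      exact hF.null_through _ _
    · obtain ⟨h, hh⟩ := D'.desc (e' ≫ e - 𝟙 _) (by simp [reassoc_of% he', he])
      refine ⟨F.obj X, wC ≫ h, fC, ?_⟩
      apply hfC.hom_ext
      · rw [Category.assoc, reassoc_of% hvwC, zero_comp, Preadditive.comp_sub,
          reassoc_of% hc1', hc1, Category.comp_id, sub_self]
      · rw [Category.assoc, reassoc_of% hfwC, reassoc_of% hh, Preadditive.comp_sub,
          reassoc_of% hc2', hc2]
        simp
  obtain ⟨c, c', hc1, hc2, hn, hn'⟩ := hex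
  refine mem_distSet_of_iso e' hmem
    (triangleIso (Iso.refl _) (Iso.refl _) (stableIso hr' c c' hn hn') ?_ ?_ ?_)
  · simp
  · change (Quotient.functor r').map _ ≫ (Quotient.functor r').map c = 𝟙 _ ≫ _
    rw [← Functor.map_comp, hc1, Category.id_comp]
  · change _ ≫ (𝟙 _)⟦(1 : ℤ)⟧' = (Quotient.functor r').map c ≫ _ ≫ _
    rw [CategoryTheory.Functor.map_id, Category.comp_id, ← Functor.map_comp_assoc, ← hc2,
      Functor.map_comp_assoc]

variable {r : HomRel 𝒜} (hr : ∀ {X Y : 𝒜} (f g : X ⟶ Y), r f g ↔ D.Null (f - g))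
include hr

/-- The functor induced on the stable categories. -/
def stableFunctor : CategoryTheory.Quotient r ⥤ CategoryTheory.Quotient r' :=
  CategoryTheory.Quotient.lift r (F ⋙ Quotient.functor r') (fun X Y f g h => by
    have := hF.additive
    rw [Functor.comp_map, Functor.comp_map, map_eq_iff hr', ← F.map_sub]
    exact hF.null_map ((hr f g).1 h))

variable [HasShift (CategoryTheory.Quotient r) ℤ] [HasShift (CategoryTheory.Quotient r') ℤ]
  (e : D.T ⋙ Quotient.functor r ≅
    Quotient.functor r ⋙ shiftFunctor (CategoryTheory.Quotient r) (1 : ℤ))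
  (e' : D'.T ⋙ Quotient.functor r' ≅
    Quotient.functor r' ⋙ shiftFunctor (CategoryTheory.Quotient r') (1 : ℤ))

/-- The induced functor commutes with the shift. -/
def shiftIso : shiftFunctor _ (1 : ℤ) ⋙ hF.stableFunctor hr' hr ≅
    hF.stableFunctor hr' hr ⋙ shiftFunctor _ (1 : ℤ) :=
  Quotient.natIsoLift r (Functor.isoWhiskerRight e.symm (hF.stableFunctor hr' hr) ≪≫
    hF.θIso hr' ≪≫ Functor.isoWhiskerLeft F e')

theorem map_e_comp_shiftIso (X : 𝒜) :
    (hF.stableFunctor hr' hr).map (e.hom.app X) ≫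
      (hF.shiftIso hr' hr e e').hom.app ((Quotient.functor r).obj X) =
    (Quotient.functor r').map (hF.θ X) ≫ e'.hom.app (F.obj X) := by
  change _ ≫ (hF.stableFunctor hr' hr).map (e.inv.app X) ≫ (Quotient.functor r').map (hF.θ X) ≫
    e'.hom.app (F.obj X) = _
  rw [← Functor.map_comp_assoc, Iso.hom_inv_id_app, CategoryTheory.Functor.map_id]
  exact Category.id_comp _

end Quotient

/-- A compatible functor induces an exact functor on stable categories. -/
theorem exists_isTriangulated {r : HomRel 𝒜}
    (hr : ∀ {X Y : 𝒜} (f g : X ⟶ Y), r f g ↔ D.Null (f - g)) {r' : HomRel ℬ}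
    (hr' : ∀ {X Y : ℬ} (f g : X ⟶ Y), r' f g ↔ D'.Null (f - g))
    [Preadditive (CategoryTheory.Quotient r)] [HasZeroObject (CategoryTheory.Quotient r)]
    [HasShift (CategoryTheory.Quotient r) ℤ]
    [∀ n : ℤ, (shiftFunctor (CategoryTheory.Quotient r) n).Additive]
    [Pretriangulated (CategoryTheory.Quotient r)]
    [Preadditive (CategoryTheory.Quotient r')] [HasZeroObject (CategoryTheory.Quotient r')]
    [HasShift (CategoryTheory.Quotient r') ℤ]
    [∀ n : ℤ, (shiftFunctor (CategoryTheory.Quotient r') n).Additive]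
    [Pretriangulated (CategoryTheory.Quotient r')]
    [(Quotient.functor r').Additive]
    (e : D.T ⋙ Quotient.functor r ≅
      Quotient.functor r ⋙ shiftFunctor (CategoryTheory.Quotient r) (1 : ℤ))
    (e' : D'.T ⋙ Quotient.functor r' ≅
      Quotient.functor r' ⋙ shiftFunctor (CategoryTheory.Quotient r') (1 : ℤ))
    (hd : distTriang (CategoryTheory.Quotient r) = distSet e)
    (hd' : distTriang (CategoryTheory.Quotient r') = distSet e') :
    ∃ _ : (hF.stableFunctor hr' hr).CommShift ℤ, (hF.stableFunctor hr' hr).IsTriangulated := by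
  obtain ⟨h, hh⟩ := exists_commShift_int (hF.stableFunctor hr' hr) (hF.shiftIso hr' hr e e')
  refine ⟨h, ⟨fun t ht => ?_⟩⟩
  rw [hd] at ht
  obtain ⟨X, Y, Z, f, v, w, hc, ⟨j⟩⟩ := ht
  refine isomorphic_distinguished _ ?_ _ ((hF.stableFunctor hr' hr).mapTriangle.mapIso j)
  rw [hd']
  -- The third map of the image triangle contains the shift isomorphism of the functor; isolating it
  -- as `x` lets it be rewritten.
  have hm : ∀ x, x = (Quotient.functor r').map (F.map w) ≫ (Quotient.functor r').map (hF.θ X) ≫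
      e'.hom.app (F.obj X) → Triangle.mk ((Quotient.functor r').map (F.map f))
        ((Quotient.functor r').map (F.map v)) x ∈ distSet e' := by
    rintro _ rfl
    exact hF.map_cone_mem_distSet hr' e' hc
  refine hm ((hF.stableFunctor hr' hr).map ((Quotient.functor r).map w ≫ e.hom.app X) ≫
      ((hF.stableFunctor hr' hr).commShiftIso (1 : ℤ)).hom.app ((Quotient.functor r).obj X)) ?_
  refine (congrArg (· ≫ _) (Functor.map_comp _ _ _)).trans ((Category.assoc _ _ _).trans ?_)
  rw [hh]
  exact congrArg _ (map_e_comp_shiftIso hF hr' hr e e' X)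

end IsCompatible

end StableData

/-! ### Tensor products of modules -/

section TensorAPI

variable (k : Type u) {H A : Type u} [Field k] [Ring H] [HopfAlgebra k H] [Ring A] [Algebra k A]
  [LeftComoduleAlgebra k H A]

/-- The orbit map `a ↦ a • m`. -/
def orb {R : Type u} [Ring R] [Algebra k R] (M : ModuleCat.{u} R) (m : M) : R →ₗ[k] M :=
  (LinearMap.toSpanSingleton R M m).restrictScalars k

@[simp]
theorem orb_apply {R : Type u} [Ring R] [Algebra k R] (M : ModuleCat.{u} R) (m : M) (a : R) :
    orb k M m a = a • m := rfl

/-- `toTensorObj` as an equivalence. -/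
def tensorEquiv (V : ModuleCat.{u} H) (M : ModuleCat.{u} A) :
    V ⊗[k] M ≃ₗ[k] (tensorObj k V M : ModuleCat.{u} A) :=
  { toTensorObj k V M with
    invFun := fun x => x
    left_inv := fun _ => rfl
    right_inv := fun _ => rfl }

/-- The element `v ⊗ m` of the module `V ⊗ M`. -/
def tm (V : ModuleCat.{u} H) (M : ModuleCat.{u} A) (v : V) (m : M) : tensorObj k V M :=
  tensorEquiv k V M (v ⊗ₜ m)

variable {V W U : ModuleCat.{u} H} {M N P : ModuleCat.{u} A}

theorem tensor_induction {p : tensorObj k V M → Prop} (x : tensorObj k V M) (h0 : p 0)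
    (ht : ∀ v m, p (tm k V M v m)) (ha : ∀ x y, p x → p y → p (x + y)) : p x :=
  TensorProduct.induction_on (motive := p) x h0 ht ha

theorem smul_tensorEquiv (a : A) (x : V ⊗[k] M) :
    a • tensorEquiv k V M x = tensorEquiv k V M (HTensor.rep k V M a x) := rfl

/-- Orbit maps make the action on a pure tensor linear in `coact a`, so equivariance can be checked
by induction on that tensor. -/
theorem smul_tm (a : A) (v : V) (m : M) : a • tm k V M v m =
    tensorEquiv k V M (TensorProduct.map (orb k V v) (orb k M m)
      (LeftComoduleAlgebra.coact (k := k) (H := H) a)) := by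
  rw [tm, smul_tensorEquiv]
  congr 1
  simp only [HTensor.rep, AlgHom.comp_apply]
  generalize LeftComoduleAlgebra.coact (k := k) (H := H) a = t
  induction t with
  | zero => simp
  | add s t hs ht => simp only [map_add, LinearMap.add_apply, hs, ht]
  | tmul h b =>
    simp only [Algebra.TensorProduct.map_tmul, Module.endTensorEndAlgHom_apply]
    simp

/-- An equivariant linear map out of a tensor product, as a linear map over `A`. -/
def tensorDescLinear (f : V ⊗[k] M →ₗ[k] N)
    (hf : ∀ a v m, f (TensorProduct.map (orb k V v) (orb k M m)
      (LeftComoduleAlgebra.coact (k := k) (H := H) a)) = a • f (v ⊗ₜ m)) :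
    tensorObj k V M →ₗ[A] N where
  toFun x := f ((tensorEquiv k V M).symm x)
  map_add' x y := by simp
  map_smul' a x := by
    induction x using tensor_induction k with
    | h0 => simp
    | ha x y hx hy => simp only [smul_add, map_add, hx, hy]
    | ht v m =>
      rw [smul_tm, LinearEquiv.symm_apply_apply, hf, tm, LinearEquiv.symm_apply_apply]
      rfl

/-- A morphism out of a tensor product, from an equivariant linear map. -/
def tensorDesc (f : V ⊗[k] M →ₗ[k] N)
    (hf : ∀ a v m, f (TensorProduct.map (orb k V v) (orb k M m)
      (LeftComoduleAlgebra.coact (k := k) (H := H) a)) = a • f (v ⊗ₜ m)) :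
    tensorObj k V M ⟶ N :=
  ModuleCat.ofHom (X := tensorObj k V M) (tensorDescLinear k f hf)

theorem tensor_hom_ext {f g : tensorObj k V M ⟶ N}
    (h : ∀ v m, f (tm k V M v m) = g (tm k V M v m)) : f = g := by
  ext x
  induction x using tensor_induction k with
  | h0 => simp
  | ha x y hx hy => simp only [map_add, hx, hy]
  | ht v m => exact h v m

@[simp]
theorem tensorMap_tm (f : V ⟶ W) (g : M ⟶ N) (v : V) (m : M) :
    tensorMap k f g (tm k V M v m) = tm k W N (f v) (g m) := rfl

theorem tm_add (v : V) (m m' : M) : tm k V M v (m + m') = tm k V M v m + tm k V M v m' := by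
  simp [tm, TensorProduct.tmul_add]

theorem add_tm (v v' : V) (m : M) : tm k V M (v + v') m = tm k V M v m + tm k V M v' m := by
  simp [tm, TensorProduct.add_tmul]

theorem zero_tm (m : M) : tm k V M 0 m = 0 := by simp [tm]

theorem tensorMap_comp_id (f : V ⟶ W) (f' : W ⟶ U) (M : ModuleCat.{u} A) :
    tensorMap k (f ≫ f') (𝟙 M) = tensorMap k f (𝟙 M) ≫ tensorMap k f' (𝟙 M) :=
  tensor_hom_ext k fun _ _ => by simp

theorem tensorMap_id_comp (V : ModuleCat.{u} H) (g : M ⟶ N) (g' : N ⟶ P) :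
    tensorMap k (𝟙 V) (g ≫ g') = tensorMap k (𝟙 V) g ≫ tensorMap k (𝟙 V) g' :=
  tensor_hom_ext k fun _ _ => by simp

theorem tensorMap_id_id (V : ModuleCat.{u} H) (M : ModuleCat.{u} A) :
    tensorMap k (𝟙 V) (𝟙 M) = 𝟙 (tensorObj k V M) :=
  tensor_hom_ext k fun _ _ => by simp

theorem tensorMap_exchange (f : V ⟶ W) (g : M ⟶ N) :
    tensorMap k f (𝟙 M) ≫ tensorMap k (𝟙 W) g = tensorMap k (𝟙 V) g ≫ tensorMap k f (𝟙 N) :=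
  tensor_hom_ext k fun _ _ => by simp

theorem tensorMap_add_left (f f' : V ⟶ W) (g : M ⟶ N) :
    tensorMap k (f + f') g = tensorMap k f g + tensorMap k f' g :=
  tensor_hom_ext k fun _ _ => by simp [add_tm]

theorem tensorMap_add_right (f : V ⟶ W) (g g' : M ⟶ N) :
    tensorMap k f (g + g') = tensorMap k f g + tensorMap k f g' :=
  tensor_hom_ext k fun _ _ => by simp [tm_add]

/-- A bijective morphism of modules is an isomorphism. -/
def isoOfBijective {R : Type u} [Ring R] {M N : ModuleCat.{u} R} (f : M ⟶ N)
    (hf : Function.Bijective f) : M ≅ N :=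
  have : IsIso f := (ConcreteCategory.isIso_iff_bijective f).2 hf
  asIso f

/-- An isomorphism of modules from an equivariant linear equivalence. -/
def tensorIso (f : V ⊗[k] M ≃ₗ[k] N)
    (hf : ∀ a v m, f (TensorProduct.map (orb k V v) (orb k M m)
      (LeftComoduleAlgebra.coact (k := k) (H := H) a)) = a • f (v ⊗ₜ m)) :
    tensorObj k V M ≅ N :=
  isoOfBijective (tensorDesc k f.toLinearMap hf) f.bijective

/-- The linear equivalence underlying the associativity isomorphism. -/
def assocEquiv (V W : ModuleCat.{u} H) (M : ModuleCat.{u} A) :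
    (tensorObj k V W : ModuleCat.{u} H) ⊗[k] M ≃ₗ[k]
      (tensorObj k V (tensorObj k W M) : ModuleCat.{u} A) :=
  ((TensorProduct.congr (tensorEquiv k V W).symm (LinearEquiv.refl k M)).trans
      (TensorProduct.assoc k V W M)).trans
      ((TensorProduct.congr (LinearEquiv.refl k V) (tensorEquiv k W M)).trans
        (tensorEquiv k V (tensorObj k W M)))

theorem assocEquiv_tmul (v : V) (w : W) (m : M) :
    assocEquiv k V W M (tm k V W v w ⊗ₜ m) = tm k V (tensorObj k W M) v (tm k W M w m) := rfl

/-- Stated for arbitrary `t` to allow induction; at `t = coact a`, coassociativity turns the right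
side into the iterated action. -/
theorem assocEquiv_smul (v : V) (w : W) (m : M) (t : H ⊗[k] A) :
    assocEquiv k V W M (TensorProduct.map (orb k (tensorObj k V W) (tm k V W v w)) (orb k M m) t) =
    tensorEquiv k V (tensorObj k W M) (TensorProduct.map (orb k V v)
      ((tensorEquiv k W M).toLinearMap ∘ₗ TensorProduct.map (orb k W w) (orb k M m))
        (TensorProduct.assoc k H H A ((Coalgebra.comul (R := k) (A := H)).rTensor A t))) := by
  induction t with
  | zero => simp
  | add x y hx hy => simp only [map_add, hx, hy]
  | tmul h b =>
    rw [TensorProduct.map_tmul, orb_apply, smul_tm, LinearMap.rTensor_tmul]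
    change assocEquiv k V W M (tensorEquiv k V W (TensorProduct.map _ _
      (Coalgebra.comul (R := k) h)) ⊗ₜ _) = _
    generalize Coalgebra.comul (R := k) h = s
    induction s with
    | zero => simp
    | add x y hx hy => simp only [map_add, TensorProduct.add_tmul, hx, hy]
    | tmul x y => rfl

/-- The associativity isomorphism. -/
def assocIso (V W : ModuleCat.{u} H) (M : ModuleCat.{u} A) :
    tensorObj k (tensorObj k V W) M ≅ tensorObj k V (tensorObj k W M) :=
  tensorIso k (assocEquiv k V W M) (by
    intro a x m
    induction x using tensor_induction k with
    | h0 => simp [orb]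
    | ha x y hx hy =>
      have h1 : orb k (tensorObj k V W) (x + y) =
          orb k (tensorObj k V W) x + orb k (tensorObj k V W) y := by ext; simp
      rw [h1, TensorProduct.map_add_left, LinearMap.add_apply, map_add, hx, hy,
        TensorProduct.add_tmul, map_add, smul_add]
    | ht v w =>
      rw [assocEquiv_smul, LeftComoduleAlgebra.coassoc_coact, assocEquiv_tmul, smul_tm]
      generalize LeftComoduleAlgebra.coact (k := k) (H := H) a = t
      congr 1
      induction t with
      | zero => simp
      | add x y hx hy => simp only [map_add, hx, hy]
      | tmul h b =>
        rw [LinearMap.lTensor_tmul, TensorProduct.map_tmul, TensorProduct.map_tmul]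
        congr 1
        exact (smul_tm k b w m).symm)

@[simp]
theorem assocIso_hom_tm (v : V) (w : W) (m : M) :
    (assocIso k V W M).hom (tm k (tensorObj k V W) M (tm k V W v w) m) =
      tm k V (tensorObj k W M) v (tm k W M w m) := rfl

@[simp]
theorem assocIso_inv_tm (v : V) (w : W) (m : M) :
    (assocIso k V W M).inv (tm k V (tensorObj k W M) v (tm k W M w m)) =
      tm k (tensorObj k V W) M (tm k V W v w) m :=
  Iso.hom_inv_id_apply (assocIso k V W M) (tm k (tensorObj k V W) M (tm k V W v w) m)

theorem tensor_hom_ext₃ {f g : tensorObj k (tensorObj k V W) M ⟶ N}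
    (h : ∀ v w m, f (tm k (tensorObj k V W) M (tm k V W v w) m) =
      g (tm k (tensorObj k V W) M (tm k V W v w) m)) : f = g :=
  tensor_hom_ext k fun x m => by
    induction x using tensor_induction k with
    | h0 => simp [zero_tm]
    | ha x y hx hy => simp only [add_tm, map_add, hx, hy]
    | ht w v => exact h w v m

/-- The trivial module is `k`. -/
def trivialEquiv : trivialModule k H ≃ₗ[k] k where
  toFun c := c
  map_add' _ _ := rfl
  map_smul' c x := by
    change Coalgebra.counit (R := k) (algebraMap k H c) * _ = c * _
    rw [Bialgebra.counit_algebraMap]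
  invFun c := c
  left_inv _ := rfl
  right_inv _ := rfl

/-- The unit isomorphism. -/
def unitIso (M : ModuleCat.{u} A) : tensorObj k (trivialModule k H) M ≅ M :=
  tensorIso k ((TensorProduct.congr (trivialEquiv k) (LinearEquiv.refl k M)).trans
    (TensorProduct.lid k M)) (by
      intro a c m
      have : ∀ t : H ⊗[k] A, ((TensorProduct.congr (trivialEquiv k) (LinearEquiv.refl k M)).trans
          (TensorProduct.lid k M)) (TensorProduct.map (orb k (trivialModule k H) c) (orb k M m) t) =
          trivialEquiv k c • (TensorProduct.lid k A
            ((Coalgebra.counit (R := k) (A := H)).rTensor A t)) • m := by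
        intro t
        induction t with
        | zero => simp
        | add x y hx hy => simp only [map_add, hx, hy, add_smul, smul_add]
        | tmul h b =>
          change (Coalgebra.counit (R := k) h * trivialEquiv k c) • b • m = _
          simp [smul_smul, mul_comm]
      rw [this, LeftComoduleAlgebra.counit_coact]
      change _ = a • trivialEquiv k c • m
      rw [smul_comm])

end TensorAPI

/-! ### Free and coinduced modules -/

section Free

variable (k : Type u) {H : Type u} [Field k] [Ring H] [HopfAlgebra k H]

theorem coact_self (a : H) : LeftComoduleAlgebra.coact (k := k) (H := H) a =
    Coalgebra.comul (R := k) a := rfl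

/-- The convolution product of linear endomorphisms. -/
def conv (s t : H →ₗ[k] H) : H →ₗ[k] H :=
  LinearMap.mul' k H ∘ₗ TensorProduct.map s t ∘ₗ Coalgebra.comul

variable (H) in
/-- The unit of the convolution product. -/
def convOne : H →ₗ[k] H := Algebra.linearMap k H ∘ₗ Coalgebra.counit

theorem conv_id_antipode : conv k LinearMap.id (HopfAlgebra.antipode k) = convOne k H :=
  HopfAlgebra.mul_antipode_lTensor_comul

theorem conv_antipode_id : conv k (HopfAlgebra.antipode k) LinearMap.id = convOne k H :=
  HopfAlgebra.mul_antipode_rTensor_comul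

variable {V : ModuleCat.{u} H}

/-- The linear map `h ⊗ v ↦ ∑ h₍₁₎ ⊗ s(h₍₂₎) v`. -/
def twistMap (V : ModuleCat.{u} H) (s : H →ₗ[k] H) : H ⊗[k] V →ₗ[k] H ⊗[k] V :=
  (TensorProduct.lift (Algebra.lsmul k k V).toLinearMap).lTensor H ∘ₗ
    (TensorProduct.assoc k H H V).toLinearMap ∘ₗ (s.lTensor H ∘ₗ Coalgebra.comul).rTensor V

theorem twistMap_tmul (s : H →ₗ[k] H) (h : H) (v : V) :
    twistMap k V s (h ⊗ₜ v) = (orb k V v ∘ₗ s).lTensor H (Coalgebra.comul (R := k) h) := by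
  simp only [twistMap, LinearMap.comp_apply, LinearMap.rTensor_tmul]
  generalize Coalgebra.comul (R := k) h = t
  induction t with
  | zero => simp
  | add x y hx hy => simp only [map_add, TensorProduct.add_tmul, hx, hy]
  | tmul x y => rfl

/-- Coassociativity makes `twistMap` multiplicative for convolution, so the antipode inverts the
twist by the identity. -/
theorem twistMap_twistMap (s t : H →ₗ[k] H) (x : H ⊗[k] V) :
    twistMap k V s (twistMap k V t x) = twistMap k V (conv k s t) x := by
  induction x with
  | zero => simp
  | add x y hx hy => simp only [map_add, hx, hy]
  | tmul h v =>
    have h1 : ∀ z : H ⊗[k] H, twistMap k V s ((orb k V v ∘ₗ t).lTensor H z) =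
        (orb k V v ∘ₗ LinearMap.mul' k H ∘ₗ TensorProduct.map s t).lTensor H
          (TensorProduct.assoc k H H H ((Coalgebra.comul (R := k) (A := H)).rTensor H z)) := by
      intro z
      induction z with
      | zero => simp
      | add x y hx hy => simp only [map_add, hx, hy]
      | tmul x y =>
        rw [LinearMap.lTensor_tmul, twistMap_tmul, LinearMap.rTensor_tmul]
        generalize Coalgebra.comul (R := k) x = w
        induction w with
        | zero => simp
        | add x y hx hy => simp only [map_add, TensorProduct.add_tmul, hx, hy]
        | tmul a b =>
          simp [smul_smul]
    rw [twistMap_tmul, h1, Coalgebra.coassoc_apply, twistMap_tmul, ← LinearMap.comp_apply,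
      ← LinearMap.lTensor_comp]
    rfl

theorem twistMap_convOne (x : H ⊗[k] V) : twistMap k V (convOne k H) x = x := by
  induction x with
  | zero => simp
  | add x y hx hy => simp only [map_add, hx, hy]
  | tmul h v =>
    rw [twistMap_tmul]
    have : ∀ z : H ⊗[k] H, (orb k V v ∘ₗ convOne k H).lTensor H z =
        TensorProduct.rid k H ((Coalgebra.counit (R := k) (A := H)).lTensor H z) ⊗ₜ v := by
      intro z
      induction z with
      | zero => simp
      | add x y hx hy => simp only [map_add, TensorProduct.add_tmul, hx, hy]
      | tmul x y =>
        simp only [LinearMap.lTensor_tmul, TensorProduct.rid_tmul, LinearMap.comp_apply, orb_apply,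
          convOne, TensorProduct.smul_tmul]
        rfl
    rw [this]
    simp

variable (H) in
/-- The regular module is `H`. -/
def regularEquiv : H ≃ₗ[k] regular H where
  toFun := toRegular
  invFun h := h
  left_inv _ := rfl
  right_inv _ := rfl
  map_add' _ _ := rfl
  map_smul' c h := Algebra.smul_def c h

/-- The underlying vector space of `H ⊗ V`. -/
def regularTensorEquiv (V : ModuleCat.{u} H) :
    H ⊗[k] V ≃ₗ[k] (tensorObj k (regular H) V : ModuleCat.{u} H) :=
  (TensorProduct.congr (regularEquiv k H) (LinearEquiv.refl k V)).trans
    (tensorEquiv k (regular H) V)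

theorem regularTensorEquiv_tmul (h : H) (v : V) :
    regularTensorEquiv k V (h ⊗ₜ v) = tm k (regular H) V (toRegular h) v := rfl

theorem smul_regularTensorEquiv (a : H) (v : V) (z : H ⊗[k] H) :
    a • regularTensorEquiv k V ((orb k V v).lTensor H z) =
      regularTensorEquiv k V ((orb k V v).lTensor H (Coalgebra.comul (R := k) a * z)) := by
  induction z with
  | zero => simp
  | add x y hx hy => simp only [map_add, smul_add, mul_add, hx, hy]
  | tmul x y =>
    rw [LinearMap.lTensor_tmul, regularTensorEquiv_tmul, smul_tm, coact_self]
    generalize Coalgebra.comul (R := k) a = t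
    induction t with
    | zero => simp
    | add x y hx hy => simp only [map_add, add_mul, hx, hy]
    | tmul p q =>
      rw [Algebra.TensorProduct.tmul_mul_tmul, LinearMap.lTensor_tmul, orb_apply k V v (q * y),
        mul_smul]
      rfl

/-- The module `H ⊗ V` is free: it is isomorphic to the module induced from the vector
space `V`. -/
def freeEquiv (V : ModuleCat.{u} H) : H ⊗[k] V ≃ₗ[H] tensorObj k (regular H) V where
  toFun x := regularTensorEquiv k V (twistMap k V LinearMap.id x)
  map_add' x y := by simp
  map_smul' a x := by
    induction x with
    | zero => simp
    | add x y hx hy => simp only [smul_add, map_add, hx, hy]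
    | tmul h v =>
      rw [TensorProduct.smul_tmul', twistMap_tmul, twistMap_tmul, smul_eq_mul,
        Bialgebra.comul_mul, RingHom.id_apply]
      exact (smul_regularTensorEquiv k a v _).symm
  invFun x := twistMap k V (HopfAlgebra.antipode k) ((regularTensorEquiv k V).symm x)
  left_inv x := by
    beta_reduce
    rw [LinearEquiv.symm_apply_apply, twistMap_twistMap, conv_antipode_id, twistMap_convOne]
  right_inv x := by
    beta_reduce
    rw [twistMap_twistMap, conv_id_antipode, twistMap_convOne, LinearEquiv.apply_symm_apply]

/-- The tensor product `H ⊗ V` is projective. -/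
theorem projective_regular_tensor (V : ModuleCat.{u} H) :
    Projective (tensorObj k (regular H) V) :=
  have := Module.Projective.of_equiv (freeEquiv k V)
  (IsProjective.iff_projective (tensorObj k (regular H) V)).1 this

end Free

/-! ### Coinduced modules and their injectivity -/

section Coinduced

variable (k H : Type u) [Field k] [Ring H] [HopfAlgebra k H]

/-- The space of linear maps `H → V`, as the underlying space of the coinduced module. -/
@[nolint unusedArguments]
def Coind (V : Type u) [AddCommGroup V] [Module k V] : Type u := H →ₗ[k] V

variable (V : Type u) [AddCommGroup V] [Module k V]

instance : AddCommGroup (Coind k H V) := inferInstanceAs (AddCommGroup (H →ₗ[k] V))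

/-- `H` acts on linear maps by translation: `(a F)(x) = F(x a)`. -/
instance : Module H (Coind k H V) where
  smul a F := (show H →ₗ[k] V from F) ∘ₗ LinearMap.mulRight k a
  one_smul F := LinearMap.ext fun x => congrArg (show H →ₗ[k] V from F) (mul_one x)
  mul_smul a b F := LinearMap.ext fun x =>
    congrArg (show H →ₗ[k] V from F) (mul_assoc x a b).symm
  smul_zero _ := rfl
  smul_add _ _ _ := rfl
  add_smul a b F := LinearMap.ext fun x =>
    (congrArg (show H →ₗ[k] V from F) (mul_add x a b)).trans (map_add _ _ _)
  zero_smul F := LinearMap.ext fun x =>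
    (congrArg (show H →ₗ[k] V from F) (mul_zero x)).trans (map_zero _)

/-- The coinduced module. -/
def coind : ModuleCat.{u} H := ModuleCat.of H (Coind k H V)

/-- The elements of the coinduced module are the linear maps `H → V`. -/
def coindEquiv : (H →ₗ[k] V) ≃ₗ[k] coind k H V where
  toFun F := F
  invFun F := F
  left_inv _ := rfl
  right_inv _ := rfl
  map_add' _ _ := rfl
  map_smul' c F := LinearMap.ext fun x => by
    change c • F x = F (x * algebraMap k H c)
    rw [← Algebra.commutes, ← Algebra.smul_def, map_smul]

theorem smul_coindEquiv (a : H) (F : H →ₗ[k] V) :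
    a • coindEquiv k H V F = coindEquiv k H V (F ∘ₗ LinearMap.mulRight k a) := rfl

/-- The `H`-linear map to a coinduced module that corresponds to a linear map. -/
def coindLiftLinear (X : ModuleCat.{u} H) (f : X →ₗ[k] V) : X →ₗ[H] coind k H V where
  toFun x := coindEquiv k H V (f ∘ₗ orb k X x)
  map_add' x y := by
    rw [← map_add]
    congr 1
    ext
    simp
  map_smul' a x := by
    rw [RingHom.id_apply, smul_coindEquiv]
    congr 1
    ext
    simp [smul_smul]

/-- The morphism to a coinduced module that corresponds to a linear map. -/
def coindLift (X : ModuleCat.{u} H) (f : X →ₗ[k] V) : X ⟶ coind k H V :=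
  ModuleCat.ofHom (Y := coind k H V) (coindLiftLinear k H V X f)

/-- Evaluation at `1` identifies morphisms to the coinduced module with linear maps to `V`, and
these extend along injections of vector spaces. -/
instance coind_injective : Injective (coind k H V) where
  factors {X Y} g f _ := by
    have hf : Function.Injective (klin k f) := (ModuleCat.mono_iff_injective f).1 inferInstance
    obtain ⟨r, hr⟩ := (klin k f).exists_leftInverse_of_injective (LinearMap.ker_eq_bot.2 hf)
    let ev : coind k H V →ₗ[k] V :=
      (LinearMap.applyₗ (R := k) (1 : H)) ∘ₗ (coindEquiv k H V).symm.toLinearMap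
    refine ⟨coindLift k H V Y (ev ∘ₗ klin k g ∘ₗ r), ?_⟩
    ext x
    apply (coindEquiv k H V).symm.injective
    ext a
    have h1 : r (a • f x) = a • x := by
      have := LinearMap.congr_fun hr (a • x)
      simpa using this
    change ev (g (r (a • f x))) = (coindEquiv k H V).symm (g x) a
    rw [h1, map_smul]
    change (coindEquiv k H V).symm (g x) (1 * a) = _
    rw [one_mul]

end Coinduced

/-! ### Tensor products with the dual of `H` -/

section Dual

variable (k : Type u) {H : Type u} [Field k] [Ring H] [HopfAlgebra k H]

/-- The linear map `F ↦ (x ↦ ∑ s(x₍₁₎) F(x₍₂₎))`. -/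
def cotwist (V : ModuleCat.{u} H) (s : H →ₗ[k] H) (F : H →ₗ[k] V) : H →ₗ[k] V :=
  TensorProduct.lift (Algebra.lsmul k k V).toLinearMap ∘ₗ TensorProduct.map s F ∘ₗ
    Coalgebra.comul

/-- The counterpart of `twistMap_twistMap`: composition again becomes convolution, by
coassociativity. -/
theorem cotwist_cotwist (V : ModuleCat.{u} H) (s t : H →ₗ[k] H) (F : H →ₗ[k] V) :
    cotwist k V s (cotwist k V t F) = cotwist k V (conv k s t) F := by
  ext h
  have h1 : ∀ z : H ⊗[k] H, TensorProduct.lift (Algebra.lsmul k k V).toLinearMap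
      (TensorProduct.map (conv k s t) F z) =
      TensorProduct.lift (Algebra.lsmul k k V).toLinearMap (TensorProduct.map s
        (TensorProduct.lift (Algebra.lsmul k k V).toLinearMap ∘ₗ TensorProduct.map t F)
          (TensorProduct.assoc k H H H ((Coalgebra.comul (R := k) (A := H)).rTensor H z))) := by
    intro z
    induction z with
    | zero => simp
    | add x y hx hy => simp only [map_add, hx, hy]
    | tmul x y =>
      simp only [conv, TensorProduct.map_tmul, LinearMap.comp_apply, LinearMap.rTensor_tmul]
      generalize Coalgebra.comul (R := k) x = w
      induction w with
      | zero => simp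
      | add x y hx hy => simp only [map_add, TensorProduct.add_tmul, hx, hy]
      | tmul a b => simp
  rw [cotwist, cotwist, cotwist, LinearMap.comp_apply, LinearMap.comp_apply, LinearMap.comp_apply,
    LinearMap.comp_apply, h1, Coalgebra.coassoc_apply, LinearMap.lTensor_def,
    ← LinearMap.comp_apply (TensorProduct.map _ _) (TensorProduct.map _ _),
    ← TensorProduct.map_comp]
  rfl

theorem cotwist_convOne (V : ModuleCat.{u} H) (F : H →ₗ[k] V) :
    cotwist k V (convOne k H) F = F := by
  ext h
  have : ∀ z : H ⊗[k] H, TensorProduct.lift (Algebra.lsmul k k V).toLinearMap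
      (TensorProduct.map (convOne k H) F z) =
      F (TensorProduct.lid k H ((Coalgebra.counit (R := k) (A := H)).rTensor H z)) := by
    intro z
    induction z with
    | zero => simp
    | add x y hx hy => simp only [map_add, hx, hy]
    | tmul x y => simp [convOne]
  rw [cotwist, LinearMap.comp_apply, LinearMap.comp_apply, this]
  simp

variable [FiniteDimensional k H]

/-- The linear equivalence `V ⊗ H^* ≃ Hom(H, V)`, `v ⊗ f ↦ (x ↦ ∑ f(x₍₂₎) x₍₁₎ v)`. -/
def tensorDualEquiv (V : ModuleCat.{u} H) : V ⊗[k] coind k H k ≃ₗ[k] (H →ₗ[k] V) :=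
  ((TensorProduct.comm k V (coind k H k)).trans
    ((TensorProduct.congr (coindEquiv k H k).symm (LinearEquiv.refl k V)).trans
      -- Finite dimension of `H` enters here. The twist that follows turns the diagonal action into
      -- translation.
      (dualTensorHomEquiv k H V))).trans
    { toFun := cotwist k V LinearMap.id
      map_add' := fun F G => by
        rw [cotwist, TensorProduct.map_add_right, LinearMap.add_comp, LinearMap.comp_add]; rfl
      map_smul' := fun c F => by
        rw [cotwist, TensorProduct.map_smul_right, LinearMap.smul_comp, LinearMap.comp_smul]; rfl
      invFun := cotwist k V (HopfAlgebra.antipode k)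
      left_inv := fun F => by rw [cotwist_cotwist, conv_antipode_id, cotwist_convOne]
      right_inv := fun F => by rw [cotwist_cotwist, conv_id_antipode, cotwist_convOne] }

theorem tensorDualEquiv_tmul (V : ModuleCat.{u} H) (v : V) (f : H →ₗ[k] k) (x : H) :
    tensorDualEquiv k V (v ⊗ₜ coindEquiv k H k f) x =
      TensorProduct.lift (LinearMap.lsmul k V).flip
        (TensorProduct.map (orb k V v) f (Coalgebra.comul (R := k) x)) := by
  change TensorProduct.lift (Algebra.lsmul k k V).toLinearMap
    (TensorProduct.map LinearMap.id (dualTensorHom k H V (f ⊗ₜ v)) (Coalgebra.comul (R := k) x)) = _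
  generalize Coalgebra.comul (R := k) x = t
  induction t with
  | zero => simp
  | add x y hx hy => simp only [map_add, hx, hy]
  | tmul x y => exact smul_comm x (f y) v

/-- The tensor product `V ⊗ H^*` is coinduced. -/
def tensorDualIso (V : ModuleCat.{u} H) : tensorObj k V (coind k H k) ≅ coind k H V :=
  tensorIso k ((tensorDualEquiv k V).trans (coindEquiv k H V)) (by
    intro a v f
    obtain ⟨f, rfl⟩ := (coindEquiv k H k).surjective f
    rw [LinearEquiv.trans_apply, LinearEquiv.trans_apply, smul_coindEquiv, coact_self]
    congr 1
    ext x
    rw [LinearMap.comp_apply, LinearMap.mulRight_apply, tensorDualEquiv_tmul, Bialgebra.comul_mul]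
    generalize Coalgebra.comul (R := k) a = t
    induction t with
    | zero => simp
    | add s t hs ht => simp only [map_add, mul_add, LinearMap.add_apply, hs, ht]
    | tmul b c =>
      rw [TensorProduct.map_tmul, orb_apply, orb_apply, smul_coindEquiv, tensorDualEquiv_tmul]
      generalize Coalgebra.comul (R := k) x = s
      induction s with
      | zero => simp
      | add s t hs ht => simp only [map_add, add_mul, hs, ht]
      | tmul x y => simp [mul_smul])

end Dual

/-! ### Injectivity of tensor products with the regular module -/

section SelfInjective

variable (k H : Type u) [Field k] [Ring H] [HopfAlgebra k H]

theorem injective_of_retract {𝒞 : Type*} [Category 𝒞] {X Y : 𝒞} (a : X ⟶ Y) (b : Y ⟶ X)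
    (h : a ≫ b = 𝟙 X) [Injective Y] : Injective X :=
  ⟨fun g f _ => ⟨Injective.factorThru (g ≫ a) f ≫ b, by simp [h]⟩⟩

/-- `H ⊗ H^*` is free on the vector space `H^*`; the vector `ε` and the functional "evaluate at
`1`", which takes the value `1` on it, split off a free summand of rank one. -/
theorem regular_retract : ∃ (a : regular H ⟶ tensorObj k (regular H) (coind k H k))
    (b : tensorObj k (regular H) (coind k H k) ⟶ regular H), a ≫ b = 𝟙 _ := by
  let d : coind k H k := coindEquiv k H k Coalgebra.counit
  let φ : coind k H k →ₗ[k] k :=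
    LinearMap.applyₗ (R := k) (1 : H) ∘ₗ (coindEquiv k H k).symm.toLinearMap
  have hφ : φ d = 1 := Bialgebra.counit_one
  let a : regular H →ₗ[H] tensorObj k (regular H) (coind k H k) :=
    (freeEquiv k (coind k H k)).toLinearMap ∘ₗ
      ((TensorProduct.AlgebraTensorModule.mk k H H (coind k H k)).flip d : H →ₗ[H] _)
  let b : tensorObj k (regular H) (coind k H k) →ₗ[H] regular H :=
    ((TensorProduct.AlgebraTensorModule.rid k H H).toLinearMap ∘ₗ
      TensorProduct.AlgebraTensorModule.lTensor H H φ : _ →ₗ[H] H) ∘ₗ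
      (freeEquiv k (coind k H k)).symm.toLinearMap
  refine ⟨ModuleCat.ofHom (X := regular H) a, ModuleCat.ofHom (Y := regular H) b, ?_⟩
  ext
  change TensorProduct.AlgebraTensorModule.rid k H H
    (TensorProduct.AlgebraTensorModule.lTensor H H φ ((freeEquiv k (coind k H k)).symm
      (freeEquiv k (coind k H k) (_ ⊗ₜ d)))) = _
  rw [LinearEquiv.symm_apply_apply, TensorProduct.AlgebraTensorModule.lTensor_tmul, hφ,
    TensorProduct.AlgebraTensorModule.rid_tmul, one_smul]
  rfl

variable [FiniteDimensional k H]

-- Up to associativity, `V ⊗ H` is a retract of `(V ⊗ H) ⊗ H^*`, which is coinduced. The dimension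
-- of `V` plays no role.
variable {H} in
theorem injective_tensor_regular (V : ModuleCat.{u} H) : Injective (tensorObj k V (regular H)) := by
  obtain ⟨a, b, h⟩ := regular_retract k H
  let i : tensorObj k V (tensorObj k (regular H) (coind k H k)) ≅
      coind k H (tensorObj k V (regular H)) :=
    (assocIso k V (regular H) (coind k H k)).symm ≪≫ tensorDualIso k (tensorObj k V (regular H))
  refine injective_of_retract (tensorMap k (𝟙 V) a ≫ i.hom) (i.inv ≫ tensorMap k (𝟙 V) b) ?_
  rw [Category.assoc, Iso.hom_inv_id_assoc, ← tensorMap_id_comp, h, tensorMap_id_id]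

include k in
theorem injective_regular : Injective (regular H) := by
  have := injective_tensor_regular k (trivialModule k H)
  exact Injective.of_iso (unitIso k (H := H) (regular H)) this

/-- The trivial module on a vector space. -/
def trivialOn (N : Type u) [AddCommGroup N] [Module k N] : ModuleCat.{u} H :=
  (ModuleCat.restrictScalars (Bialgebra.counitAlgHom k H).toRingHom).obj (ModuleCat.of k N)

/-- The underlying vector space of the trivial module. -/
def trivialOnEquiv (N : Type u) [AddCommGroup N] [Module k N] : trivialOn k H N ≃ₗ[k] N where
  toFun c := c
  map_add' _ _ := rfl
  map_smul' c x := by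
    change Coalgebra.counit (R := k) (algebraMap k H c) • (show N from x) = c • (show N from x)
    rw [Bialgebra.counit_algebraMap]
  invFun c := c
  left_inv _ := rfl
  right_inv _ := rfl

/-- The module induced from `N`. -/
def induced (N : Type u) [AddCommGroup N] [Module k N] : ModuleCat.{u} H :=
  ModuleCat.of H (H ⊗[k] N)

/-- The underlying vector space of the module induced from `N`. -/
def inducedEquiv (N : Type u) [AddCommGroup N] [Module k N] : H ⊗[k] N ≃ₗ[k] induced k H N where
  toFun x := x
  map_add' _ _ := rfl
  map_smul' c x := (algebraMap_smul H c x).symm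
  invFun x := x
  left_inv _ := rfl
  right_inv _ := rfl

/-- Tensoring a trivial module with the regular module gives a free module. -/
def trivialOnTensorIso (N : Type u) [AddCommGroup N] [Module k N] :
    tensorObj k (trivialOn k H N) (regular H) ≅ induced k H N :=
  tensorIso k (((TensorProduct.comm k _ _).trans (TensorProduct.congr
    (regularEquiv k H).symm (trivialOnEquiv k H N))).trans (inducedEquiv k H N)) (by
      intro a n h
      have : ∀ t : H ⊗[k] H, (((TensorProduct.comm k _ _).trans (TensorProduct.congr
          (regularEquiv k H).symm (trivialOnEquiv k H N))).trans (inducedEquiv k H N))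
          (TensorProduct.map (orb k (trivialOn k H N) n) (orb k (regular H) h) t) =
          inducedEquiv k H N ((TensorProduct.lid k H
            ((Coalgebra.counit (R := k) (A := H)).rTensor H t) * (regularEquiv k H).symm h) ⊗ₜ
              trivialOnEquiv k H N n) := by
        intro t
        induction t with
        | zero => simp
        | add x y hx hy => simp only [map_add, hx, hy, add_mul, TensorProduct.add_tmul]
        | tmul x y =>
          change inducedEquiv k H N ((y * (regularEquiv k H).symm h) ⊗ₜ
            (Coalgebra.counit (R := k) x • trivialOnEquiv k H N n)) = _
          simp [TensorProduct.smul_tmul]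
      rw [this, coact_self, Coalgebra.rTensor_counit_comul, TensorProduct.lid_tmul, one_smul]
      rfl)

-- The factors of `V ⊗ H` cannot simply be swapped when `H` is not cocommutative. Instead, `H ⊗ V`
-- is free on the vector space `V`, and so is the product with `H` on the right once `V` is given
-- the trivial action.
variable {H} in
theorem injective_regular_tensor (V : ModuleCat.{u} H) :
    Injective (tensorObj k (regular H) V) := by
  have := injective_tensor_regular k (trivialOn k H V)
  exact Injective.of_iso (trivialOnTensorIso k H V ≪≫ (freeEquiv k V).toModuleIso) inferInstance

/-- A finite-dimensional Hopf algebra has a left integral. -/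
theorem exists_isLeftIntegral : ∃ Λ : H, IsLeftIntegral k Λ := by
  -- The function `x ↦ ε(x) 1` is a nonzero invariant of the coinduced module on `H`. That module is
  -- free over `H`, and a nonzero coordinate of an invariant in a free module is a left integral.
  let F₀ : H →ₗ[k] regular H := (regularEquiv k H).toLinearMap ∘ₗ Algebra.linearMap k H ∘ₗ
    Coalgebra.counit
  have hF₀ : ∀ h : H, F₀ h = toRegular (algebraMap k H (Coalgebra.counit (R := k) h)) :=
    fun _ => rfl
  let F : coind k H (regular H) := coindEquiv k H (regular H) F₀
  have hF : ∀ a : H, a • F = algebraMap k H (Coalgebra.counit (R := k) a) • F := by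
    intro a
    rw [smul_coindEquiv, smul_coindEquiv]
    congr 1
    ext x
    simp [hF₀]
  have hF0 : F ≠ 0 := by
    intro h
    have h1 : F₀ 1 = 0 := by
      rw [(coindEquiv k H (regular H)).map_eq_zero_iff.1 h, LinearMap.zero_apply]
    rw [hF₀, Bialgebra.counit_one, map_one] at h1
    have h2 : (1 : H) = 0 := h1
    have h3 := congrArg (Coalgebra.counit (R := k)) h2
    simp at h3
  let L : coind k H (regular H) ≃ₗ[H] H ⊗[k] coind k H k :=
    (tensorDualIso k (regular H)).symm.toLinearEquiv.trans (freeEquiv k (coind k H k)).symm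
  let b := Algebra.TensorProduct.basis H (Module.Free.chooseBasis k (coind k H k))
  have hy : b.repr (L F) ≠ 0 := by simpa using hF0
  obtain ⟨i, hi⟩ := Finsupp.ne_iff.1 hy
  refine ⟨b.repr (L F) i, hi, fun h => ?_⟩
  have h1 := congrArg (fun z => b.repr (L z) i) (hF h)
  simp only [map_smul, Finsupp.smul_apply, smul_eq_mul] at h1
  rw [h1, Algebra.smul_def]

end SelfInjective

/-! ### Exactness of tensor products -/

section Exactness

variable (k : Type u) {H A : Type u} [Field k] [Ring H] [HopfAlgebra k H] [Ring A] [Algebra k A]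
  [LeftComoduleAlgebra k H A]

variable {V W U : ModuleCat.{u} H} {M N P : ModuleCat.{u} A}

theorem tensorMap_surjective {f : V ⟶ W} {g : M ⟶ N} (hf : Function.Surjective f)
    (hg : Function.Surjective g) : Function.Surjective (tensorMap k f g) :=
  TensorProduct.map_surjective (g := klin k f) (g' := klin k g) hf hg

theorem tensorMap_left_injective {f : V ⟶ W} (hf : Function.Injective f) (M : ModuleCat.{u} A) :
    Function.Injective (tensorMap k f (𝟙 M)) :=
  Module.Flat.rTensor_preserves_injective_linearMap (M := M) (klin k f) hf

theorem tensorMap_left_exact {f : V ⟶ W} {g : W ⟶ U} (h : Function.Exact f g)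
    (hg : Function.Surjective g) (M : ModuleCat.{u} A) :
    Function.Exact (tensorMap k f (𝟙 M)) (tensorMap k g (𝟙 M)) :=
  rTensor_exact (f := klin k f) (g := klin k g) M h hg

theorem tensorMap_right_exact {f : M ⟶ N} {g : N ⟶ P} (h : Function.Exact f g)
    (hg : Function.Surjective g) (V : ModuleCat.{u} H) :
    Function.Exact (tensorMap k (𝟙 V) f) (tensorMap k (𝟙 V) g) :=
  lTensor_exact (f := klin k f) (g := klin k g) V h hg

variable {R : Type u} [Ring R] {X Y Z : ModuleCat.{u} R}

theorem exists_desc_of_exact {f : X ⟶ Y} {g : Y ⟶ Z} (h : Function.Exact f g)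
    (hg : Function.Surjective g) {W : ModuleCat.{u} R} (l : Y ⟶ W) (hl : f ≫ l = 0) :
    ∃ m : Z ⟶ W, g ≫ m = l := by
  have h0 : f ≫ g = 0 := by ext x; exact h.apply_apply_eq_zero x
  have : Epi g := (ModuleCat.epi_iff_surjective g).2 hg
  have hS : (ShortComplex.mk f g h0).Exact :=
    (ShortComplex.ShortExact.moduleCat_exact_iff_function_exact _).2 h
  exact ⟨hS.desc l hl, hS.g_desc l hl⟩

theorem exists_lift_of_exact {f : X ⟶ Y} {g : Y ⟶ Z} (h : Function.Exact f g)
    (hf : Function.Injective f) {W : ModuleCat.{u} R} (l : W ⟶ Y) (hl : l ≫ g = 0) :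
    ∃ m : W ⟶ X, m ≫ f = l := by
  have h0 : f ≫ g = 0 := by ext x; exact h.apply_apply_eq_zero x
  have : Mono f := (ModuleCat.mono_iff_injective f).2 hf
  have hS : (ShortComplex.mk f g h0).Exact :=
    (ShortComplex.ShortExact.moduleCat_exact_iff_function_exact _).2 h
  exact ⟨hS.lift l hl, hS.lift_f l hl⟩

instance tensorLeft_additive (V : ModuleCat.{u} H) :
    (tensorLeft k V : ModuleCat.{u} A ⥤ ModuleCat.{u} A).Additive where
  map_add {_ _ f g} := tensorMap_add_right k (𝟙 V) f g

/-- Tensoring with an `A`-module, as a functor on `H`-modules. -/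
def tensorRight (M : ModuleCat.{u} A) : ModuleCat.{u} H ⥤ ModuleCat.{u} A where
  obj V := tensorObj k V M
  map f := tensorMap k f (𝟙 M)
  map_id V := tensorMap_id_id k V M
  map_comp f g := tensorMap_comp_id k f g M

instance tensorRight_additive (M : ModuleCat.{u} A) :
    (tensorRight k M : ModuleCat.{u} H ⥤ ModuleCat.{u} A).Additive where
  map_add {_ _ f g} := tensorMap_add_left k f g (𝟙 M)

instance tensorLeft_preservesFiniteColimits (V : ModuleCat.{u} H) :
    PreservesFiniteColimits (tensorLeft k V : ModuleCat.{u} A ⥤ ModuleCat.{u} A) := by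
  rw [Functor.preservesFiniteColimits_iff_forall_exact_map_and_epi]
  intro S hS
  have hg := (ModuleCat.epi_iff_surjective S.g).1 hS.epi_g
  refine ⟨(ShortComplex.ShortExact.moduleCat_exact_iff_function_exact _).2 (tensorMap_right_exact k
    ((ShortComplex.ShortExact.moduleCat_exact_iff_function_exact _).1 hS.exact) hg V),
    (ModuleCat.epi_iff_surjective _).2 (tensorMap_surjective k (fun x => ⟨x, rfl⟩) hg)⟩

instance tensorRight_preservesFiniteColimits (M : ModuleCat.{u} A) :
    PreservesFiniteColimits (tensorRight k M : ModuleCat.{u} H ⥤ ModuleCat.{u} A) := by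
  rw [Functor.preservesFiniteColimits_iff_forall_exact_map_and_epi]
  intro S hS
  have hg := (ModuleCat.epi_iff_surjective S.g).1 hS.epi_g
  refine ⟨(ShortComplex.ShortExact.moduleCat_exact_iff_function_exact _).2 (tensorMap_left_exact k
    ((ShortComplex.ShortExact.moduleCat_exact_iff_function_exact _).1 hS.exact) hg M),
    (ModuleCat.epi_iff_surjective _).2 (tensorMap_surjective k hg (fun x => ⟨x, rfl⟩))⟩

end Exactness

/-! ### Right exactness on classes of modules closed under subquotients -/

section FullSubcategory

variable {R : Type u} [Ring R] (C : ObjectProperty (ModuleCat.{u} R)) [C.IsClosedUnderSubobjects]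
  [C.IsClosedUnderQuotients] [C.IsClosedUnderFiniteProducts]

instance containsZero_of_closed : C.ContainsZero where
  exists_zero := by
    refine ⟨∏ᶜ (fun i : Fin 0 => i.elim0), ?_, C.prop_product fun i => i.elim0⟩
    rw [IsZero.iff_id_eq_zero]
    exact Limits.Pi.hom_ext _ _ fun i => i.elim0

instance ι_preservesFiniteColimits : PreservesFiniteColimits C.ι := by
  have := C.preservesCokernels_ι
  exact C.ι.preservesFiniteColimits_of_preservesCokernels

/-- A functor between full subcategories that is induced by a right exact functor
is right exact. -/
theorem preservesFiniteColimits_of_comp_ι {S : Type u} [Ring S]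
    {C' : ObjectProperty (ModuleCat.{u} S)} {G : ModuleCat.{u} R ⥤ ModuleCat.{u} S}
    [PreservesFiniteColimits G] {F : C.FullSubcategory ⥤ C'.FullSubcategory}
    (e : C.ι ⋙ G ≅ F ⋙ C'.ι) : PreservesFiniteColimits F where
  preservesFiniteColimits J _ _ := by
    have : PreservesColimitsOfShape J (F ⋙ C'.ι) := preservesColimitsOfShape_of_natIso e
    exact preservesColimitsOfShape_of_reflects_of_preserves F C'.ι

end FullSubcategory

namespace StableData

variable {𝒜 : Type u₁} [Category.{v₁} 𝒜] [Preadditive 𝒜] {ℬ : Type u₂} [Category.{v₂} ℬ]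
  [Preadditive ℬ]

/-- Right exact functors are compatible with the embeddings as soon as they preserve null
objects and the embeddings extend. -/
theorem IsCompatible.of_preservesFiniteColimits {D : StableData 𝒜} {D' : StableData ℬ}
    (F : 𝒜 ⥤ ℬ) [F.Additive] [PreservesFiniteColimits F]
    (h : ∀ N, D'.Null (𝟙 (F.obj (D.I.obj N))))
    (h' : ∀ X, ∃ e : F.obj (D.I.obj X) ⟶ D'.I.obj (F.obj X),
      F.map (D.i X) ≫ e = D'.i (F.obj X)) : D.IsCompatible D' F where
  additive := inferInstance
  null_I := h
  exists_extension := h'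
  map_coker X := by
    have hc : IsColimit (CokernelCofork.ofπ (D.p X) (D.i_p X)) :=
      CokernelCofork.IsColimit.ofπ _ _ (fun g hg => (D.desc g hg).choose)
        (fun g hg => (D.desc g hg).choose_spec)
        (fun g hg m hm => by
          rw [← cancel_epi (D.p X), hm]
          exact (D.desc g hg).choose_spec.symm)
    have hF := CokernelCofork.mapIsColimit _ hc F
    exact
      { zero := by rw [← F.map_comp, D.i_p, F.map_zero]
        epi := ⟨fun g g' hg => Cofork.IsColimit.hom_ext hF hg⟩
        desc := fun g hg => ⟨hF.desc (CokernelCofork.ofπ g hg), hF.fac _ WalkingParallelPair.one⟩ }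
  map_pushout h := h.map F

end StableData

/-! ### The embedding defined by a left integral -/

section Integral

variable (k : Type u) {H A : Type u} [Field k] [Ring H] [HopfAlgebra k H] [Ring A] [Algebra k A]
  [LeftComoduleAlgebra k H A] {Λ : H} (hΛ : IsLeftIntegral k Λ)

theorem integralEmb_apply (M : ModuleCat.{u} A) (m : M) :
    integralEmb k hΛ M m = tm k (regular H) M (toRegular Λ) m := rfl

theorem integralEmb_naturality {M N : ModuleCat.{u} A} (f : M ⟶ N) :
    f ≫ integralEmb k hΛ N = integralEmb k hΛ M ≫ tensorMap k (𝟙 (regular H)) f := by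
  ext x
  rfl

/-- This reduces extension problems for `A`-modules to `H`-modules. -/
theorem integralEmb_assoc (V : ModuleCat.{u} H) (M : ModuleCat.{u} A) :
    tensorMap k (integralEmb k hΛ V) (𝟙 M) ≫ (assocIso k (regular H) V M).hom =
      integralEmb k hΛ (tensorObj k V M) :=
  tensor_hom_ext k fun _ _ => rfl

include hΛ in
theorem toRegular_ne_zero : toRegular Λ ≠ 0 := hΛ.1

/-- The span of `Λ` as a module map from the trivial module. -/
def integralLinear : trivialModule k H →ₗ[H] regular H where
  toFun c := trivialEquiv k c • toRegular Λ
  map_add' x y := by rw [map_add, add_smul]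
  map_smul' h c := by
    have h1 : trivialEquiv k (h • c) = Coalgebra.counit (R := k) h * trivialEquiv k c := rfl
    have h2 : h • toRegular Λ = Coalgebra.counit (R := k) h • toRegular Λ :=
      (hΛ.2 h).trans (Algebra.smul_def _ _)
    rw [RingHom.id_apply, h1, smul_comm h, h2, smul_smul, mul_comm]

/-- The inclusion of the trivial module as the span of `Λ`. -/
def integralHom : trivialModule k H ⟶ regular H :=
  ModuleCat.ofHom (X := trivialModule k H) (Y := regular H) (integralLinear k hΛ)

theorem integralHom_apply (c : trivialModule k H) :
    integralHom k hΛ c = trivialEquiv k c • toRegular Λ := rfl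

theorem integralHom_injective : Function.Injective (integralHom k hΛ) := by
  intro c d h
  rw [integralHom_apply, integralHom_apply] at h
  exact (trivialEquiv k).injective (smul_left_injective k (toRegular_ne_zero k hΛ) h)

/-- The integral property makes the submodule generated by `Λ` equal to the line `kΛ`. -/
theorem integralHom_exact : Function.Exact (integralHom k hΛ) (regularProj Λ) := by
  intro x
  constructor
  · intro hx
    obtain ⟨h, rfl⟩ := Submodule.mem_span_singleton.1 ((Submodule.Quotient.mk_eq_zero _).1 hx)
    exact ⟨(trivialEquiv k).symm (Coalgebra.counit (R := k) h),
      ((hΛ.2 h).trans (Algebra.smul_def _ _)).symm⟩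
  · rintro ⟨c, rfl⟩
    refine (Submodule.Quotient.mk_eq_zero _).2 (Submodule.mem_span_singleton.2
      ⟨algebraMap k H (trivialEquiv k c), rfl⟩)

/-- With this, injectivity and exactness at `H ⊗ M` follow from those of `k → H → H/kΛ`, since
tensoring over a field is exact. -/
theorem unitIso_integralEmb (M : ModuleCat.{u} A) :
    (unitIso k M).hom ≫ integralEmb k hΛ M = tensorMap k (integralHom k hΛ) (𝟙 M) :=
  tensor_hom_ext k fun c m =>
    ((TensorProduct.smul_tmul (trivialEquiv k c) (toRegular Λ) m).symm :
      (toRegular Λ) ⊗ₜ[k] (trivialEquiv k c • m) = (trivialEquiv k c • toRegular Λ) ⊗ₜ[k] m)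

theorem integralEmb_eq (M : ModuleCat.{u} A) :
    integralEmb k hΛ M = (unitIso k M).inv ≫ tensorMap k (integralHom k hΛ) (𝟙 M) := by
  rw [← unitIso_integralEmb, Iso.inv_hom_id_assoc]

theorem integralEmb_injective (M : ModuleCat.{u} A) : Function.Injective (integralEmb k hΛ M) := by
  rw [integralEmb_eq]
  exact (tensorMap_left_injective k (integralHom_injective k hΛ) M).comp
    ((ConcreteCategory.isIso_iff_bijective (unitIso k M).inv).1 inferInstance).1

theorem integralEmb_exact (M : ModuleCat.{u} A) :
    Function.Exact (integralEmb k hΛ M) (tensorMap k (regularProj Λ) (𝟙 M)) := by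
  have h := tensorMap_left_exact k (integralHom_exact k hΛ)
    ((ModuleCat.epi_iff_surjective _).1 (regularProj_epi Λ)) M
  intro x
  rw [h x, ← unitIso_integralEmb]
  constructor
  · rintro ⟨y, rfl⟩
    exact ⟨(unitIso k M).hom y, rfl⟩
  · rintro ⟨y, rfl⟩
    refine ⟨(unitIso k M).inv y, ?_⟩
    simp

/-- The counit as a morphism from the regular to the trivial module. -/
def counitHom (k H : Type u) [Field k] [Ring H] [HopfAlgebra k H] :
    regular H ⟶ trivialModule k H :=
  ModuleCat.ofHom (X := regular H) (Y := trivialModule k H)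
    ({ toFun := fun h => (trivialEquiv k).symm (Coalgebra.counit (R := k) (A := H) h)
       map_add' := fun x y => by
        rw [← map_add]; exact congrArg _ (map_add (Coalgebra.counit (R := k) (A := H)) x y)
       map_smul' := fun a x => congrArg (trivialEquiv k).symm
        (Bialgebra.counit_mul (R := k) a x) } : regular H →ₗ[H] trivialModule k H)

theorem counitHom_surjective : Function.Surjective (counitHom k H) := by
  intro c
  refine ⟨toRegular (algebraMap k H (trivialEquiv k c)), ?_⟩
  exact congrArg (trivialEquiv k).symm (Bialgebra.counit_algebraMap (trivialEquiv k c))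

/-- The kernel of the counit. -/
def augmentation (k H : Type u) [Field k] [Ring H] [HopfAlgebra k H] : ModuleCat.{u} H :=
  kernel (counitHom k H)

/-- The inclusion of the kernel of the counit. -/
def augmentationι (k H : Type u) [Field k] [Ring H] [HopfAlgebra k H] :
    augmentation k H ⟶ regular H := kernel.ι (counitHom k H)

instance : Mono (augmentationι k H) := inferInstanceAs (Mono (kernel.ι (counitHom k H)))

theorem augmentationι_exact : Function.Exact (augmentationι k H) (counitHom k H) :=
  (ShortComplex.ShortExact.moduleCat_exact_iff_function_exact
    (ShortComplex.mk (kernel.ι (counitHom k H)) (counitHom k H) (kernel.condition _))).1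
      (ShortComplex.exact_kernel _)

/-- The morphism `ε ⊗ M : H ⊗ M ⟶ M`. -/
def counitTensor (M : ModuleCat.{u} A) : tensorObj k (regular H) M ⟶ M :=
  tensorMap k (counitHom k H) (𝟙 M) ≫ (unitIso k M).hom

theorem counitTensor_surjective (M : ModuleCat.{u} A) :
    Function.Surjective (counitTensor k (H := H) M) := by
  rw [counitTensor]
  exact ((ConcreteCategory.isIso_iff_bijective (unitIso k M).hom).1 inferInstance).2.comp
    (tensorMap_surjective k (counitHom_surjective k) (fun x => ⟨x, rfl⟩))

theorem counitTensor_exact (M : ModuleCat.{u} A) :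
    Function.Exact (tensorMap k (augmentationι k H) (𝟙 M)) (counitTensor k (H := H) M) := by
  intro x
  rw [← tensorMap_left_exact k (augmentationι_exact k) (counitHom_surjective k) M x]
  exact map_eq_zero_iff (unitIso k M).hom.hom
    ((ConcreteCategory.isIso_iff_bijective (unitIso k M).hom).1 inferInstance).1

theorem counitTensor_naturality {M N : ModuleCat.{u} A} (f : M ⟶ N) :
    tensorMap k (𝟙 (regular H)) f ≫ counitTensor k N = counitTensor k M ≫ f := by
  refine tensor_hom_ext k fun h m => ?_
  exact (map_smul (klin k f) (Coalgebra.counit (R := k) (A := H) h) m).symm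

theorem counitTensor_assoc (V : ModuleCat.{u} H) (M : ModuleCat.{u} A) :
    (assocIso k (regular H) V M).hom ≫ counitTensor k (tensorObj k V M) =
      tensorMap k (counitTensor k V) (𝟙 M) := by
  refine tensor_hom_ext₃ k fun h v m => ?_
  exact ((tensorEquiv k V M).map_smul (Coalgebra.counit (R := k) (A := H) h) (v ⊗ₜ m)).symm

variable [FiniteDimensional k H]

/-- As `H` is injective, the embedding `H ⟶ H ⊗ H` has a retraction `ρ`. Tensored with `N`, it
retracts the embedding of `H ⊗ N`; following `H ⊗ g` by it extends `g`. -/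
theorem exists_extension_regular {M N : ModuleCat.{u} A} (g : M ⟶ tensorObj k (regular H) N) :
    ∃ g', integralEmb k hΛ M ≫ g' = g := by
  have := injective_regular k H
  have : Mono (integralEmb k hΛ (regular H)) :=
    (ModuleCat.mono_iff_injective _).2 (integralEmb_injective k hΛ _)
  let ρ := Injective.factorThru (𝟙 (regular H)) (integralEmb k hΛ (regular H))
  refine ⟨tensorMap k (𝟙 _) g ≫ (assocIso k _ _ _).inv ≫ tensorMap k ρ (𝟙 N), ?_⟩
  rw [← reassoc_of% integralEmb_naturality k hΛ g, ← integralEmb_assoc, Category.assoc,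
    Iso.hom_inv_id_assoc, ← tensorMap_comp_id, Injective.comp_factorThru, tensorMap_id_id,
    Category.comp_id]

-- The dual argument: `ε ⊗ H` has a section `σ` because `H` is projective, and `ε ⊗ W` lifts through
-- `π` because `H ⊗ W` is projective.
omit [FiniteDimensional k H] in
theorem exists_lift_regular {W : ModuleCat.{u} H} {π : regular H ⟶ W} (hπ : Epi π)
    {M N : ModuleCat.{u} A} (g : tensorObj k (regular H) N ⟶ tensorObj k W M) :
    ∃ g', g' ≫ tensorMap k π (𝟙 M) = g := by
  have h1 : Projective (regular H) :=
    (IsProjective.iff_projective (regular H)).1 (inferInstanceAs (Module.Projective H H))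
  have h2 := projective_regular_tensor k W
  have : Epi (counitTensor k (H := H) (regular H)) :=
    (ModuleCat.epi_iff_surjective _).2 (counitTensor_surjective k _)
  let σ := Projective.factorThru (𝟙 (regular H)) (counitTensor k (H := H) (regular H))
  have hσ : σ ≫ counitTensor k (regular H) = 𝟙 _ := Projective.factorThru_comp _ _
  let l := Projective.factorThru (counitTensor k (H := H) W) π
  have hl : l ≫ π = counitTensor k W := Projective.factorThru_comp _ _
  refine ⟨tensorMap k σ (𝟙 N) ≫ (assocIso k _ _ _).hom ≫ tensorMap k (𝟙 _) g ≫
    (assocIso k _ _ _).inv ≫ tensorMap k l (𝟙 M), ?_⟩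
  simp only [Category.assoc]
  rw [← tensorMap_comp_id, hl, ← counitTensor_assoc, Iso.inv_hom_id_assoc, counitTensor_naturality,
    reassoc_of% counitTensor_assoc, ← Category.assoc, ← tensorMap_comp_id, hσ, tensorMap_id_id,
    Category.id_comp]

/-- The loop of `M` is `ker ε ⊗ M`. Since `H ⊗ ker ε` is injective, the embedding of `ker ε` extends
over the inclusion `ker ε ⟶ H`; then tensor with `M`. -/
theorem exists_embedding_augmentation (M : ModuleCat.{u} A) :
    ∃ e : tensorObj k (regular H) M ⟶ tensorObj k (regular H) (tensorObj k (augmentation k H) M),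
      tensorMap k (augmentationι k H) (𝟙 M) ≫ e = integralEmb k hΛ _ := by
  have := injective_regular_tensor k (augmentation k H)
  refine ⟨tensorMap k (Injective.factorThru (integralEmb k hΛ (augmentation k H))
    (augmentationι k H)) (𝟙 M) ≫ (assocIso k _ _ _).hom, ?_⟩
  rw [← Category.assoc, ← tensorMap_comp_id, Injective.comp_factorThru, integralEmb_assoc]

theorem finDim_augmentation : finDim k H (augmentation k H) :=
  (finDim k H).prop_of_mono (augmentationι k H) (finDim_regular k H)

end Integral

/-! ### The stable data of a class of modules -/

/-- Standard triangles use pushouts of modules, cones use pushouts inside the class. They agree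
because the inclusion is fully faithful and right exact. -/
theorem ι_isPushout_iff {R : Type u} [Ring R] (C : ObjectProperty (ModuleCat.{u} R))
    [C.IsClosedUnderSubobjects] [C.IsClosedUnderQuotients] [C.IsClosedUnderFiniteProducts]
    {X Y Z W : C.FullSubcategory} (f : X ⟶ Y) (g : X ⟶ Z)
    (f' : Z ⟶ W) (g' : Y ⟶ W) : IsPushout f.hom g.hom g'.hom f'.hom ↔ IsPushout f g g' f' :=
  ⟨fun h => IsPushout.of_map C.ι (by ext : 1; exact h.w) h, fun h => h.map C.ι⟩

section Concrete

variable (k : Type u) {H A : Type u} [Field k] [Ring H] [HopfAlgebra k H] [FiniteDimensional k H]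
  [Ring A] [Algebra k A] [LeftComoduleAlgebra k H A] {Λ : H} (hΛ : IsLeftIntegral k Λ)
  (C : ObjectProperty (ModuleCat.{u} A)) [IsAdmissible k H C]

instance tensorOn_additive {V : ModuleCat.{u} H} (hV : PreservesClass k V C) :
    (tensorOn k C hV).Additive where
  map_add {_ _ f g} := by
    ext : 1
    exact tensorMap_add_right k (𝟙 V) f.hom g.hom

/-- The stable data of an admissible class of modules. -/
def stableData : StableData C.FullSubcategory where
  I := tensorOn k C (V := regular H) (fun M hM => IsAdmissible.tensor_regular M hM)
  T := shiftT k C Λ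
  additive_T := inferInstance
  i X := ObjectProperty.homMk (integralEmb k hΛ X.obj)
  p X := ObjectProperty.homMk (tensorMap k (regularProj Λ) (𝟙 X.obj))
  i_naturality f := by
    ext : 1
    exact integralEmb_naturality k hΛ f.hom
  p_naturality f := by
    ext : 1
    exact (tensorMap_exchange k (regularProj Λ) f.hom).symm
  i_p X := by
    ext x
    exact (integralEmb_exact k hΛ X.obj).apply_apply_eq_zero x
  mono_i X := C.ι.mono_of_mono_map
    ((ModuleCat.mono_iff_injective _).2 (integralEmb_injective k hΛ X.obj))
  epi_p X := C.ι.epi_of_epi_map ((ModuleCat.epi_iff_surjective _).2 (tensorMap_surjective k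
    ((ModuleCat.epi_iff_surjective _).1 (regularProj_epi Λ)) (fun x => ⟨x, rfl⟩)))
  lift g hg := by
    obtain ⟨m, hm⟩ := exists_lift_of_exact (integralEmb_exact k hΛ _)
      (integralEmb_injective k hΛ _) g.hom (congrArg (fun z => z.hom) hg)
    exact ⟨ObjectProperty.homMk m, by ext : 1; exact hm⟩
  desc g hg := by
    obtain ⟨m, hm⟩ := exists_desc_of_exact (integralEmb_exact k hΛ _)
      (tensorMap_surjective k ((ModuleCat.epi_iff_surjective _).1 (regularProj_epi Λ))
        (fun x => ⟨x, rfl⟩)) g.hom (congrArg (fun z => z.hom) hg)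
    exact ⟨ObjectProperty.homMk m, by ext : 1; exact hm⟩
  extend g := by
    obtain ⟨m, hm⟩ := exists_extension_regular k hΛ g.hom
    exact ⟨ObjectProperty.homMk m, by ext : 1; exact hm⟩
  cover g := by
    obtain ⟨m, hm⟩ := exists_lift_regular k (regularProj_epi Λ) g.hom
    exact ⟨ObjectProperty.homMk m, by ext : 1; exact hm⟩
  exists_loop M := by
    obtain ⟨e, he⟩ := exists_embedding_augmentation k hΛ M.obj
    refine ⟨⟨tensorObj k (augmentation k H) M.obj, preservesClass_of_finDim k C
      (finDim_augmentation k) _ M.property⟩, M,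
      ObjectProperty.homMk (tensorMap k (augmentationι k H) (𝟙 M.obj)),
      ObjectProperty.homMk (counitTensor k M.obj), ObjectProperty.homMk e, by ext : 1; exact he,
      ?_, ?_, ?_⟩
    · ext x
      exact (counitTensor_exact k M.obj).apply_apply_eq_zero x
    · exact C.ι.epi_of_epi_map
        ((ModuleCat.epi_iff_surjective _).2 (counitTensor_surjective k M.obj))
    · intro Z g hg
      obtain ⟨m, hm⟩ := exists_desc_of_exact (counitTensor_exact k M.obj)
        (counitTensor_surjective k M.obj) g.hom (congrArg (fun z => z.hom) hg)
      exact ⟨ObjectProperty.homMk m, by ext : 1; exact hm⟩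
  exists_pushout f := ⟨_, _, _, IsPushout.of_hasPushout _ _⟩

theorem stableData_isCone_iff {X Y Z : C.FullSubcategory} (f : X ⟶ Y) (v : Y ⟶ Z)
    (w : Z ⟶ (shiftT k C Λ).obj X) :
    (stableData k hΛ C).IsCone f v w ↔ IsStandardTriangle k C hΛ f v w := by
  constructor
  · rintro ⟨f', h, h1, h2⟩
    exact ⟨f'.hom, (ι_isPushout_iff C _ _ _ _).2 h, congrArg (fun z => z.hom) h1,
      congrArg (fun z => z.hom) h2⟩
  · rintro ⟨f', h, h1, h2⟩
    refine ⟨ObjectProperty.homMk f', (ι_isPushout_iff C _ _ _ _).1 h, ?_, ?_⟩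
    · ext : 1; exact h1
    · ext : 1; exact h2

theorem homotopyRel_iff {X Y : C.FullSubcategory} (f g : X ⟶ Y) :
    homotopyRel k H C f g ↔ (stableData k hΛ C).Null (f - g) := by
  constructor
  · rintro ⟨N, hN, a, b, h⟩
    refine ⟨⟨N, hN⟩, ObjectProperty.homMk a, ObjectProperty.homMk b, ?_⟩
    ext : 1
    exact h
  · rintro ⟨N, a, b, h⟩
    exact ⟨N.obj, N.property, a.hom, b.hom, congrArg (fun z => z.hom) h⟩

/-- For `H`-modules the relative notion is the absolute one: an injective `I` is a retract of `H ⊗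
I`, and every `H ⊗ N` is injective. -/
theorem stableRel_iff (P : ObjectProperty (ModuleCat.{u} H)) [IsAdmissible k H P]
    {X Y : P.FullSubcategory} (f g : X ⟶ Y) :
    stableRel P f g ↔ (stableData k hΛ P).Null (f - g) := by
  constructor
  · rintro ⟨I, hI, hinj, a, b, h⟩
    have : Mono (integralEmb k hΛ I) :=
      (ModuleCat.mono_iff_injective _).2 (integralEmb_injective k hΛ _)
    let ρ := Injective.factorThru (𝟙 I) (integralEmb k hΛ I)
    have hρ : integralEmb k hΛ I ≫ ρ = 𝟙 I := Injective.comp_factorThru _ _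
    refine ⟨⟨I, hI⟩, ObjectProperty.homMk (a ≫ integralEmb k hΛ I),
      ObjectProperty.homMk (ρ ≫ b), ?_⟩
    ext : 1
    change f.hom - g.hom = (a ≫ integralEmb k hΛ I) ≫ ρ ≫ b
    rw [h, Category.assoc, reassoc_of% hρ]
  · rintro ⟨N, a, b, h⟩
    exact ⟨_, ((stableData k hΛ P).I.obj N).property, injective_regular_tensor k N.obj, a.hom,
      b.hom, congrArg (fun z => z.hom) h⟩

end Concrete

/-! ### Tensor products and restriction on stable categories -/

section TensorFunctors

variable (k : Type u) {H A : Type u} [Field k] [Ring H] [HopfAlgebra k H]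
  [Ring A] [Algebra k A] [LeftComoduleAlgebra k H A] {Λ : H} (hΛ : IsLeftIntegral k Λ)

/-- The linear map `v ↦ v ⊗ Λ`. -/
def integralEmbRightLinear (V : ModuleCat.{u} H) : V →ₗ[H] tensorObj k V (regular H) where
  toFun v := tm k V (regular H) v (toRegular Λ)
  map_add' v w := add_tm k v w (toRegular Λ)
  map_smul' a v := by
    have : ∀ t : H ⊗[k] H, tensorEquiv k V (regular H) (TensorProduct.map (orb k V v)
        (orb k (regular H) (toRegular Λ)) t) = tm k V (regular H)
          (TensorProduct.rid k H ((Coalgebra.counit (R := k) (A := H)).lTensor H t) • v)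
            (toRegular Λ) := by
      intro t
      induction t with
      | zero => simp [zero_tm]
      | add x y hx hy => simp only [map_add, hx, hy, add_smul, add_tm]
      | tmul x y =>
        have h2 : y • toRegular Λ = Coalgebra.counit (R := k) y • toRegular Λ :=
          (hΛ.2 y).trans (Algebra.smul_def _ _)
        simp [h2, tm, TensorProduct.smul_tmul]
    rw [RingHom.id_apply, smul_tm, this, coact_self]
    simp

/-- The embedding `V → V ⊗ H`, `v ↦ v ⊗ Λ`. -/
def integralEmbRight (V : ModuleCat.{u} H) : V ⟶ tensorObj k V (regular H) :=
  ModuleCat.ofHom (Y := tensorObj k V (regular H)) (integralEmbRightLinear k hΛ V)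

theorem integralEmbRight_apply (V : ModuleCat.{u} H) (v : V) :
    integralEmbRight k hΛ V v = tm k V (regular H) v (toRegular Λ) := rfl

theorem integralEmbRight_injective (V : ModuleCat.{u} H) :
    Function.Injective (integralEmbRight k hΛ V) := by
  obtain ⟨φ, hφ⟩ := Module.Projective.exists_dual_ne_zero k (toRegular_ne_zero k hΛ)
  intro v w h
  have h1 := congrArg (fun z => TensorProduct.rid k V (φ.lTensor V
    ((tensorEquiv k V (regular H)).symm z))) h
  simp only [integralEmbRight_apply, tm, LinearEquiv.symm_apply_apply, LinearMap.lTensor_tmul,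
    TensorProduct.rid_tmul] at h1
  exact smul_right_injective V hφ h1

theorem exists_retraction_of_injective (J : ModuleCat.{u} H) [Injective J] (M : ModuleCat.{u} A) :
    ∃ r, integralEmb k hΛ (tensorObj k J M) ≫ r = 𝟙 _ := by
  have : Mono (integralEmb k hΛ J) :=
    (ModuleCat.mono_iff_injective _).2 (integralEmb_injective k hΛ _)
  refine ⟨(assocIso k _ _ _).inv ≫ tensorMap k (Injective.factorThru (𝟙 J) (integralEmb k hΛ J))
    (𝟙 M), ?_⟩
  rw [← integralEmb_assoc, Category.assoc, Iso.hom_inv_id_assoc, ← tensorMap_comp_id,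
    Injective.comp_factorThru, tensorMap_id_id]

variable [FiniteDimensional k H]

/-- By associativity the injective module `V ⊗ H` becomes the left factor; hence `V ⊗ -` preserves
null objects although `V` stands to the left of `H`. -/
theorem exists_retraction_tensor_regular (V : ModuleCat.{u} H) (M : ModuleCat.{u} A) :
    ∃ r, integralEmb k hΛ (tensorObj k V (tensorObj k (regular H) M)) ≫ r = 𝟙 _ := by
  have := injective_tensor_regular k V
  obtain ⟨r, hr⟩ := exists_retraction_of_injective k hΛ (tensorObj k V (regular H)) M
  refine ⟨tensorMap k (𝟙 _) (assocIso k _ _ _).inv ≫ r ≫ (assocIso k _ _ _).hom, ?_⟩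
  rw [← reassoc_of% integralEmb_naturality, reassoc_of% hr, Iso.inv_hom_id]

/-- The flip `V ⊗ H → H ⊗ V` is not `H`-linear in general. But `v ↦ v ⊗ Λ` is also an embedding of
modules, so injectivity of `H ⊗ V` yields a morphism carrying `v ⊗ Λ` to `Λ ⊗ v`. -/
theorem exists_exchange (V : ModuleCat.{u} H) (M : ModuleCat.{u} A) :
    ∃ e : tensorObj k V (tensorObj k (regular H) M) ⟶ tensorObj k (regular H) (tensorObj k V M),
      tensorMap k (𝟙 V) (integralEmb k hΛ M) ≫ e = integralEmb k hΛ (tensorObj k V M) := by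
  have := injective_regular_tensor k V
  have : Mono (integralEmbRight k hΛ V) :=
    (ModuleCat.mono_iff_injective _).2 (integralEmbRight_injective k hΛ _)
  let e := Injective.factorThru (integralEmb k hΛ V) (integralEmbRight k hΛ V)
  have he : ∀ v, e (tm k V (regular H) v (toRegular Λ)) = tm k (regular H) V (toRegular Λ) v :=
    fun v => congrArg (fun f : V ⟶ _ => f v)
      (Injective.comp_factorThru (integralEmb k hΛ V) (integralEmbRight k hΛ V))
  refine ⟨(assocIso k _ _ _).inv ≫ tensorMap k e (𝟙 M) ≫ (assocIso k _ _ _).hom,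
    tensor_hom_ext k fun v m => ?_⟩
  simp only [ModuleCat.comp_apply, tensorMap_tm, integralEmb_apply, ModuleCat.id_apply,
    assocIso_inv_tm, he, assocIso_hom_tm]

variable (C : ObjectProperty (ModuleCat.{u} A)) [IsAdmissible k H C]

theorem tensorOn_isCompatible {V : ModuleCat.{u} H} (hV : PreservesClass k V C) :
    (stableData k hΛ C).IsCompatible (stableData k hΛ C) (tensorOn k C hV) := by
  have : PreservesFiniteColimits (tensorOn k C hV) :=
    preservesFiniteColimits_of_comp_ι C (G := tensorLeft k V) (Iso.refl _)
  refine StableData.IsCompatible.of_preservesFiniteColimits _ (fun N => ?_) (fun X => ?_)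
  · obtain ⟨r, hr⟩ := exists_retraction_tensor_regular k hΛ V N.obj
    exact StableData.null_iff.2 ⟨ObjectProperty.homMk r, by ext : 1; exact hr⟩
  · obtain ⟨e, he⟩ := exists_exchange k hΛ V X.obj
    exact ⟨ObjectProperty.homMk e, by ext : 1; exact he⟩

/-- Tensoring a module in `C` with finite-dimensional `H`-modules. -/
def tensorWith (M : C.FullSubcategory) : (finDim k H).FullSubcategory ⥤ C.FullSubcategory :=
  C.lift ((finDim k H).ι ⋙ tensorRight k M.obj)
    (fun V => preservesClass_of_finDim k C V.property M.obj M.property)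

instance tensorWith_additive (M : C.FullSubcategory) :
    (tensorWith k (H := H) C M).Additive where
  map_add {_ _ f g} := by
    ext : 1
    exact tensorMap_add_left k f.hom g.hom (𝟙 M.obj)

/-- Exactness in the variable `V`: associativity identifies `(H ⊗ V) ⊗ M` with `H ⊗ (V ⊗ M)`,
compatibly with the embeddings. -/
theorem tensorWith_isCompatible (M : C.FullSubcategory) :
    (stableData k hΛ (finDim k H)).IsCompatible (stableData k hΛ C) (tensorWith k C M) := by
  have : PreservesFiniteColimits (tensorWith k (H := H) C M) :=
    preservesFiniteColimits_of_comp_ι (finDim k H) (G := tensorRight k M.obj) (Iso.refl _)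
  refine StableData.IsCompatible.of_preservesFiniteColimits _ (fun V => ?_) (fun V => ?_)
  · refine ⟨(tensorWith k C M).obj V, ObjectProperty.homMk (assocIso k _ _ _).hom,
      ObjectProperty.homMk (assocIso k _ _ _).inv, ?_⟩
    ext : 1
    exact (assocIso k (regular H) V.obj M.obj).hom_inv_id.symm
  · exact ⟨ObjectProperty.homMk (assocIso k _ _ _).hom, by
      ext : 1; exact integralEmb_assoc k hΛ V.obj M.obj⟩

end TensorFunctors

/-! ### Restriction from the smash product to `H` -/

section Restriction

variable (k H B : Type u) [Field k] [Ring H] [HopfAlgebra k H] [Ring B] [Algebra k B]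
  [RightModuleAlgebra k H B]

/-- Restriction of `H # B`-modules to `H`-modules. -/
abbrev res : ModuleCat.{u} (SmashProduct k H B) ⥤ ModuleCat.{u} H :=
  ModuleCat.restrictScalars (SmashProduct.incl k H B).toRingHom

variable {B}

/-- The underlying vector space of a restricted module. -/
def resEquiv (M : ModuleCat.{u} (SmashProduct k H B)) : M ≃ₗ[k] (res k H B).obj M where
  toFun m := m
  invFun m := m
  left_inv _ := rfl
  right_inv _ := rfl
  map_add' _ _ := rfl
  map_smul' c m := by
    change algebraMap k (SmashProduct k H B) c • m =
      SmashProduct.incl k H B (algebraMap k H c) • m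
    rw [AlgHom.commutes]

variable {H}

theorem smul_resEquiv (M : ModuleCat.{u} (SmashProduct k H B)) (h : H) (m : M) :
    h • resEquiv k H M m = resEquiv k H M (SmashProduct.incl k H B h • m) := rfl

theorem coact_incl (h : H) :
    LeftComoduleAlgebra.coact (k := k) (H := H) (SmashProduct.incl k H B h) =
      (SmashProduct.incl k H B).toLinearMap.lTensor H (Coalgebra.comul (R := k) h) := rfl

/-- Restriction commutes with tensor products. -/
def resTensorIso (V : ModuleCat.{u} H) (M : ModuleCat.{u} (SmashProduct k H B)) :
    tensorObj k V ((res k H B).obj M) ≅ (res k H B).obj (tensorObj k V M) :=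
  tensorIso k (((TensorProduct.congr (LinearEquiv.refl k V) (resEquiv k H M).symm).trans
    (tensorEquiv k V M)).trans (resEquiv k H (tensorObj k V M))) (by
      intro a v m
      obtain ⟨m, rfl⟩ := (resEquiv k H M).surjective m
      change _ = a • resEquiv k H (tensorObj k V M) (tm k V M v m)
      rw [smul_resEquiv, smul_tm, coact_incl, coact_self, LinearEquiv.trans_apply]
      congr 1
      generalize Coalgebra.comul (R := k) a = t
      induction t with
      | zero => simp
      | add x y hx hy => simp only [map_add, hx, hy]
      | tmul x y => rfl)

variable [FiniteDimensional k H] {Λ : H} (hΛ : IsLeftIntegral k Λ)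
  (C : ObjectProperty (ModuleCat.{u} (SmashProduct k H B))) [IsAdmissible k H C]

theorem res_integralEmb (M : ModuleCat.{u} (SmashProduct k H B)) :
    (res k H B).map (integralEmb k hΛ M) ≫ (resTensorIso k (regular H) M).inv =
      integralEmb k hΛ ((res k H B).obj M) := by
  rw [Iso.comp_inv_eq]
  ext m
  rfl

instance : (restrict k H B C).Additive where
  map_add {_ _ f g} := by
    ext : 1
    exact (res k H B).map_add (f := f.hom) (g := g.hom)

/-- Makes restriction exact on stable categories, so that the quasi-isomorphisms are the maps
inverted by an exact functor. -/
theorem restrict_isCompatible :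
    (stableData k hΛ C).IsCompatible (stableData k hΛ (⊤ : ObjectProperty (ModuleCat.{u} H)))
      (restrict k H B C) := by
  have : PreservesFiniteColimits (restrict k H B C) :=
    preservesFiniteColimits_of_comp_ι C (G := res k H B) (Iso.refl _)
  refine StableData.IsCompatible.of_preservesFiniteColimits _ (fun N => ?_) (fun N => ?_)
  · refine ⟨(restrict k H B C).obj N, ObjectProperty.homMk (resTensorIso k (regular H) N.obj).inv,
      ObjectProperty.homMk (resTensorIso k (regular H) N.obj).hom, ?_⟩
    ext : 1
    exact (resTensorIso k (regular H) N.obj).inv_hom_id.symm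
  · exact ⟨ObjectProperty.homMk (resTensorIso k (regular H) N.obj).inv, by
      ext : 1; exact res_integralEmb k hΛ N.obj⟩

end Restriction

/-! ### Grothendieck groups and exact functors -/

section K

open ZeroObject

variable {E : Type u₁} [Category.{v₁} E] [Preadditive E] [HasZeroObject E] [HasShift E ℤ]
  [∀ n : ℤ, (shiftFunctor E n).Additive] [Pretriangulated E]
  {S : Type u₂} [Category.{v₂} S] [Preadditive S] [HasZeroObject S] [HasShift S ℤ]
  [∀ n : ℤ, (shiftFunctor S n).Additive] [Pretriangulated S]

theorem cls_eq_of_distTriang {t : Triangle E} (ht : t ∈ distTriang E) :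
    cls t.obj₂ = cls t.obj₁ + cls t.obj₃ :=
  (QuotientAddGroup.eq_iff_sub_mem (N := triangleRelations E)).2
    (AddSubgroup.subset_closure ⟨t, ht, rfl⟩)

theorem cls_zero : cls (0 : E) = 0 := by
  have : cls (0 : E) = cls (0 : E) + cls (0 : E) :=
    cls_eq_of_distTriang (contractible_distinguished (0 : E))
  exact left_eq_add.1 this

theorem cls_eq_of_iso {X Y : E} (i : X ≅ Y) : cls X = cls Y := by
  have h : Triangle.mk i.hom (0 : Y ⟶ 0) (0 : 0 ⟶ X⟦(1 : ℤ)⟧) ∈ distTriang E :=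
    isomorphic_distinguished _ (contractible_distinguished X) _
      (triangleIso (Iso.refl X) i.symm (Iso.refl _) (by simp) (by simp) (by simp))
  have h2 : cls Y = cls X + cls (0 : E) := cls_eq_of_distTriang h
  rw [h2, cls_zero, add_zero]

theorem hom_ext_cls {G : Type*} [AddCommGroup G] {f g : GrothendieckGroup E →+ G}
    (h : ∀ X, f (cls X) = g (cls X)) : f = g :=
  QuotientAddGroup.addMonoidHom_ext (triangleRelations E) (FreeAbelianGroup.lift_ext _ _ h)

/-- An additive function on triangles extends to the Grothendieck group. -/
def liftCls {G : Type*} [AddCommGroup G] (f : E → G)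
    (hf : ∀ t ∈ distTriang E, f t.obj₂ = f t.obj₁ + f t.obj₃) : GrothendieckGroup E →+ G :=
  QuotientAddGroup.lift (triangleRelations E) (FreeAbelianGroup.lift f) (by
    intro x hx
    refine (AddSubgroup.closure_le (K := (FreeAbelianGroup.lift f).ker)).2 ?_ hx
    rintro _ ⟨t, ht, rfl⟩
    change FreeAbelianGroup.lift f _ = 0
    simp [hf t ht])

@[simp]
theorem liftCls_cls {G : Type*} [AddCommGroup G] (f : E → G) (hf) (X : E) :
    liftCls f hf (cls X) = f X :=
  FreeAbelianGroup.lift_apply_of f X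

/-- An operation on objects that is exact in both variables induces a biadditive map on
Grothendieck groups. -/
theorem exists_biadditive (a : S → E → E)
    (h₁ : ∀ X, ∃ (F : E ⥤ E) (_ : F.CommShift ℤ), F.IsTriangulated ∧
      ∀ N, Nonempty (F.obj N ≅ a X N))
    (h₂ : ∀ N, ∃ (G : S ⥤ E) (_ : G.CommShift ℤ), G.IsTriangulated ∧
      ∀ X, Nonempty (G.obj X ≅ a X N)) :
    ∃ φ : GrothendieckGroup S →+ GrothendieckGroup E →+ GrothendieckGroup E,
      ∀ X N, φ (cls X) (cls N) = cls (a X N) := by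
  have h₁' : ∀ X, ∀ t ∈ distTriang E,
      cls (a X t.obj₂) = cls (a X t.obj₁) + cls (a X t.obj₃) := by
    intro X t ht
    obtain ⟨F, _, _, hF⟩ := h₁ X
    rw [← cls_eq_of_iso (hF _).some, ← cls_eq_of_iso (hF t.obj₁).some,
      ← cls_eq_of_iso (hF t.obj₃).some]
    exact cls_eq_of_distTriang (F.map_distinguished t ht)
  have h₂' : ∀ N, ∀ t ∈ distTriang S,
      cls (a t.obj₂ N) = cls (a t.obj₁ N) + cls (a t.obj₃ N) := by
    intro N t ht
    obtain ⟨F, _, _, hF⟩ := h₂ N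
    rw [← cls_eq_of_iso (hF _).some, ← cls_eq_of_iso (hF t.obj₁).some,
      ← cls_eq_of_iso (hF t.obj₃).some]
    exact cls_eq_of_distTriang (F.map_distinguished t ht)
  refine ⟨liftCls (fun X => liftCls (fun N => cls (a X N)) (h₁' X)) (fun t ht => ?_),
    fun X N => by simp⟩
  exact hom_ext_cls fun N => by simpa using h₂' N t ht

end K

/-! ### Localization at the morphisms inverted by an exact functor -/

section Localization

open ZeroObject

variable {𝒯 : Type u₁} [Category.{v₁} 𝒯] [Preadditive 𝒯] [HasZeroObject 𝒯] [HasShift 𝒯 ℤ]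
  [∀ n : ℤ, (shiftFunctor 𝒯 n).Additive] [Pretriangulated 𝒯]
  {𝒰 : Type u₂} [Category.{v₂} 𝒰] [Preadditive 𝒰] [HasZeroObject 𝒰] [HasShift 𝒰 ℤ]
  [∀ n : ℤ, (shiftFunctor 𝒰 n).Additive] [Pretriangulated 𝒰]

theorem isZero_trW_iff {X Y : 𝒰} (f : X ⟶ Y) :
    ObjectProperty.trW (IsZero (C := 𝒰)) f ↔ IsIso f := by
  constructor
  · rw [ObjectProperty.trW_iff]
    rintro ⟨Z, g, h, hT, hZ⟩
    exact (Triangle.isZero₃_iff_isIso₁ _ hT).1 hZ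
  · intro _
    exact ObjectProperty.trW_of_isIso _ f

/-- An exact functor inverts a map exactly when it kills the cone, so `W` is the class attached to
the kernel of `F`, a triangulated subcategory. -/
theorem eq_trW_of_iff {W : MorphismProperty 𝒯} (F : 𝒯 ⥤ 𝒰) [F.CommShift ℤ] [F.IsTriangulated]
    (hW : ∀ {X Y : 𝒯} (f : X ⟶ Y), W f ↔ IsIso (F.map f)) :
    W = (ObjectProperty.inverseImage (IsZero (C := 𝒰)) F).trW := by
  ext X Y f
  rw [ObjectProperty.inverseImage_trW_iff, isZero_trW_iff, hW]

instance isTriangulated_isZero : ObjectProperty.IsTriangulated (IsZero (C := 𝒰)) where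
  exists_zero := ⟨0, isZero_zero _, isZero_zero _⟩
  isStableUnderShiftBy n := ⟨fun _ hX => (shiftFunctor 𝒰 n).map_isZero hX⟩
  toIsTriangulatedClosed₂ := .mk' fun T hT h₁ h₃ => Triangle.isZero₂_of_isZero₁₃ T hT h₁ h₃

theorem localization_instances [IsTriangulated 𝒯] {W : MorphismProperty 𝒯} (F : 𝒯 ⥤ 𝒰)
    [F.CommShift ℤ] [F.IsTriangulated]
    (hW : ∀ {X Y : 𝒯} (f : X ⟶ Y), W f ↔ IsIso (F.map f)) :
    W.HasLeftCalculusOfFractions ∧ W.HasRightCalculusOfFractions ∧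
      W.IsCompatibleWithTriangulation := by
  rw [eq_trW_of_iff F hW]
  exact ⟨inferInstance, inferInstance, inferInstance⟩

variable (W : MorphismProperty 𝒯) [W.HasLeftCalculusOfFractions] [W.IsCompatibleWithTriangulation]

/-- An exact functor that preserves `W` induces an exact functor on the localization. -/
theorem exists_localized_functor (F : 𝒯 ⥤ 𝒯) [F.CommShift ℤ] [F.IsTriangulated]
    (hF : ∀ {X Y : 𝒯} (f : X ⟶ Y), W f → W (F.map f)) :
    ∃ (G : W.Localization ⥤ W.Localization) (_ : G.CommShift ℤ),
      G.IsTriangulated ∧ Nonempty (W.Q ⋙ G ≅ F ⋙ W.Q) := by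
  have h : W.IsInvertedBy (F ⋙ W.Q) := fun X Y f hf => W.Q_inverts _ (hF f hf)
  let G := Localization.lift (F ⋙ W.Q) h W.Q
  let e : W.Q ⋙ G ≅ F ⋙ W.Q := Localization.fac _ _ _
  let : G.CommShift ℤ := Functor.commShiftOfLocalization W.Q W ℤ (F ⋙ W.Q) G
  have : NatTrans.CommShift e.hom ℤ :=
    inferInstanceAs (NatTrans.CommShift (Localization.Lifting.iso W.Q W (F ⋙ W.Q) G).hom ℤ)
  have := Localization.essSurj_mapArrow W.Q W
  exact ⟨G, inferInstance, Functor.isTriangulated_of_precomp_iso e, ⟨e⟩⟩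

end Localization

/-! ### The triangulated categories and their Grothendieck groups -/

section Main

variable (k : Type u) {H A : Type u} [Field k] [Ring H] [HopfAlgebra k H]

/-- The unit isomorphism `V ⊗ k ≅ V`. -/
def rightUnitIso (V : ModuleCat.{u} H) : tensorObj k V (trivialModule k H) ≅ V :=
  tensorIso k ((TensorProduct.congr (LinearEquiv.refl k V) (trivialEquiv k)).trans
    (TensorProduct.rid k V)) (by
      intro a v c
      have : ∀ t : H ⊗[k] H, ((TensorProduct.congr (LinearEquiv.refl k V) (trivialEquiv k)).trans
          (TensorProduct.rid k V)) (TensorProduct.map (orb k V v) (orb k (trivialModule k H) c) t) =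
          trivialEquiv k c • (TensorProduct.rid k H
            ((Coalgebra.counit (R := k) (A := H)).lTensor H t)) • v := by
        intro t
        induction t with
        | zero => simp
        | add x y hx hy => simp only [map_add, hx, hy, add_smul, smul_add]
        | tmul b h =>
          change (Coalgebra.counit (R := k) h * trivialEquiv k c) • b • v = _
          simp [smul_smul, mul_comm]
      rw [this, coact_self]
      simp [smul_comm a])

variable [FiniteDimensional k H]
  [Ring A] [Algebra k A] [LeftComoduleAlgebra k H A] {Λ : H} (hΛ : IsLeftIntegral k Λ)
  (C : ObjectProperty (ModuleCat.{u} A)) [IsAdmissible k H C]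

theorem mem_distSet_stableData_iff {r : HomRel C.FullSubcategory}
    [Preadditive (CategoryTheory.Quotient r)]
    [HasShift (CategoryTheory.Quotient r) ℤ]
    (e : (stableData k hΛ C).T ⋙ Quotient.functor r ≅
      Quotient.functor r ⋙ shiftFunctor (CategoryTheory.Quotient r) (1 : ℤ))
    (t : Triangle (CategoryTheory.Quotient r)) :
    t ∈ StableData.distSet e ↔
      ∃ (X Y Z : C.FullSubcategory) (f : X ⟶ Y) (v : Y ⟶ Z) (w : Z ⟶ (shiftT k C Λ).obj X),
        IsStandardTriangle k C hΛ f v w ∧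
        Nonempty (t ≅ Triangle.mk ((Quotient.functor r).map f) ((Quotient.functor r).map v)
          ((Quotient.functor r).map w ≫ e.hom.app X)) := by
  constructor
  · rintro ⟨X, Y, Z, f, v, w, h, i⟩
    exact ⟨X, Y, Z, f, v, w, (stableData_isCone_iff k hΛ C f v w).1 h, i⟩
  · rintro ⟨X, Y, Z, f, v, w, h, i⟩
    exact ⟨X, Y, Z, f, v, w, (stableData_isCone_iff k hΛ C f v w).2 h, i⟩

theorem exists_triangulation_stableData {r : HomRel C.FullSubcategory}
    (hr : ∀ {X Y : C.FullSubcategory} (f g : X ⟶ Y), r f g ↔ (stableData k hΛ C).Null (f - g)) :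
    ∃ (_ : Preadditive (CategoryTheory.Quotient r)) (_ : HasZeroObject (CategoryTheory.Quotient r))
      (_ : HasShift (CategoryTheory.Quotient r) ℤ)
      (_ : ∀ n : ℤ, (shiftFunctor (CategoryTheory.Quotient r) n).Additive)
      (_ : Pretriangulated (CategoryTheory.Quotient r)),
      IsTriangulated (CategoryTheory.Quotient r) ∧ (Quotient.functor r).Additive ∧
        ∃ e : (stableData k hΛ C).T ⋙ Quotient.functor r ≅
            Quotient.functor r ⋙ shiftFunctor (CategoryTheory.Quotient r) (1 : ℤ),
          distTriang (CategoryTheory.Quotient r) = StableData.distSet e :=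
  StableData.exists_triangulation hr

/-- Tensoring the modules of a class with a finite-dimensional module. -/
abbrev tensorFin (V : (finDim k H).FullSubcategory) : C.FullSubcategory ⥤ C.FullSubcategory :=
  tensorOn k C (preservesClass_of_finDim k C V.property)

/-- `(V ⊗ W) ⊗ M ≅ V ⊗ (W ⊗ M)` in a class of modules. -/
def tensorFinAssoc (V W : (finDim k H).FullSubcategory) (M : C.FullSubcategory) :
    (tensorFin k C ((tensorFin k (finDim k H) V).obj W)).obj M ≅
      (tensorFin k C V).obj ((tensorFin k C W).obj M) :=
  C.isoMk (assocIso k V.obj W.obj M.obj)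

/-- `k ⊗ M ≅ M` in a class of modules. -/
def tensorFinUnit (M : C.FullSubcategory) :
    (tensorFin k C ⟨trivialModule k H, finDim_trivialModule k H⟩).obj M ≅ M :=
  C.isoMk (unitIso k M.obj)

end Main

/-! ### Quasi-isomorphisms and tensor products -/

section Derived

variable (k H B : Type u) [Field k] [Ring H] [HopfAlgebra k H] [FiniteDimensional k H] [Ring B]
  [Algebra k B] [RightModuleAlgebra k H B] {Λ : H} (hΛ : IsLeftIntegral k Λ)
  (C : ObjectProperty (ModuleCat.{u} (SmashProduct k H B))) [IsAdmissible k H C]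

/-- Restriction on the homotopy category. -/
abbrev stableRestrict : HomotopyCat k H C ⥤ StableCat (⊤ : ObjectProperty (ModuleCat.{u} H)) :=
  (restrict_isCompatible k hΛ C).stableFunctor (stableRel_iff k hΛ ⊤) (homotopyRel_iff k hΛ C)

variable {B}

/-- The condition on one representative depends only on the homotopy class, because restriction
descends to the homotopy category. -/
theorem quasiIso_iff {X Y : HomotopyCat k H C} (f : X ⟶ Y) :
    quasiIso k H B C f ↔ IsIso ((stableRestrict k H B hΛ C).map f) := by
  constructor
  · rintro ⟨g, rfl, h⟩
    exact h
  · intro h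
    obtain ⟨g, rfl⟩ := (CategoryTheory.Quotient.functor (homotopyRel k H C)).map_surjective
      (X := X.as) (Y := Y.as) f
    exact ⟨g, rfl, h⟩

theorem restrict_tensorOn_iso {V : ModuleCat.{u} H} (hV : PreservesClass k V C) :
    Nonempty (tensorOn k C hV ⋙ restrict k H B C ≅ restrict k H B C ⋙
      tensorOn k (⊤ : ObjectProperty (ModuleCat.{u} H)) (V := V) (fun _ _ => trivial)) := by
  refine ⟨NatIso.ofComponents (fun M => (ObjectProperty.isoMk ⊤ (resTensorIso k V M.obj).symm)) ?_⟩
  intro M N f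
  ext : 1
  change (res k H B).map (tensorMap k (𝟙 V) f.hom) ≫ (resTensorIso k V N.obj).inv =
    (resTensorIso k V M.obj).inv ≫ tensorMap k (𝟙 V) ((res k H B).map f.hom)
  rw [Iso.comp_inv_eq, Category.assoc, Iso.eq_inv_comp]
  exact tensor_hom_ext k fun _ _ => rfl

/-- `V ⊗ -` commutes with restriction and is a functor on the stable category of `H`-modules, where
it preserves isomorphisms. -/
theorem quasiIso_tensorOn {V : ModuleCat.{u} H} (hV : PreservesClass k V C)
    {X Y : HomotopyCat k H C} (f : X ⟶ Y) (hf : quasiIso k H B C f) :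
    quasiIso k H B C (((tensorOn_isCompatible k hΛ C hV).stableFunctor (homotopyRel_iff k hΛ C)
      (homotopyRel_iff k hΛ C)).map f) := by
  obtain ⟨g, rfl, h⟩ := hf
  refine ⟨(tensorOn k C hV).map g, rfl, ?_⟩
  obtain ⟨j⟩ := restrict_tensorOn_iso k H C hV
  have h1 := (NatIso.isIso_map_iff (Functor.isoWhiskerRight j (toStable ⊤)) g).2 ?_
  · exact h1
  · let G := (tensorOn_isCompatible k hΛ (⊤ : ObjectProperty (ModuleCat.{u} H)) (V := V)
      (fun _ _ => trivial)).stableFunctor (stableRel_iff k hΛ ⊤) (stableRel_iff k hΛ ⊤)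
    exact (inferInstance : IsIso (G.map ((toStable ⊤).map ((restrict k H B C).map g))))

end Derived

section DerivedTriangulation

variable (k : Type u) {H B : Type u} [Field k] [Ring H] [HopfAlgebra k H] [FiniteDimensional k H]
  [Ring B] [Algebra k B] [RightModuleAlgebra k H B] {Λ : H} (hΛ : IsLeftIntegral k Λ)
  (C : ObjectProperty (ModuleCat.{u} (SmashProduct k H B))) [IsAdmissible k H C]

/-- The standard triangulation passes from the homotopy category to the derived category. -/
theorem isStandardTriangulation_toDerived [Preadditive (HomotopyCat k H C)]
    [HasZeroObject (HomotopyCat k H C)] [HasShift (HomotopyCat k H C) ℤ]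
    [∀ n : ℤ, (shiftFunctor (HomotopyCat k H C) n).Additive]
    [Pretriangulated (HomotopyCat k H C)] [IsTriangulated (HomotopyCat k H C)]
    [(Quotient.functor (homotopyRel k H C)).Additive]
    (e : (stableData k hΛ C).T ⋙ Quotient.functor (homotopyRel k H C) ≅
      Quotient.functor (homotopyRel k H C) ⋙ shiftFunctor (HomotopyCat k H C) (1 : ℤ))
    (hd : distTriang (HomotopyCat k H C) = StableData.distSet e)
    [(quasiIso k H B C).HasLeftCalculusOfFractions]
    [(quasiIso k H B C).HasRightCalculusOfFractions]
    [(quasiIso k H B C).IsCompatibleWithTriangulation] :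
    IsStandardTriangulation k C hΛ (toDerived k H B C) := by
  let W := quasiIso k H B C
  let e' : shiftT k C Λ ⋙ toDerived k H B C ≅
      toDerived k H B C ⋙ shiftFunctor (DerivedCat k H B C) (1 : ℤ) :=
    Functor.isoWhiskerRight e W.Q ≪≫
      Functor.isoWhiskerLeft (Quotient.functor (homotopyRel k H C)) (W.Q.commShiftIso (1 : ℤ))
  have he' : ∀ {Z X : C.FullSubcategory} (w : Z ⟶ (shiftT k C Λ).obj X),
      W.Q.map ((Quotient.functor (homotopyRel k H C)).map w ≫ e.hom.app X) ≫
        (W.Q.commShiftIso (1 : ℤ)).hom.app _ =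
      (toDerived k H B C).map w ≫ e'.hom.app X := fun {Z X} w =>
    (congrArg (· ≫ (W.Q.commShiftIso (1 : ℤ)).hom.app _) (W.Q.map_comp _ _)).trans
      (Category.assoc _ _ _)
  have key : ∀ {X Y Z : C.FullSubcategory} (f : X ⟶ Y) (v : Y ⟶ Z)
      (w : Z ⟶ (shiftT k C Λ).obj X),
      W.Q.mapTriangle.obj (Triangle.mk ((Quotient.functor (homotopyRel k H C)).map f)
        ((Quotient.functor (homotopyRel k H C)).map v)
        ((Quotient.functor (homotopyRel k H C)).map w ≫ e.hom.app X)) =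
      Triangle.mk ((toDerived k H B C).map f) ((toDerived k H B C).map v)
        ((toDerived k H B C).map w ≫ e'.hom.app X) := fun f v w =>
    congrArg (Triangle.mk ((toDerived k H B C).map f) ((toDerived k H B C).map v)) (he' w)
  refine ⟨inferInstance, inferInstance, e', fun t => ?_⟩
  constructor
  -- A distinguished triangle of the localization is one isomorphic to the image of a distinguished
  -- triangle.
  · rintro ⟨T', i, hT'⟩
    rw [hd, mem_distSet_stableData_iff] at hT'
    obtain ⟨X, Y, Z, f, v, w, h, ⟨j⟩⟩ := hT'
    exact ⟨X, Y, Z, f, v, w, h,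
      ⟨i ≪≫ W.Q.mapTriangle.mapIso j ≪≫ eqToIso (key f v w)⟩⟩
  · rintro ⟨X, Y, Z, f, v, w, h, ⟨j⟩⟩
    refine ⟨_, j ≪≫ eqToIso (key f v w).symm, ?_⟩
    rw [hd, mem_distSet_stableData_iff]
    exact ⟨X, Y, Z, f, v, w, h, ⟨Iso.refl _⟩⟩

/-- The derived category is triangulated, tensor products act on it by exact functors, and the
action on Grothendieck groups is biadditive. -/
theorem exists_derived_triangulation [Preadditive (StableCat (finDim k H))]
    [HasZeroObject (StableCat (finDim k H))] [HasShift (StableCat (finDim k H)) ℤ]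
    [∀ n : ℤ, (shiftFunctor (StableCat (finDim k H)) n).Additive]
    [Pretriangulated (StableCat (finDim k H))]
    (e₀ : (stableData k hΛ (finDim k H)).T ⋙ Quotient.functor (stableRel (finDim k H)) ≅
      Quotient.functor (stableRel (finDim k H)) ⋙ shiftFunctor (StableCat (finDim k H)) (1 : ℤ))
    (hd₀ : distTriang (StableCat (finDim k H)) = StableData.distSet e₀) :
    ∃ (_ : Preadditive (DerivedCat k H B C))
      (_ : HasZeroObject (DerivedCat k H B C))
      (_ : HasShift (DerivedCat k H B C) ℤ)
      (_ : ∀ n : ℤ, (shiftFunctor (DerivedCat k H B C) n).Additive)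
      (_ : Pretriangulated (DerivedCat k H B C)),
      IsStandardTriangulation k C hΛ (toDerived k H B C) ∧
      (∀ (V : ModuleCat.{u} H) (hV : PreservesClass k V C),
        ∃ F : DerivedCat k H B C ⥤ DerivedCat k H B C,
          Nonempty (toDerived k H B C ⋙ F ≅ tensorOn k C hV ⋙ toDerived k H B C) ∧
          F.Additive ∧ ∃ _ : F.CommShift ℤ, F.IsTriangulated) ∧
      ∃ φ : GrothendieckGroup (StableCat (finDim k H)) →+
          GrothendieckGroup (DerivedCat k H B C) →+ GrothendieckGroup (DerivedCat k H B C),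
        ∀ (V : (finDim k H).FullSubcategory) (M : C.FullSubcategory),
          φ (cls ((toStable (finDim k H)).obj V)) (cls ((toDerived k H B C).obj M)) =
            cls ((toDerived k H B C).obj ((tensorFin k C V).obj M)) := by
  obtain ⟨_, _, _, _, _, _, _, e₁, hd₁⟩ :=
    exists_triangulation_stableData k hΛ (⊤ : ObjectProperty (ModuleCat.{u} H))
      (stableRel_iff k hΛ ⊤)
  obtain ⟨_, _, _, _, _, _, _, e, hd⟩ :=
    exists_triangulation_stableData k hΛ C (homotopyRel_iff k hΛ C)
  obtain ⟨_, _⟩ := (restrict_isCompatible k hΛ C).exists_isTriangulated (homotopyRel_iff k hΛ C)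
    (stableRel_iff k hΛ ⊤) e e₁ hd hd₁
  obtain ⟨_, _, _⟩ := localization_instances (stableRestrict k H B hΛ C) (quasiIso_iff k H hΛ C)
  have hF : ∀ {V : ModuleCat.{u} H} (hV : PreservesClass k V C),
      ∃ (F : DerivedCat k H B C ⥤ DerivedCat k H B C) (_ : F.CommShift ℤ), F.IsTriangulated ∧
        Nonempty (toDerived k H B C ⋙ F ≅ tensorOn k C hV ⋙ toDerived k H B C) := by
    intro V hV
    obtain ⟨_, _⟩ := (tensorOn_isCompatible k hΛ C hV).exists_isTriangulated
      (homotopyRel_iff k hΛ C) (homotopyRel_iff k hΛ C) e e hd hd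
    obtain ⟨F, h1, h2, ⟨i⟩⟩ := exists_localized_functor (quasiIso k H B C)
      ((tensorOn_isCompatible k hΛ C hV).stableFunctor (homotopyRel_iff k hΛ C)
        (homotopyRel_iff k hΛ C)) (quasiIso_tensorOn k H hΛ C hV)
    exact ⟨F, h1, h2, ⟨Functor.isoWhiskerLeft (Quotient.functor (homotopyRel k H C)) i⟩⟩
  refine ⟨inferInstance, inferInstance, inferInstance, inferInstance, inferInstance,
    isStandardTriangulation_toDerived k hΛ C e hd, fun V hV => ?_, ?_⟩
  · obtain ⟨F, h1, h2, h3⟩ := hF hV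
    exact ⟨F, h3, inferInstance, h1, h2⟩
  -- Localizing does not change the objects, so each object of the derived category is a module of
  -- the class.
  · let M : DerivedCat k H B C → C.FullSubcategory := fun N =>
      ((Localization.Construction.objEquiv (quasiIso k H B C)).symm N).as
    have hM : ∀ N, (toDerived k H B C).obj (M N) = N := fun N =>
      (Localization.Construction.objEquiv (quasiIso k H B C)).apply_symm_apply N
    have h₁ : ∀ V : StableCat (finDim k H), ∃ (F : DerivedCat k H B C ⥤ DerivedCat k H B C)
        (_ : F.CommShift ℤ), F.IsTriangulated ∧ ∀ N, Nonempty (F.obj N ≅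
          (toDerived k H B C).obj ((tensorFin k C V.as).obj (M N))) := by
      intro V
      obtain ⟨F, h1, h2, ⟨i⟩⟩ := hF (preservesClass_of_finDim k C V.as.property)
      exact ⟨F, h1, h2, fun N => ⟨eqToIso (congrArg F.obj (hM N).symm) ≪≫ i.app (M N)⟩⟩
    have h₂ : ∀ N : DerivedCat k H B C, ∃ (G : StableCat (finDim k H) ⥤ DerivedCat k H B C)
        (_ : G.CommShift ℤ), G.IsTriangulated ∧ ∀ V, Nonempty (G.obj V ≅
          (toDerived k H B C).obj ((tensorFin k C V.as).obj (M N))) := by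
      intro N
      obtain ⟨_, _⟩ := (tensorWith_isCompatible k hΛ C (M N)).exists_isTriangulated
        (stableRel_iff k hΛ (finDim k H)) (homotopyRel_iff k hΛ C) e₀ e hd₀ hd
      exact ⟨(tensorWith_isCompatible k hΛ C (M N)).stableFunctor (homotopyRel_iff k hΛ C)
        (stableRel_iff k hΛ (finDim k H)) ⋙ (quasiIso k H B C).Q, inferInstance, inferInstance,
        fun V => ⟨Iso.refl _⟩⟩
    obtain ⟨φ, hφ⟩ := exists_biadditive _ h₁ h₂
    exact ⟨φ, fun V X => hφ _ _⟩

end DerivedTriangulation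

/-! ### The ring structure -/

section Ring

variable {E : Type u₁} [Category.{v₁} E] [Preadditive E] [HasZeroObject E] [HasShift E ℤ]
  [∀ n : ℤ, (shiftFunctor E n).Additive] [Pretriangulated E]
  {S : Type u₂} [Category.{v₂} S] [Preadditive S] [HasZeroObject S] [HasShift S ℤ]
  [∀ n : ℤ, (shiftFunctor S n).Additive] [Pretriangulated S]

/-- Both sides are additive in each variable, so classes of objects are replaced by arbitrary
elements one variable at a time. -/
theorem assoc_of_assoc_cls {φ : GrothendieckGroup S →+ GrothendieckGroup S →+ GrothendieckGroup S}
    {ψ : GrothendieckGroup S →+ GrothendieckGroup E →+ GrothendieckGroup E}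
    (h : ∀ X Y N, ψ (φ (cls X) (cls Y)) (cls N) = ψ (cls X) (ψ (cls Y) (cls N)))
    (x y : GrothendieckGroup S) (z : GrothendieckGroup E) : ψ (φ x y) z = ψ x (ψ y z) := by
  have h₁ (X Y : S) (z) : ψ (φ (cls X) (cls Y)) z = ψ (cls X) (ψ (cls Y) z) :=
    DFunLike.congr_fun (hom_ext_cls (f := ψ (φ (cls X) (cls Y)))
      (g := (ψ (cls X)).comp (ψ (cls Y))) (h X Y)) z
  have h₂ (X : S) (y z) : ψ (φ (cls X) y) z = ψ (cls X) (ψ y z) :=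
    DFunLike.congr_fun (hom_ext_cls (f := (ψ.flip z).comp (φ (cls X)))
      (g := (ψ (cls X)).comp (ψ.flip z)) (fun Y => h₁ X Y z)) y
  exact DFunLike.congr_fun (hom_ext_cls (f := (ψ.flip z).comp (φ.flip y))
    (g := ψ.flip (ψ y z)) (fun X => h₂ X y z)) x

/-- A biadditive multiplication on a Grothendieck group that is associative and unital on classes
of objects defines a ring. -/
theorem exists_ring (φ : GrothendieckGroup S →+ GrothendieckGroup S →+ GrothendieckGroup S) (I : S)
    (hassoc : ∀ X Y Z : S, φ (φ (cls X) (cls Y)) (cls Z) = φ (cls X) (φ (cls Y) (cls Z)))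
    (hone : ∀ X, φ (cls I) (cls X) = cls X) (hone' : ∀ X, φ (cls X) (cls I) = cls X) :
    ∃ R : Ring (GrothendieckGroup S),
      R.toAddCommGroup = instAddCommGroupGrothendieckGroup S ∧ 1 = cls I ∧
        ∀ x y : GrothendieckGroup S, x * y = φ x y := by
  have h1 : φ (cls I) = AddMonoidHom.id _ := hom_ext_cls hone
  have h2 : φ.flip (cls I) = AddMonoidHom.id _ := hom_ext_cls hone'
  exact ⟨{ instAddCommGroupGrothendieckGroup S with
    mul := fun x y => φ x y
    one := cls I
    left_distrib := fun x y z => map_add (φ x) y z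
    right_distrib := fun x y z => DFunLike.congr_fun (map_add φ x y) z
    zero_mul := fun x => DFunLike.congr_fun (map_zero φ) x
    mul_zero := fun x => map_zero (φ x)
    one_mul := fun x => DFunLike.congr_fun h1 x
    mul_one := fun x => DFunLike.congr_fun h2 x
    mul_assoc := assoc_of_assoc_cls hassoc }, rfl, rfl, fun _ _ => rfl⟩

/-- A biadditive action that is associative and unital on classes of objects defines a module. -/
theorem exists_module {φ : GrothendieckGroup S →+ GrothendieckGroup S →+ GrothendieckGroup S}
    {I : S} (ψ : GrothendieckGroup S →+ GrothendieckGroup E →+ GrothendieckGroup E)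
    (hassoc : ∀ X Y N, ψ (φ (cls X) (cls Y)) (cls N) = ψ (cls X) (ψ (cls Y) (cls N)))
    (hone : ∀ N, ψ (cls I) (cls N) = cls N) {R : Ring (GrothendieckGroup S)}
    (hR : R.toAddCommGroup = instAddCommGroupGrothendieckGroup S) (hI : 1 = cls I)
    (hφ : ∀ x y : GrothendieckGroup S, x * y = φ x y) :
    ∃ _ : Module (GrothendieckGroup S) (GrothendieckGroup E),
      ∀ (x : GrothendieckGroup S) (n : GrothendieckGroup E), x • n = ψ x n := by
  have h1 : ψ (cls I) = AddMonoidHom.id _ := hom_ext_cls hone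
  have h2 := assoc_of_assoc_cls hassoc
  -- `R` carries a second addition, equal to the original only through `hR`. Additivity is stated
  -- while `R` is out of scope, and `ψ` becomes a bare function of its first argument before
  -- rewriting along `hR`.
  revert R
  have hadd (x y n) : ψ (x + y) n = ψ x n + ψ y n := DFunLike.congr_fun (map_add ψ x y) n
  have hzero (n) : ψ 0 n = 0 := DFunLike.congr_fun (map_zero ψ) n
  intro R hR hI hφ
  obtain ⟨ψ', hψ⟩ : ∃ ψ' : GrothendieckGroup S → GrothendieckGroup E →+ GrothendieckGroup E,
      ∀ x, ψ x = ψ' x := ⟨ψ, fun _ => rfl⟩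
  simp only [hψ] at *
  rw [← hR] at hadd hzero
  exact ⟨{
    smul := fun x n => ψ' x n
    one_smul := fun n => (congrArg (fun x => ψ' x n) hI).trans (DFunLike.congr_fun h1 n)
    mul_smul := fun x y n => (congrArg (fun x => ψ' x n) (hφ x y)).trans (h2 x y n)
    smul_zero := fun x => map_zero (ψ' x)
    smul_add := fun x => map_add (ψ' x)
    add_smul := hadd
    zero_smul := hzero }, fun _ _ => rfl⟩

end Ring

end Hopfological

end

theorem mainTheorem3 (k H B : Type u) [Field k] [Ring H] [HopfAlgebra k H] [FiniteDimensional k H]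
    [Ring B] [Algebra k B] [RightModuleAlgebra k H B] :
    (∃ Λ : H, IsLeftIntegral k Λ) ∧
    ∀ (Λ : H) (hΛ : IsLeftIntegral k Λ),
    -- the stable category of finite-dimensional `H`-modules is triangulated ...
    ∃ (_ : Preadditive (StableCat (finDim k H)))
      (_ : HasZeroObject (StableCat (finDim k H)))
      (_ : HasShift (StableCat (finDim k H)) ℤ)
      (_ : ∀ n : ℤ, (shiftFunctor (StableCat (finDim k H)) n).Additive)
      (_ : Pretriangulated (StableCat (finDim k H))),
      IsStandardTriangulation k (finDim k H) hΛ (toStable (finDim k H)) ∧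
    -- ... and its Grothendieck group is a ring under the tensor product
    ∃ R : Ring (GrothendieckGroup (StableCat (finDim k H))),
      R.toAddCommGroup = instAddCommGroupGrothendieckGroup (StableCat (finDim k H)) ∧
      (1 = cls ((toStable (finDim k H)).obj ⟨trivialModule k H, finDim_trivialModule k H⟩)) ∧
      (∀ V W : (finDim k H).FullSubcategory,
        cls ((toStable (finDim k H)).obj V) * cls ((toStable (finDim k H)).obj W) =
          cls ((toStable (finDim k H)).obj
            ((tensorOn k (finDim k H)
              (preservesClass_of_finDim k (finDim k H) V.property)).obj W))) ∧
    -- for every admissible class of `H # B`-modules (e.g. all modules),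
    ∀ (C : ObjectProperty (ModuleCat.{u} (SmashProduct k H B))) [IsAdmissible k H C],
    -- the derived category is triangulated,
    ∃ (_ : Preadditive (DerivedCat k H B C))
      (_ : HasZeroObject (DerivedCat k H B C))
      (_ : HasShift (DerivedCat k H B C) ℤ)
      (_ : ∀ n : ℤ, (shiftFunctor (DerivedCat k H B C) n).Additive)
      (_ : Pretriangulated (DerivedCat k H B C)),
      IsStandardTriangulation k C hΛ (toDerived k H B C) ∧
      -- tensoring with an `H`-module induces an exact functor on it,
      (∀ (V : ModuleCat.{u} H) (hV : PreservesClass k V C),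
        ∃ F : DerivedCat k H B C ⥤ DerivedCat k H B C,
          Nonempty (toDerived k H B C ⋙ F ≅ tensorOn k C hV ⋙ toDerived k H B C) ∧
          F.Additive ∧ ∃ _ : F.CommShift ℤ, F.IsTriangulated) ∧
      -- and its Grothendieck group is a module over that of the stable category
      ∃ _ : Module (GrothendieckGroup (StableCat (finDim k H)))
          (GrothendieckGroup (DerivedCat k H B C)),
        ∀ (V : (finDim k H).FullSubcategory) (M : C.FullSubcategory),
          cls ((toStable (finDim k H)).obj V) • cls ((toDerived k H B C).obj M) =
            cls ((toDerived k H B C).obj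
              ((tensorOn k C (preservesClass_of_finDim k C V.property)).obj M)) := by
  refine ⟨exists_isLeftIntegral k H, fun Λ hΛ => ?_⟩
  obtain ⟨_, _, _, _, _, hT, hA, e₀, hd₀⟩ :=
    exists_triangulation_stableData k hΛ (finDim k H) (stableRel_iff k hΛ (finDim k H))
  let S := StableCat (finDim k H)
  let Q := toStable (finDim k H)
  -- Exactness in the second factor comes from `tensorOn`, in the first from `tensorWith`; on
  -- objects both induced functors are the tensor product itself.
  obtain ⟨φ, hφ⟩ := exists_biadditive (S := S) (E := S)
    (fun V W => Q.obj ((tensorFin k (finDim k H) V.as).obj W.as))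
    (fun V => by
      obtain ⟨h1, h2⟩ := (tensorOn_isCompatible k hΛ (finDim k H) (preservesClass_of_finDim k
        (finDim k H) V.as.property)).exists_isTriangulated (stableRel_iff k hΛ (finDim k H))
          (stableRel_iff k hΛ (finDim k H)) e₀ e₀ hd₀ hd₀
      exact ⟨_, h1, h2, fun W => ⟨Iso.refl _⟩⟩)
    (fun W => by
      obtain ⟨h1, h2⟩ := (tensorWith_isCompatible k hΛ (finDim k H) W.as).exists_isTriangulated
        (stableRel_iff k hΛ (finDim k H)) (stableRel_iff k hΛ (finDim k H)) e₀ e₀ hd₀ hd₀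
      exact ⟨_, h1, h2, fun V => ⟨Iso.refl _⟩⟩)
  let I : (finDim k H).FullSubcategory := ⟨trivialModule k H, finDim_trivialModule k H⟩
  obtain ⟨R, hR, hone, hmul⟩ := exists_ring φ (Q.obj I)
    (fun X Y Z => by
      rw [hφ, hφ, hφ, hφ]
      exact cls_eq_of_iso (Q.mapIso (tensorFinAssoc k (finDim k H) X.as Y.as Z.as)))
    (fun X => (hφ _ _).trans (cls_eq_of_iso (Q.mapIso (tensorFinUnit k (finDim k H) X.as))))
    (fun X => (hφ _ _).trans
      (cls_eq_of_iso (Q.mapIso ((finDim k H).isoMk (rightUnitIso k X.as.obj)))))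
  refine ⟨_, _, _, _, _, ⟨hT, hA, e₀, fun t => ?_⟩, R, hR, hone,
    fun V W => (hmul _ _).trans (hφ _ _), fun C _ => ?_⟩
  · rw [hd₀]
    exact mem_distSet_stableData_iff k hΛ (finDim k H) e₀ t
  · obtain ⟨_, _, _, _, _, h1, h2, ψ, hψ⟩ := exists_derived_triangulation k hΛ C e₀ hd₀
    have hobj : ∀ N : DerivedCat k H B C, ∃ M, (toDerived k H B C).obj M = N := fun N =>
      ⟨((Localization.Construction.objEquiv (quasiIso k H B C)).symm N).as,
        (Localization.Construction.objEquiv (quasiIso k H B C)).apply_symm_apply N⟩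
    obtain ⟨m, hm⟩ := exists_module ψ
      (fun X Y N => by
        obtain ⟨M, rfl⟩ := hobj N
        rw [hφ]
        refine (hψ _ M).trans ((cls_eq_of_iso ((toDerived k H B C).mapIso
          (tensorFinAssoc k C X.as Y.as M))).trans ?_)
        exact (hψ X.as _).symm.trans (congrArg (ψ (cls X)) (hψ Y.as M).symm))
      (fun N => by
        obtain ⟨M, rfl⟩ := hobj N
        exact (hψ I M).trans (cls_eq_of_iso ((toDerived k H B C).mapIso (tensorFinUnit k C M))))
      hR hone hmul
    exact ⟨_, _, _, _, _, h1, h2, m, fun V M => (hm _ _).trans (hψ V M)⟩
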